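/- Let $M$ be a smooth finite-dimensional manifold (Hausdorff, second countable, without boundary). A bundle gerbe $(P,Y)$ over $M$ consists of a smooth surjective submersion $\pi\colon Y\to M$, a smooth principal $U(1)$ bundle $P\to Y^{[2]}=Y\times_M Y$, and a smooth isomorphism of $U(1)$ bundles over $Y^{[3]}$ with fibres $P_{(y_1,y_2)}\otimes P_{(y_2,y_3)}\to P_{(y_1,y_3)}$ which is associative over $Y^{[4]}$. For a $U(1)$ bundle $R\to Y$ let $\delta(R)\to Y^{[2]}$ be the bundle with fibres $\delta(R)_{(y_1,y_2)}=R_{y_1}\otimes R_{y_2}^*$, with the contraction as multiplication; $(P,Y)$ is trivial if it is isomorphic, compatibly with the multiplications, to $(\delta(R),Y)$ for some $R$. Put $(P,Y)^*=(P^*,Y)$ and $(P,Y)\otimes(Q,X)=(P\otimes Q,\,Y\times_M X)$, where $(P\otimes Q)_{((y_1,x_1),(y_2,x_2))}=P_{(y_1,y_2)}\otimes Q_{(x_1,x_2)}$. Two bundle gerbes $(P,Y)$, $(Q,X)$ over $M$ are stably isomorphic if $(P,Y)^*\otimes(Q,X)$ is trivial. The Dixmier--Douady class $DD(P,Y)\in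 H^3(M,\mathbb Z)$ is defined as follows (with $H^*$ Čech cohomology). Choose an open cover $\{U_\alpha\}$ of $M$ with smooth local sections $s_\alpha\colon U_\alpha\to Y$ of $\pi$, smooth sections $\sigma_{\alpha\beta}$ of $(s_\alpha,s_\beta)^*P$ over $U_\alpha\cap U_\beta$, and smooth functions $\theta_{\alpha\beta\gamma}\colon U_\alpha\cap U_\beta\cap U_\gamma\to\mathbb R$ with $g_{\alpha\beta\gamma}=\exp(2\pi i\,\theta_{\alpha\beta\gamma})$, where $g_{\alpha\beta\gamma}$ is defined by $m(\sigma_{\alpha\beta},\sigma_{\beta\gamma})=g_{\alpha\beta\gamma}\,\sigma_{\alpha\gamma}$ ($m$ being the multiplication). Then $DD(P,Y)$ is the class of the integer cocycle $\theta_{\beta\gamma\delta}-\theta_{\alpha\gamma\delta}+\theta_{\alpha\beta\delta}-\theta_{\alpha\beta\gamma}$, i.e. the image of $[g_{\alpha\beta\gamma}]\in H^2(M,U(1))$ in $H^3(M,\mathbb Z)$. Proposition. The class $DD(P,Y)$ exists and does not depend on the choices. Bundle gerbes $(P,Y)$ and $(Q,X)$ over $M$ are stably isomorphic if and only if $DD(P,Y)=DD(Q,X)$.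 Stable isomorphism is an equivalence relation, and $DD$ induces a bijection from the set of stable isomorphism classes of bundle gerbes over $M$ onto $H^3(M,\mathbb Z)$. -/

import Mathlib

open scoped Manifold ContDiff
universe u

noncomputable section

open Set Manifold

/-! ### Surjective submersions and their fibre products -/

/-- A surjective submersion `proj : Y → M` onto an `n`-manifold `M`, from a smooth manifold `Y`
(Hausdorff, second countable, without boundary, modelled on a finite-dimensional space `E`). -/
structure SurjSubmersion (n : ℕ) (M : Type u) [TopologicalSpace M]
    [ChartedSpace (EuclideanSpace ℝ (Fin n)) M] : Type (u + 1) where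
  E : Type
  [normE : NormedAddCommGroup E]
  [spaceE : NormedSpace ℝ E]
  [finE : FiniteDimensional ℝ E]
  Y : Type u
  [topY : TopologicalSpace Y]
  [chartY : ChartedSpace E Y]
  [smoothY : IsManifold 𝓘(ℝ, E) ∞ Y]
  [t2Y : T2Space Y]
  [countableY : SecondCountableTopology Y]
  proj : Y → M
  isSubmersion : IsSubmersion 𝓘(ℝ, E) (𝓡 n) ∞ proj
  surjective : Function.Surjective proj

namespace SurjSubmersion

attribute [instance] normE spaceE finE topY chartY smoothY t2Y countableY

variable {n : ℕ} {M : Type u} [TopologicalSpace M]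
  [ChartedSpace (EuclideanSpace ℝ (Fin n)) M]

theorem exists_compl (S : SurjSubmersion n M) :
    ∃ (F : Type) (_ : NormedAddCommGroup F) (_ : NormedSpace ℝ F),
      FiniteDimensional ℝ F ∧ IsSubmersionOfComplement F 𝓘(ℝ, S.E) (𝓡 n) ∞ S.proj := by
  obtain ⟨F, i1, i2, h⟩ := S.isSubmersion
  by_cases hY : Nonempty S.Y
  · obtain ⟨y⟩ := hY
    refine ⟨F, i1, i2, ?_, h⟩
    have e := (h y).equiv
    exact FiniteDimensional.of_surjective
      ((LinearMap.snd ℝ (EuclideanSpace ℝ (Fin n)) F) ∘ₗ e.toLinearEquiv.toLinearMap)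
      (Prod.snd_surjective.comp e.surjective)
  · exact ⟨PUnit, inferInstance, inferInstance, inferInstance, fun y => (hY ⟨y⟩).elim⟩

/-- A choice of complement `F`, with `E ≃ ℝⁿ × F`. -/
def Compl (S : SurjSubmersion n M) : Type := S.exists_compl.choose

instance (S : SurjSubmersion n M) : NormedAddCommGroup S.Compl :=
  S.exists_compl.choose_spec.choose

instance (S : SurjSubmersion n M) : NormedSpace ℝ S.Compl :=
  S.exists_compl.choose_spec.choose_spec.choose

instance (S : SurjSubmersion n M) : FiniteDimensional ℝ S.Compl :=
  S.exists_compl.choose_spec.choose_spec.choose_spec.1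

theorem submersion (S : SurjSubmersion n M) :
    IsSubmersionOfComplement S.Compl 𝓘(ℝ, S.E) (𝓡 n) ∞ S.proj :=
  S.exists_compl.choose_spec.choose_spec.choose_spec.2

theorem contMDiff_proj (S : SurjSubmersion n M) : ContMDiff 𝓘(ℝ, S.E) (𝓡 n) ∞ S.proj :=
  S.submersion.contMDiff

/-- Submersion chart on the total space. -/
def upChart (S : SurjSubmersion n M) (y : S.Y) : OpenPartialHomeomorph S.Y S.E :=
  (S.submersion y).domChart

/-- Submersion chart on the base. -/
def downChart (S : SurjSubmersion n M) (y : S.Y) :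
    OpenPartialHomeomorph M (EuclideanSpace ℝ (Fin n)) :=
  (S.submersion y).codChart

/-- The linear splitting in which the submersion is the first projection. -/
def split (S : SurjSubmersion n M) (y : S.Y) :
    S.E ≃L[ℝ] EuclideanSpace ℝ (Fin n) × S.Compl :=
  (S.submersion y).equiv

theorem mapsTo (S : SurjSubmersion n M) (y : S.Y) {z : S.Y} (hz : z ∈ (S.upChart y).source) :
    S.proj z ∈ (S.downChart y).source :=
  (S.submersion y).source_subset_preimage_source hz

theorem chart_proj (S : SurjSubmersion n M) (y : S.Y) {z : S.Y}
    (hz : z ∈ (S.upChart y).source) :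
    S.downChart y (S.proj z) = (S.split y (S.upChart y z)).1 := by
  have hz' : S.upChart y z ∈ ((S.submersion y).domChart.extend 𝓘(ℝ, S.E)).target := by
    rw [OpenPartialHomeomorph.extend_target]
    exact ⟨by simpa [upChart] using (S.upChart y).map_source hz, by simp⟩
  have h := (S.submersion y).writtenInCharts hz'
  have hl : (S.submersion y).domChart.symm (S.upChart y z) = z := (S.upChart y).left_inv hz
  simpa [downChart, split, hl] using h

section FiberProduct

variable (S T : SurjSubmersion n M)

/-- The fibre product `Y ×_M X`, the pairs `(y, x)` over the same point of `M`. -/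
@[ext]
structure FiberProd : Type u where
  fst : S.Y
  snd : T.Y
  comm : S.proj fst = T.proj snd

/-- The inclusion of the fibre product in the product. -/
def incl (q : FiberProd S T) : S.Y × T.Y := (q.fst, q.snd)

instance : TopologicalSpace (FiberProd S T) := TopologicalSpace.induced (incl S T) inferInstance

theorem isEmbedding_incl : Topology.IsEmbedding (incl S T) where
  eq_induced := rfl
  injective _ _ h := FiberProd.ext (congrArg Prod.fst h) (congrArg Prod.snd h)

instance : T2Space (FiberProd S T) := (isEmbedding_incl S T).t2Space
instance : SecondCountableTopology (FiberProd S T) :=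
  (isEmbedding_incl S T).secondCountableTopology

theorem continuous_fst' : Continuous (FiberProd.fst : FiberProd S T → S.Y) :=
  continuous_fst.comp (isEmbedding_incl S T).continuous
theorem continuous_snd' : Continuous (FiberProd.snd : FiberProd S T → T.Y) :=
  continuous_snd.comp (isEmbedding_incl S T).continuous

variable {S T}

/-- The first coordinate recovered from the fibre coordinate `v` and the second point. -/
def solve (y : S.Y) (v : S.Compl) (x : T.Y) : S.E :=
  (S.split y).symm (S.downChart y (T.proj x), v)

/-- The set where the inverse of the fibre product chart is defined. -/
def prodTarget (q : FiberProd S T) : Set (S.Compl × T.E) :=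
  {w | w.2 ∈ (T.upChart q.snd).target ∧
    T.proj ((T.upChart q.snd).symm w.2) ∈ (S.downChart q.fst).source ∧
    solve q.fst w.1 ((T.upChart q.snd).symm w.2) ∈ (S.upChart q.fst).target}

theorem proj_solve {y : S.Y} {v : S.Compl} {x : T.Y} (hx : T.proj x ∈ (S.downChart y).source)
    (h : solve y v x ∈ (S.upChart y).target) :
    S.proj ((S.upChart y).symm (solve y v x)) = T.proj x := by
  have h1 := (S.upChart y).map_target h
  apply (S.downChart y).injOn (S.mapsTo y h1) hx
  rw [S.chart_proj y h1, (S.upChart y).right_inv h]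
  simp [solve]

theorem contMDiffOn_upChart (S : SurjSubmersion n M) (y : S.Y) :
    ContMDiffOn 𝓘(ℝ, S.E) 𝓘(ℝ, S.E) ∞ (S.upChart y) (S.upChart y).source :=
  contMDiffOn_of_mem_maximalAtlas (S.submersion y).domChart_mem_maximalAtlas

theorem contMDiffOn_upChart_symm (S : SurjSubmersion n M) (y : S.Y) :
    ContMDiffOn 𝓘(ℝ, S.E) 𝓘(ℝ, S.E) ∞ (S.upChart y).symm (S.upChart y).target :=
  contMDiffOn_symm_of_mem_maximalAtlas (S.submersion y).domChart_mem_maximalAtlas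

theorem contMDiffOn_downChart [IsManifold (𝓡 n) ∞ M] (S : SurjSubmersion n M) (y : S.Y) :
    ContMDiffOn (𝓡 n) (𝓡 n) ∞ (S.downChart y) (S.downChart y).source :=
  contMDiffOn_of_mem_maximalAtlas (S.submersion y).codChart_mem_maximalAtlas

theorem isOpen_prodTarget (q : FiberProd S T) : IsOpen (prodTarget q) := by
  have h1 : ContinuousOn (fun w : S.Compl × T.E => T.proj ((T.upChart q.snd).symm w.2))
      {w | w.2 ∈ (T.upChart q.snd).target} :=
    T.contMDiff_proj.continuous.comp_continuousOn
      ((T.upChart q.snd).continuousOn_symm.comp continuous_snd.continuousOn fun w hw => hw)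
  have o1 : IsOpen {w : S.Compl × T.E | w.2 ∈ (T.upChart q.snd).target} :=
    (T.upChart q.snd).open_target.preimage continuous_snd
  have o2 := h1.isOpen_inter_preimage o1 (S.downChart q.fst).open_source
  have h2 : ContinuousOn (fun w : S.Compl × T.E =>
      solve q.fst w.1 ((T.upChart q.snd).symm w.2))
      ({w | w.2 ∈ (T.upChart q.snd).target} ∩
        (fun w : S.Compl × T.E => T.proj ((T.upChart q.snd).symm w.2)) ⁻¹'
          (S.downChart q.fst).source) := by
    refine (S.split q.fst).symm.continuous.comp_continuousOn (ContinuousOn.prodMk ?_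
      continuous_fst.continuousOn)
    exact (S.downChart q.fst).continuousOn.comp (h1.mono inter_subset_left) fun w hw => hw.2
  have o3 := h2.isOpen_inter_preimage o2 (S.upChart q.fst).open_target
  convert o3 using 1
  ext w
  simp [prodTarget, and_assoc]

theorem contMDiffOn_solve [IsManifold (𝓡 n) ∞ M] (q : FiberProd S T) :
    ContMDiffOn 𝓘(ℝ, S.Compl × T.E) 𝓘(ℝ, S.E) ∞
      (fun w => (S.upChart q.fst).symm (solve q.fst w.1 ((T.upChart q.snd).symm w.2)))
      (prodTarget q) := by
  have hf : ContMDiff 𝓘(ℝ, S.Compl × T.E) 𝓘(ℝ, S.Compl) ∞ (Prod.fst : S.Compl × T.E → S.Compl) :=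
    contDiff_fst.contMDiff
  have hs : ContMDiff 𝓘(ℝ, S.Compl × T.E) 𝓘(ℝ, T.E) ∞ (Prod.snd : S.Compl × T.E → T.E) :=
    contDiff_snd.contMDiff
  have hl : ContMDiff 𝓘(ℝ, EuclideanSpace ℝ (Fin n) × S.Compl) 𝓘(ℝ, S.E) ∞
      (S.split q.fst).symm := (S.split q.fst).symm.contDiff.contMDiff
  refine (S.contMDiffOn_upChart_symm q.fst).comp (t := (S.upChart q.fst).target) ?_
    fun w hw => hw.2.2
  refine hl.comp_contMDiffOn (ContMDiffOn.prodMk_space ?_ hf.contMDiffOn)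
  refine (S.contMDiffOn_downChart q.fst).comp (t := (S.downChart q.fst).source) ?_
    fun w hw => hw.2.1
  refine T.contMDiff_proj.comp_contMDiffOn ?_
  exact (T.contMDiffOn_upChart_symm q.snd).comp hs.contMDiffOn fun w hw => hw.1

theorem contMDiffOn_second (q : FiberProd S T) :
    ContMDiffOn 𝓘(ℝ, S.Compl × T.E) 𝓘(ℝ, T.E) ∞
      (fun w => (T.upChart q.snd).symm w.2) (prodTarget q) := by
  have hs : ContMDiff 𝓘(ℝ, S.Compl × T.E) 𝓘(ℝ, T.E) ∞ (Prod.snd : S.Compl × T.E → T.E) :=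
    contDiff_snd.contMDiff
  exact (T.contMDiffOn_upChart_symm q.snd).comp hs.contMDiffOn fun w hw => hw.1

theorem solve_eq (q r : FiberProd S T) (h : r.fst ∈ (S.upChart q.fst).source) :
    solve q.fst (S.split q.fst (S.upChart q.fst r.fst)).2 r.snd = S.upChart q.fst r.fst := by
  rw [solve, ← r.comm, S.chart_proj q.fst h]
  simp

/-- The chart of the fibre product around `q`, as a map: a fibre coordinate of the first point,
together with all coordinates of the second one. -/
def prodMap (q r : FiberProd S T) : S.Compl × T.E :=
  ((S.split q.fst (S.upChart q.fst r.fst)).2, T.upChart q.snd r.snd)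

open Classical in
/-- The inverse of the chart of the fibre product around `q`. -/
def prodInv (q : FiberProd S T) (w : S.Compl × T.E) : FiberProd S T :=
  if h : w ∈ prodTarget q then
    ⟨(S.upChart q.fst).symm (solve q.fst w.1 ((T.upChart q.snd).symm w.2)),
      (T.upChart q.snd).symm w.2, proj_solve h.2.1 h.2.2⟩ else q

theorem prodInv_fst (q : FiberProd S T) {w : S.Compl × T.E} (hw : w ∈ prodTarget q) :
    (prodInv q w).fst =
      (S.upChart q.fst).symm (solve q.fst w.1 ((T.upChart q.snd).symm w.2)) := by
  simp [prodInv, hw]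

theorem prodInv_snd (q : FiberProd S T) {w : S.Compl × T.E} (hw : w ∈ prodTarget q) :
    (prodInv q w).snd = (T.upChart q.snd).symm w.2 := by
  simp [prodInv, hw]

theorem prodMap_mem (q : FiberProd S T) {r : FiberProd S T}
    (h1 : r.fst ∈ (S.upChart q.fst).source) (h2 : r.snd ∈ (T.upChart q.snd).source) :
    prodMap q r ∈ prodTarget q := by
  refine ⟨(T.upChart q.snd).map_source h2, ?_, ?_⟩
  · simp only [prodMap, (T.upChart q.snd).left_inv h2]
    rw [← r.comm]
    exact S.mapsTo _ h1
  · simp only [prodMap, (T.upChart q.snd).left_inv h2]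
    rw [solve_eq q r h1]
    exact (S.upChart q.fst).map_source h1

variable [IsManifold (𝓡 n) ∞ M]

/-- The chart of the fibre product around `q`. -/
def prodChart (q : FiberProd S T) : OpenPartialHomeomorph (FiberProd S T) (S.Compl × T.E) where
  toFun := prodMap q
  invFun := prodInv q
  source := {r | r.fst ∈ (S.upChart q.fst).source ∧ r.snd ∈ (T.upChart q.snd).source}
  target := prodTarget q
  map_source' := fun _ h => prodMap_mem q h.1 h.2
  map_target' := by
    intro w hw
    rw [mem_ofPred_eq, prodInv_fst q hw, prodInv_snd q hw]
    exact ⟨(S.upChart q.fst).map_target hw.2.2, (T.upChart q.snd).map_target hw.1⟩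
  left_inv' := by
    rintro r ⟨h1, h2⟩
    have hw := prodMap_mem q h1 h2
    refine FiberProd.ext ?_ ?_
    · rw [prodInv_fst q hw]
      simp only [prodMap, (T.upChart q.snd).left_inv h2]
      rw [solve_eq q r h1, (S.upChart q.fst).left_inv h1]
    · rw [prodInv_snd q hw]
      exact (T.upChart q.snd).left_inv h2
  right_inv' := by
    intro w hw
    refine Prod.ext ?_ ?_
    · simp only [prodMap]
      rw [prodInv_fst q hw, (S.upChart q.fst).right_inv hw.2.2]
      simp [solve]
    · simp only [prodMap]
      rw [prodInv_snd q hw]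
      exact (T.upChart q.snd).right_inv hw.1
  open_source :=
    ((S.upChart q.fst).open_source.preimage (continuous_fst' S T)).inter
      ((T.upChart q.snd).open_source.preimage (continuous_snd' S T))
  open_target := isOpen_prodTarget q
  continuousOn_toFun := by
    refine ContinuousOn.prodMk ?_ ?_
    · refine (continuous_snd.comp (S.split q.fst).continuous).comp_continuousOn ?_
      exact (S.upChart q.fst).continuousOn.comp (continuous_fst' S T).continuousOn
        fun r hr => hr.1
    · exact (T.upChart q.snd).continuousOn.comp (continuous_snd' S T).continuousOn
        fun r hr => hr.2
  continuousOn_invFun := by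
    refine (isEmbedding_incl S T).continuousOn_iff.2 ?_
    refine ((contMDiffOn_solve q).continuousOn.prodMk (contMDiffOn_second q).continuousOn).congr ?_
    intro w hw
    exact Prod.ext (prodInv_fst q hw) (prodInv_snd q hw)

theorem prodChart_symm_apply (q : FiberProd S T) (w : S.Compl × T.E) :
    (prodChart q).symm w = prodInv q w := rfl

theorem prodChart_target (q : FiberProd S T) : (prodChart q).target = prodTarget q := rfl

instance : ChartedSpace (S.Compl × T.E) (FiberProd S T) where
  atlas := range prodChart
  chartAt := prodChart
  mem_chart_source q :=
    ⟨(S.submersion q.fst).mem_domChart_source, (T.submersion q.snd).mem_domChart_source⟩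
  chart_mem_atlas q := ⟨q, rfl⟩

theorem contMDiffOn_chart_comp {E' N : Type*} [NormedAddCommGroup E'] [NormedSpace ℝ E']
    [TopologicalSpace N] [ChartedSpace E' N] {U : Set N} {f : N → FiberProd S T}
    (h1 : ContMDiffOn 𝓘(ℝ, E') 𝓘(ℝ, S.E) ∞ (fun z => (f z).fst) U)
    (h2 : ContMDiffOn 𝓘(ℝ, E') 𝓘(ℝ, T.E) ∞ (fun z => (f z).snd) U) (q : FiberProd S T) :
    ContMDiffOn 𝓘(ℝ, E') 𝓘(ℝ, S.Compl × T.E) ∞ (fun z => prodChart q (f z))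
      (U ∩ f ⁻¹' (prodChart q).source) := by
  have hl : ContMDiff 𝓘(ℝ, S.E) 𝓘(ℝ, S.Compl) ∞ (fun e => (S.split q.fst e).2) :=
    (contDiff_snd.comp (S.split q.fst).contDiff).contMDiff
  refine ContMDiffOn.prodMk_space ?_ ?_
  · refine hl.comp_contMDiffOn ?_
    exact (S.contMDiffOn_upChart q.fst).comp (h1.mono inter_subset_left) fun z hz => hz.2.1
  · exact (T.contMDiffOn_upChart q.snd).comp (h2.mono inter_subset_left) fun z hz => hz.2.2

instance : IsManifold 𝓘(ℝ, S.Compl × T.E) ∞ (FiberProd S T) := by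
  apply isManifold_of_contDiffOn
  rintro _ _ ⟨q, rfl⟩ ⟨r, rfl⟩
  have h := contMDiffOn_chart_comp (U := prodTarget q) (f := (prodChart q).symm)
    ((contMDiffOn_solve q).congr fun w hw => prodInv_fst q hw)
    ((contMDiffOn_second q).congr fun w hw => prodInv_snd q hw) r
  rw [contMDiffOn_iff_contDiffOn] at h
  refine h.mono ?_
  intro w hw
  simpa [prodChart_target] using hw

theorem contMDiff_val_fst : ContMDiff 𝓘(ℝ, S.Compl × T.E) 𝓘(ℝ, S.E) ∞
    (fun q : FiberProd S T => q.fst) := by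
  intro q
  have h1 : ContMDiffOn 𝓘(ℝ, S.Compl × T.E) 𝓘(ℝ, S.E) ∞
      (fun q : FiberProd S T => q.fst) (prodChart q).source := by
    refine ((contMDiffOn_solve q).comp
      (contMDiffOn_of_mem_maximalAtlas (e := prodChart q)
        (IsManifold.chart_mem_maximalAtlas (I := 𝓘(ℝ, S.Compl × T.E)) q))
      fun r hr => (prodChart q).map_source hr).congr ?_
    intro r hr
    have h := prodInv_fst q ((prodChart q).map_source hr)
    rw [← prodChart_symm_apply, (prodChart q).left_inv hr] at h
    exact h
  exact h1.contMDiffAt ((prodChart q).open_source.mem_nhds (mem_chart_source _ q))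

theorem contMDiff_val_snd : ContMDiff 𝓘(ℝ, S.Compl × T.E) 𝓘(ℝ, T.E) ∞
    (fun q : FiberProd S T => q.snd) := by
  intro q
  have h1 : ContMDiffOn 𝓘(ℝ, S.Compl × T.E) 𝓘(ℝ, T.E) ∞
      (fun q : FiberProd S T => q.snd) (prodChart q).source := by
    refine ((contMDiffOn_second q).comp
      (contMDiffOn_of_mem_maximalAtlas (e := prodChart q)
        (IsManifold.chart_mem_maximalAtlas (I := 𝓘(ℝ, S.Compl × T.E)) q))
      fun r hr => (prodChart q).map_source hr).congr ?_
    intro r hr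
    have h := prodInv_snd q ((prodChart q).map_source hr)
    rw [← prodChart_symm_apply, (prodChart q).left_inv hr] at h
    exact h
  exact h1.contMDiffAt ((prodChart q).open_source.mem_nhds (mem_chart_source _ q))

theorem contMDiff_to_fiberProd {E' N : Type*} [NormedAddCommGroup E'] [NormedSpace ℝ E']
    [TopologicalSpace N] [ChartedSpace E' N] {f : N → FiberProd S T}
    (h1 : ContMDiff 𝓘(ℝ, E') 𝓘(ℝ, S.E) ∞ (fun z => (f z).fst))
    (h2 : ContMDiff 𝓘(ℝ, E') 𝓘(ℝ, T.E) ∞ (fun z => (f z).snd)) :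
    ContMDiff 𝓘(ℝ, E') 𝓘(ℝ, S.Compl × T.E) ∞ f := by
  have hc : Continuous f :=
    (isEmbedding_incl S T).continuous_iff.2 (h1.continuous.prodMk h2.continuous)
  intro z
  have h3 := contMDiffOn_chart_comp (U := univ) h1.contMDiffOn h2.contMDiffOn (f z)
  have hm : z ∈ univ ∩ f ⁻¹' (prodChart (f z)).source := 
    ⟨trivial, show f z ∈ (prodChart (f z)).source from mem_chart_source _ (f z)⟩
  have ho : IsOpen (univ ∩ f ⁻¹' (prodChart (f z)).source) :=
    isOpen_univ.inter ((prodChart (f z)).open_source.preimage hc)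
  have h4 := (contMDiffOn_symm_of_mem_maximalAtlas (e := prodChart (f z))
        (IsManifold.chart_mem_maximalAtlas (I := 𝓘(ℝ, S.Compl × T.E)) (n := ∞) (f z))).comp h3
        fun r hr => (prodChart (f z)).map_source hr.2
  refine (h4.congr fun r hr => ?_).contMDiffAt (ho.mem_nhds hm)
  exact ((prodChart (f z)).left_inv hr.2).symm

/-- Splitting of the model of the fibre product. -/
def prodSplit (x : T.Y) :
    (S.Compl × T.E) ≃L[ℝ] EuclideanSpace ℝ (Fin n) × (S.Compl × T.Compl) :=
  ((ContinuousLinearEquiv.refl ℝ S.Compl).prodCongr (T.split x)).trans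
    (((ContinuousLinearEquiv.prodAssoc ℝ _ _ _).symm.trans
      ((ContinuousLinearEquiv.prodComm ℝ _ _).prodCongr
        (ContinuousLinearEquiv.refl ℝ T.Compl))).trans
      (ContinuousLinearEquiv.prodAssoc ℝ _ _ _))

variable (S T) in
theorem fiberProd_isSubmersion : IsSubmersion 𝓘(ℝ, S.Compl × T.E) (𝓡 n) ∞
    (fun q : FiberProd S T => T.proj q.snd) := by
  refine ⟨S.Compl × T.Compl, inferInstance, inferInstance, fun q => ?_⟩
  refine IsSubmersionAtOfComplement.mk_of_charts (prodSplit q.snd) (prodChart q)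
    (T.downChart q.snd) (mem_chart_source _ q) (T.submersion q.snd).mem_codChart_source
    (IsManifold.chart_mem_maximalAtlas (I := 𝓘(ℝ, S.Compl × T.E)) q)
    (T.submersion q.snd).codChart_mem_maximalAtlas (fun r hr => T.mapsTo _ hr.2) ?_
  intro w hw
  have hw' : w ∈ prodTarget q := by simpa [prodChart_target] using hw
  have h1 := T.chart_proj q.snd ((T.upChart q.snd).map_target hw'.1)
  rw [(T.upChart q.snd).right_inv hw'.1] at h1
  simp only [Function.comp_apply, OpenPartialHomeomorph.extend_coe,
    OpenPartialHomeomorph.extend_coe_symm, modelWithCornersSelf_coe, modelWithCornersSelf_coe_symm, id]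
  rw [prodChart_symm_apply, prodInv_snd q hw']
  exact h1

variable (S T) in
/-- The fibre product `Y ×_M X → M` of two surjective submersions. -/
def fiberProd : SurjSubmersion n M where
  E := S.Compl × T.E
  Y := FiberProd S T
  proj q := T.proj q.snd
  isSubmersion := fiberProd_isSubmersion S T
  surjective m := by
    obtain ⟨y, hy⟩ := S.surjective m
    obtain ⟨x, hx⟩ := T.surjective m
    exact ⟨⟨y, x, hy.trans hx.symm⟩, hx⟩

end FiberProduct
end SurjSubmersion

/-! ### Principal `U(1)` bundles -/

/-- The relation `(p, q) ~ (z • p, z⁻¹ • q)` on a product of two `U(1)`-torsors. -/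
def tensorSetoid (A B : Type u) [Torsor Circle A] [Torsor Circle B] : Setoid (A × B) where
  r x y := ∃ z : Circle, y.1 = z • x.1 ∧ x.2 = z • y.2
  iseqv :=
    { refl := fun x => ⟨1, by simp, by simp⟩
      symm := by
        rintro x y ⟨z, h1, h2⟩
        exact ⟨z⁻¹, by rw [h1, inv_smul_smul], by rw [h2, inv_smul_smul]⟩
      trans := by
        rintro x y w ⟨z, h1, h2⟩ ⟨z', h3, h4⟩
        exact ⟨z * z', by rw [h3, h1, smul_smul, mul_comm], by rw [h2, h4, smul_smul]⟩ }

/-- The product `A ⊗ B` of two `U(1)`-torsors. -/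
def TensorFib (A B : Type u) [Torsor Circle A] [Torsor Circle B] : Type u :=
  Quotient (tensorSetoid A B)

namespace TensorFib

variable {A B C : Type u} [Torsor Circle A] [Torsor Circle B] [Torsor Circle C]

/-- The class `[a, b]`. -/
def mk (a : A) (b : B) : TensorFib A B := Quotient.mk (tensorSetoid A B) (a, b)

theorem mk_smul_left (z : Circle) (a : A) (b : B) : mk (z • a) b = mk a (z • b) :=
  (Quotient.sound (s := tensorSetoid A B) (⟨z, rfl, rfl⟩ :
    ∃ w : Circle, (z • a, b).1 = w • (a, z • b).1 ∧ (a, z • b).2 = w • (z • a, b).2)).symm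

/-- A biequivariant map out of a product of torsors. -/
def lift (f : A → B → C) (h1 : ∀ (z : Circle) a b, f (z • a) b = z • f a b)
    (h2 : ∀ (z : Circle) a b, f a (z • b) = z • f a b) : TensorFib A B → C :=
  Quotient.lift (fun x : A × B => f x.1 x.2) (by
    rintro ⟨a, b⟩ ⟨a', b'⟩ ⟨z, h, h'⟩
    simp only at h h' ⊢
    rw [h, h', h1, h2])

@[simp] theorem lift_mk (f : A → B → C) (h1 h2) (a : A) (b : B) :
    lift f h1 h2 (mk a b) = f a b := rfl

theorem ind {p : TensorFib A B → Prop} (h : ∀ a b, p (mk a b)) (x : TensorFib A B) : p x :=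
  Quotient.ind (fun ⟨a, b⟩ => h a b) x

instance : Torsor Circle (TensorFib A B) where
  smul z := Quotient.lift (fun x : A × B => mk (z • x.1) x.2) (by
    rintro ⟨a, b⟩ ⟨a', b'⟩ ⟨w, h, h'⟩
    simp only at h h' ⊢
    rw [h, h', ← mk_smul_left, smul_comm])
  one_smul := ind fun a b => congrArg (fun a => mk a b) (one_smul Circle a)
  mul_smul z w := ind fun a b => congrArg (fun a => mk a b) (mul_smul z w a)
  sdiv := Quotient.lift₂ (fun x y : A × B => (x.1 /ₛ y.1) * (x.2 /ₛ y.2)) (by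
    rintro ⟨a, b⟩ ⟨c, d⟩ ⟨a', b'⟩ ⟨c', d'⟩ ⟨z, h1, h2⟩ ⟨w, h3, h4⟩
    simp only at h1 h2 h3 h4 ⊢
    rw [h1, h2, h3, h4, smul_sdiv_smul_comm, smul_sdiv_smul_comm, mul_left_comm, mul_assoc])
  nonempty := ⟨mk (Classical.arbitrary A) (Classical.arbitrary B)⟩
  sdiv_smul' := ind fun a b => ind fun c d => by
    change mk (((a /ₛ c) * (b /ₛ d)) • c) d = mk a b
    rw [mul_comm, mul_smul, sdiv_smul, mk_smul_left, sdiv_smul]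
  smul_sdiv' z := ind fun a b => by
    change ((z • a) /ₛ a) * (b /ₛ b) = z
    simp

theorem smul_mk (z : Circle) (a : A) (b : B) : z • mk a b = mk (z • a) b := rfl

theorem smul_mk' (z : Circle) (a : A) (b : B) : z • mk a b = mk a (z • b) := by
  rw [smul_mk, mk_smul_left]

theorem mk_sdiv_mk (a a' : A) (b b' : B) : mk a b /ₛ mk a' b' = (a /ₛ a') * (b /ₛ b') := rfl

/-- The biequivariant map `([a, b], [a', b']) ↦ [f a a', g b b']`. -/
def mulMap {A' B' A'' B'' : Type u} [Torsor Circle A'] [Torsor Circle B'] [Torsor Circle A'']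
    [Torsor Circle B''] (f : A → A' → A'') (g : B → B' → B'')
    (f1 : ∀ (z : Circle) a a', f (z • a) a' = z • f a a')
    (f2 : ∀ (z : Circle) a a', f a (z • a') = z • f a a')
    (g1 : ∀ (z : Circle) b b', g (z • b) b' = z • g b b')
    (g2 : ∀ (z : Circle) b b', g b (z • b') = z • g b b') :
    TensorFib A B → TensorFib A' B' → TensorFib A'' B'' := fun x y =>
  lift (fun a b => lift (fun a' b' => mk (f a a') (g b b'))
      (fun z a' b' => by rw [f2, smul_mk]) (fun z a' b' => by rw [g2, smul_mk']) y)
    (fun z a b => by revert y; exact ind fun a' b' => by simp [f1, smul_mk])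
    (fun z a b => by revert y; exact ind fun a' b' => by simp [g1, smul_mk']) x

end TensorFib

/-- The dual `A*` of a `U(1)`-torsor: the same set with the inverse action. -/
structure DualFib (A : Type u) : Type u where
  of ::
  val : A

namespace DualFib

variable {A : Type u} [Torsor Circle A]

instance : Torsor Circle (DualFib A) where
  smul z x := ⟨z⁻¹ • x.val⟩
  one_smul x := congrArg of (by simp)
  mul_smul z w x := congrArg of (by
    change (z * w)⁻¹ • x.val = z⁻¹ • w⁻¹ • x.val
    rw [mul_inv, mul_smul])
  sdiv x y := y.val /ₛ x.val
  nonempty := ⟨⟨Classical.arbitrary A⟩⟩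
  sdiv_smul' x y := congrArg of (by
    rw [inv_smul_eq_iff, sdiv_smul])
  smul_sdiv' z x := by
    change x.val /ₛ (z⁻¹ • x.val) = z
    rw [sdiv_smul_eq_sdiv_div, sdiv_self, one_div, inv_inv]

theorem smul_of (z : Circle) (a : A) : z • of a = of (z⁻¹ • a) := rfl
theorem of_sdiv_of (a b : A) : of a /ₛ of b = b /ₛ a := rfl

end DualFib

/-- The contraction `(A ⊗ B*) ⊗ (B ⊗ C*) → A ⊗ C*`. -/
def TensorFib.contract {A B C : Type u} [Torsor Circle A] [Torsor Circle B] [Torsor Circle C] :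
    TensorFib A (DualFib B) → TensorFib B (DualFib C) → TensorFib A (DualFib C) := fun x y =>
  lift (fun a b => lift (fun b' c => (b' /ₛ b.val) • mk a c)
      (fun z b' c => by rw [smul_sdiv_assoc, mul_smul])
      (fun z b' c => by rw [← smul_mk', smul_comm]) y)
    (fun z a b => by
      revert y
      refine ind fun b' c => ?_
      rw [lift_mk, lift_mk, ← smul_mk, smul_comm])
    (fun z a b => by
      revert y
      refine ind fun b' c => ?_
      change (b' /ₛ (z⁻¹ • b.val)) • mk a c = z • (b' /ₛ b.val) • mk a c
      rw [sdiv_smul_eq_sdiv_div, div_inv_eq_mul, mul_comm, mul_smul]) x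

theorem TensorFib.contract_mk {A B C : Type u} [Torsor Circle A] [Torsor Circle B]
    [Torsor Circle C] (a : A) (b b' : B) (c : DualFib C) :
    contract (mk a (DualFib.of b)) (mk b' c) = (b' /ₛ b) • mk a c := rfl

theorem TensorFib.contract_smul_left {A B C : Type u} [Torsor Circle A] [Torsor Circle B]
    [Torsor Circle C] (z : Circle) (x : TensorFib A (DualFib B)) (y : TensorFib B (DualFib C)) :
    contract (z • x) y = z • contract x y := by
  revert x y
  refine ind fun a b => ind fun b' c => ?_
  obtain ⟨b⟩ := b
  rw [smul_mk, contract_mk, contract_mk, ← smul_mk, smul_comm]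

theorem TensorFib.contract_smul_right {A B C : Type u} [Torsor Circle A] [Torsor Circle B]
    [Torsor Circle C] (z : Circle) (x : TensorFib A (DualFib B)) (y : TensorFib B (DualFib C)) :
    contract x (z • y) = z • contract x y := by
  revert x y
  refine ind fun a b => ind fun b' c => ?_
  obtain ⟨b⟩ := b
  rw [smul_mk, contract_mk, contract_mk, smul_sdiv_assoc, mul_smul]

theorem TensorFib.contract_assoc {A B C D : Type u} [Torsor Circle A] [Torsor Circle B]
    [Torsor Circle C] [Torsor Circle D] (x : TensorFib A (DualFib B))
    (y : TensorFib B (DualFib C)) (w : TensorFib C (DualFib D)) :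
    contract (contract x y) w = contract x (contract y w) := by
  revert x y w
  refine ind fun a b => ind fun b' c => ind fun c' d => ?_
  obtain ⟨b⟩ := b
  obtain ⟨c⟩ := c
  rw [contract_mk, contract_mk, contract_smul_left, contract_smul_right, contract_mk, contract_mk,
    smul_comm]

/-- A smooth principal `U(1)` bundle `P → B`, given by its fibres `P_b`, which are `U(1)`-torsors,
and an atlas of local sections (each with an open domain; its values elsewhere play no role) whose
domains cover `B` and whose transition functions are smooth. -/
structure U1Bundle (E : Type) [NormedAddCommGroup E] [NormedSpace ℝ E]
    (B : Type u) [TopologicalSpace B] [ChartedSpace E B] : Type (u + 1) where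
  Fib : B → Type u
  [torsor : ∀ b, Torsor Circle (Fib b)]
  atlas : Set (TopologicalSpace.Opens B × ∀ b, Fib b)
  cover : ∀ b, ∃ s ∈ atlas, b ∈ s.1
  compat : ∀ s ∈ atlas, ∀ t ∈ atlas, ContMDiffOn 𝓘(ℝ, E) (𝓡 1) ∞
    (fun b => s.2 b /ₛ t.2 b) (s.1 ∩ t.1 : Set B)

namespace U1Bundle

attribute [instance] torsor

variable {E : Type} [NormedAddCommGroup E] [NormedSpace ℝ E]
  {B : Type u} [TopologicalSpace B] [ChartedSpace E B]
  {E' : Type} [NormedAddCommGroup E'] [NormedSpace ℝ E']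
  {B' : Type u} [TopologicalSpace B'] [ChartedSpace E' B']

/-- A section is smooth on `U` if its ratios to the sections of the atlas are smooth. -/
def SmoothOn (P : U1Bundle E B) (s : ∀ b, P.Fib b) (U : Set B) : Prop :=
  ∀ t ∈ P.atlas, ContMDiffOn 𝓘(ℝ, E) (𝓡 1) ∞ (fun b => s b /ₛ t.2 b) (U ∩ t.1)

theorem smoothOn_of_mem (P : U1Bundle E B) {s} (hs : s ∈ P.atlas) : P.SmoothOn s.2 s.1 :=
  fun t ht => P.compat s hs t ht

theorem SmoothOn.mono {P : U1Bundle E B} {s : ∀ b, P.Fib b} {U V : Set B}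
    (h : P.SmoothOn s U) (hV : V ⊆ U) : P.SmoothOn s V :=
  fun t ht => (h t ht).mono (inter_subset_inter_left _ hV)

theorem SmoothOn.sdiv {P : U1Bundle E B} {s t : ∀ b, P.Fib b} {U : Set B}
    (hs : P.SmoothOn s U) (ht : P.SmoothOn t U) :
    ContMDiffOn 𝓘(ℝ, E) (𝓡 1) ∞ (fun b => s b /ₛ t b) U := by
  intro b hb
  obtain ⟨a, ha, hba⟩ := P.cover b
  have h := ((hs a ha).mul (ht a ha).inv b ⟨hb, hba⟩)
  have h' := h.congr (f₁ := fun b => s b /ₛ t b) (fun c _ => by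
    change _ = (s c /ₛ a.2 c) * (t c /ₛ a.2 c)⁻¹
    rw [inv_sdiv_eq_sdiv_rev, sdiv_mul_sdiv_cancel]) (by
    change _ = (s b /ₛ a.2 b) * (t b /ₛ a.2 b)⁻¹
    rw [inv_sdiv_eq_sdiv_rev, sdiv_mul_sdiv_cancel])
  exact h'.mono_of_mem_nhdsWithin (inter_mem_nhdsWithin _ (a.1.isOpen.mem_nhds hba))

theorem SmoothOn.of_sdiv {P : U1Bundle E B} {s t : ∀ b, P.Fib b} {U : Set B}
    (ht : P.SmoothOn t U) (h : ContMDiffOn 𝓘(ℝ, E) (𝓡 1) ∞ (fun b => s b /ₛ t b) U) :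
    P.SmoothOn s U := by
  intro a ha
  refine ((h.mono inter_subset_left).mul (ht a ha)).congr fun b _ => ?_
  simp

theorem smoothOn_of_locally {P : U1Bundle E B} {s : ∀ b, P.Fib b} {U : Set B}
    (h : ∀ b ∈ U, ∃ V : Set B, IsOpen V ∧ b ∈ V ∧ P.SmoothOn s (U ∩ V)) : P.SmoothOn s U := by
  intro a ha b hb
  obtain ⟨V, hV, hbV, hs⟩ := h b hb.1
  refine (hs a ha b ⟨⟨hb.1, hbV⟩, hb.2⟩).mono_of_mem_nhdsWithin ?_
  filter_upwards [inter_mem_nhdsWithin _ (hV.mem_nhds hbV)] with c hc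
  exact ⟨⟨hc.1.1, hc.2⟩, hc.1.2⟩

/-- The pullback `f^*P`. -/
def pullback (P : U1Bundle E B) (f : B' → B) (hf : ContMDiff 𝓘(ℝ, E') 𝓘(ℝ, E) ∞ f) :
    U1Bundle E' B' where
  Fib b := P.Fib (f b)
  atlas := (fun s => (⟨f ⁻¹' s.1, s.1.isOpen.preimage hf.continuous⟩, fun b => s.2 (f b))) ''
    P.atlas
  cover b := by
    obtain ⟨s, hs, hb⟩ := P.cover (f b)
    exact ⟨_, mem_image_of_mem _ hs, hb⟩
  compat := by
    rintro _ ⟨s, hs, rfl⟩ _ ⟨t, ht, rfl⟩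
    exact (P.compat s hs t ht).comp hf.contMDiffOn fun b hb => hb

theorem SmoothOn.pullback {P : U1Bundle E B} {f : B' → B}
    (hf : ContMDiff 𝓘(ℝ, E') 𝓘(ℝ, E) ∞ f) {s : ∀ b, P.Fib b} {U : Set B} (hs : P.SmoothOn s U) :
    (P.pullback f hf).SmoothOn (fun b => s (f b)) (f ⁻¹' U) := by
  rintro _ ⟨t, ht, rfl⟩
  exact (hs t ht).comp hf.contMDiffOn fun b hb => hb

/-- The dual bundle `P*`. -/
def dual (P : U1Bundle E B) : U1Bundle E B where
  Fib b := DualFib (P.Fib b)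
  atlas := (fun s => (s.1, fun b => DualFib.of (s.2 b))) '' P.atlas
  cover b := by
    obtain ⟨s, hs, hb⟩ := P.cover b
    exact ⟨_, mem_image_of_mem _ hs, hb⟩
  compat := by
    rintro _ ⟨s, hs, rfl⟩ _ ⟨t, ht, rfl⟩
    exact (P.compat t ht s hs).mono fun b hb => ⟨hb.2, hb.1⟩

theorem SmoothOn.dual {P : U1Bundle E B} {s : ∀ b, P.Fib b} {U : Set B} (hs : P.SmoothOn s U) :
    P.dual.SmoothOn (fun b => DualFib.of (s b)) U := by
  rintro _ ⟨t, ht, rfl⟩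
  exact (SmoothOn.sdiv ((P.smoothOn_of_mem ht).mono inter_subset_right)
    (hs.mono (inter_subset_left (t := (t.1 : Set B)))))

/-- The product bundle `P ⊗ Q`. -/
def tensor (P Q : U1Bundle E B) : U1Bundle E B where
  Fib b := TensorFib (P.Fib b) (Q.Fib b)
  atlas := image2 (fun s t => (s.1 ⊓ t.1, fun b => TensorFib.mk (s.2 b) (t.2 b))) P.atlas Q.atlas
  cover b := by
    obtain ⟨s, hs, hb⟩ := P.cover b
    obtain ⟨t, ht, hb'⟩ := Q.cover b
    exact ⟨_, mem_image2_of_mem hs ht, hb, hb'⟩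
  compat := by
    rintro _ ⟨s, hs, t, ht, rfl⟩ _ ⟨s', hs', t', ht', rfl⟩
    exact ((P.compat s hs s' hs').mono fun b hb => ⟨hb.1.1, hb.2.1⟩).mul
      ((Q.compat t ht t' ht').mono fun b hb => ⟨hb.1.2, hb.2.2⟩)

theorem SmoothOn.tensor {P Q : U1Bundle E B} {s : ∀ b, P.Fib b} {t : ∀ b, Q.Fib b} {U : Set B}
    (hs : P.SmoothOn s U) (ht : Q.SmoothOn t U) :
    (P.tensor Q).SmoothOn (fun b => TensorFib.mk (s b) (t b)) U := by
  rintro _ ⟨s', hs', t', ht', rfl⟩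
  exact ((hs s' hs').mono fun b hb => ⟨hb.1, hb.2.1⟩).mul
      ((ht t' ht').mono fun b hb => ⟨hb.1, hb.2.2⟩)

theorem SmoothOn.dual_pullback {P : U1Bundle E B} {f : B' → B}
    (hf : ContMDiff 𝓘(ℝ, E') 𝓘(ℝ, E) ∞ f) {s : ∀ b, P.Fib (f b)} {U : Set B'}
    (hs : (P.pullback f hf).SmoothOn s U) :
    (P.dual.pullback f hf).SmoothOn (fun b => DualFib.of (s b)) U := by
  rintro _ ⟨_, ⟨t, ht, rfl⟩, rfl⟩
  exact SmoothOn.sdiv (P := P.pullback f hf)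
    (((P.smoothOn_of_mem ht).pullback hf).mono inter_subset_right) (hs.mono inter_subset_left)

theorem SmoothOn.tensor_pullback {P Q : U1Bundle E B} {f : B' → B}
    (hf : ContMDiff 𝓘(ℝ, E') 𝓘(ℝ, E) ∞ f) {s : ∀ b, P.Fib (f b)} {t : ∀ b, Q.Fib (f b)}
    {U : Set B'} (hs : (P.pullback f hf).SmoothOn s U) (ht : (Q.pullback f hf).SmoothOn t U) :
    ((P.tensor Q).pullback f hf).SmoothOn (fun b => TensorFib.mk (s b) (t b)) U := by
  rintro _ ⟨_, ⟨s', hs', t', ht', rfl⟩, rfl⟩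
  exact ((hs _ (mem_image_of_mem _ hs')).mono fun b hb => ⟨hb.1, hb.2.1⟩).mul
      ((ht _ (mem_image_of_mem _ ht')).mono fun b hb => ⟨hb.1, hb.2.2⟩)

/-- A smooth isomorphism of `U(1)` bundles over the identity of `B`: a fibrewise `U(1)`-equivariant
map taking smooth local sections to smooth local sections. As the fibres are torsors, such a map is
bijective and its inverse is again smooth. -/
structure Iso (P Q : U1Bundle E B) where
  toFun : ∀ b, P.Fib b → Q.Fib b
  map_smul : ∀ b (z : Circle) (p : P.Fib b), toFun b (z • p) = z • toFun b p
  smooth : ∀ (U : TopologicalSpace.Opens B) (s : ∀ b, P.Fib b), P.SmoothOn s U →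
    Q.SmoothOn (fun b => toFun b (s b)) U

theorem map_sdiv {A C : Type u} [Torsor Circle A] [Torsor Circle C] (f : A → C)
    (hf : ∀ (z : Circle) a, f (z • a) = z • f a) (a b : A) : f a /ₛ f b = a /ₛ b := by
  apply smul_right_cancel (f b)
  rw [sdiv_smul, ← hf, sdiv_smul]

/-- An equivariant map which is smooth on some local sections is smooth. -/
def Iso.ofLocal {P Q : U1Bundle E B} (f : ∀ b, P.Fib b → Q.Fib b)
    (hf : ∀ b (z : Circle) (p : P.Fib b), f b (z • p) = z • f b p)
    (h : ∀ b, ∃ (V : Set B) (t : ∀ b, P.Fib b), IsOpen V ∧ b ∈ V ∧ P.SmoothOn t V ∧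
      Q.SmoothOn (fun b => f b (t b)) V) : Iso P Q where
  toFun := f
  map_smul := hf
  smooth U s hs := by
    apply smoothOn_of_locally
    intro b hb
    obtain ⟨V, t, hV, hbV, ht, hft⟩ := h b
    refine ⟨V, hV, hbV, (hft.mono inter_subset_right).of_sdiv ?_⟩
    refine ((hs.mono inter_subset_left).sdiv (ht.mono inter_subset_right)).congr fun c _ => ?_
    exact map_sdiv (f c) (hf c) _ _

/-- A biequivariant map which is smooth on some local sections defines an isomorphism from
the product bundle. -/
def Iso.ofBilinear {P Q R : U1Bundle E B} (f : ∀ b, P.Fib b → Q.Fib b → R.Fib b)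
    (h1 : ∀ b (z : Circle) p q, f b (z • p) q = z • f b p q)
    (h2 : ∀ b (z : Circle) p q, f b p (z • q) = z • f b p q)
    (h : ∀ b, ∃ (V : Set B) (s : ∀ b, P.Fib b) (t : ∀ b, Q.Fib b), IsOpen V ∧ b ∈ V ∧
      P.SmoothOn s V ∧ Q.SmoothOn t V ∧ R.SmoothOn (fun b => f b (s b) (t b)) V) :
    Iso (P.tensor Q) R :=
  Iso.ofLocal (fun b => TensorFib.lift (f b) (h1 b) (h2 b))
    (fun b z => TensorFib.ind fun p q => h1 b z p q)
    (fun b => by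
      obtain ⟨V, s, t, hV, hb, hs, ht, hf⟩ := h b
      exact ⟨V, fun b => TensorFib.mk (s b) (t b), hV, hb, hs.tensor ht, hf⟩)

end U1Bundle

/-! ### Iterated fibre products -/

namespace SurjSubmersion

variable {n : ℕ} {M : Type u} [TopologicalSpace M]
  [ChartedSpace (EuclideanSpace ℝ (Fin n)) M] [IsManifold (𝓡 n) ∞ M]
  (S T : SurjSubmersion n M)

/-- The first projection `Y ×_M X → Y`. -/
def fst : (S.fiberProd T).Y → S.Y := FiberProd.fst

/-- The second projection `Y ×_M X → X`. -/
def snd : (S.fiberProd T).Y → T.Y := FiberProd.snd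

theorem contMDiff_fst : ContMDiff 𝓘(ℝ, (S.fiberProd T).E) 𝓘(ℝ, S.E) ∞ (S.fst T) :=
  contMDiff_val_fst

theorem contMDiff_snd : ContMDiff 𝓘(ℝ, (S.fiberProd T).E) 𝓘(ℝ, T.E) ∞ (S.snd T) :=
  contMDiff_val_snd

variable {S T} in
theorem contMDiff_of_comp {E' N : Type*} [NormedAddCommGroup E'] [NormedSpace ℝ E']
    [TopologicalSpace N] [ChartedSpace E' N] {f : N → (S.fiberProd T).Y}
    (h1 : ContMDiff 𝓘(ℝ, E') 𝓘(ℝ, S.E) ∞ (fun z => S.fst T (f z)))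
    (h2 : ContMDiff 𝓘(ℝ, E') 𝓘(ℝ, T.E) ∞ (fun z => S.snd T (f z))) :
    ContMDiff 𝓘(ℝ, E') 𝓘(ℝ, (S.fiberProd T).E) ∞ f :=
  contMDiff_to_fiberProd h1 h2

/-- `Y^[2]`. -/
def sq : SurjSubmersion n M := S.fiberProd S

/-- `Y^[3]`, as `Y ×_M Y^[2]`. -/
def cube : SurjSubmersion n M := S.fiberProd S.sq

variable {S} in
/-- The point `(y₁, y₂)` of `Y^[2]`. -/
def pair (y₁ y₂ : S.Y) (h : S.proj y₁ = S.proj y₂) : S.sq.Y := (⟨y₁, y₂, h⟩ : FiberProd S S)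

variable {S} in
/-- The point `(y₁, y₂, y₃)` of `Y^[3]`. -/
def triple (y₁ y₂ y₃ : S.Y) (h : S.proj y₁ = S.proj y₂) (h' : S.proj y₂ = S.proj y₃) :
    S.cube.Y := (⟨y₁, pair y₂ y₃ h', h.trans h'⟩ : FiberProd S S.sq)

/-- `(y₁, y₂) ↦ y₁`. -/
def p₁ : S.sq.Y → S.Y := S.fst S

/-- `(y₁, y₂) ↦ y₂`. -/
def p₂ : S.sq.Y → S.Y := S.snd S

theorem proj_p₁ (q : S.sq.Y) : S.proj (S.p₁ q) = S.proj (S.p₂ q) :=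
  FiberProd.comm (S := S) (T := S) q

theorem proj_sq (q : S.sq.Y) : S.sq.proj q = S.proj (S.p₂ q) := rfl

theorem proj_cube (q : S.cube.Y) : S.proj (S.fst S.sq q) = S.proj (S.p₁ (S.snd S.sq q)) :=
  (FiberProd.comm (S := S) (T := S.sq) q).trans (S.proj_p₁ _).symm

/-- `(y₁, y₂, y₃) ↦ (y₁, y₂)`. -/
def π₁₂ (q : S.cube.Y) : S.sq.Y :=
  pair (S.fst S.sq q) (S.p₁ (S.snd S.sq q)) (S.proj_cube q)

/-- `(y₁, y₂, y₃) ↦ (y₂, y₃)`. -/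
def π₂₃ : S.cube.Y → S.sq.Y := S.snd S.sq

/-- `(y₁, y₂, y₃) ↦ (y₁, y₃)`. -/
def π₁₃ (q : S.cube.Y) : S.sq.Y :=
  pair (S.fst S.sq q) (S.p₂ (S.snd S.sq q)) ((S.proj_cube q).trans (S.proj_p₁ _))

theorem contMDiff_p₁ : ContMDiff 𝓘(ℝ, S.sq.E) 𝓘(ℝ, S.E) ∞ S.p₁ := S.contMDiff_fst S

theorem contMDiff_p₂ : ContMDiff 𝓘(ℝ, S.sq.E) 𝓘(ℝ, S.E) ∞ S.p₂ := S.contMDiff_snd S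

variable {S} in
theorem contMDiff_pair {E' N : Type*} [NormedAddCommGroup E'] [NormedSpace ℝ E']
    [TopologicalSpace N] [ChartedSpace E' N] {f g : N → S.Y}
    (hf : ContMDiff 𝓘(ℝ, E') 𝓘(ℝ, S.E) ∞ f) (hg : ContMDiff 𝓘(ℝ, E') 𝓘(ℝ, S.E) ∞ g)
    (h : ∀ z, S.proj (f z) = S.proj (g z)) :
    ContMDiff 𝓘(ℝ, E') 𝓘(ℝ, S.sq.E) ∞ (fun z => pair (f z) (g z) (h z)) :=
  contMDiff_of_comp hf hg

theorem contMDiff_π₁₂ : ContMDiff 𝓘(ℝ, S.cube.E) 𝓘(ℝ, S.sq.E) ∞ S.π₁₂ :=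
  contMDiff_pair (S.contMDiff_fst S.sq) (S.contMDiff_p₁.comp (S.contMDiff_snd S.sq)) S.proj_cube

theorem contMDiff_π₂₃ : ContMDiff 𝓘(ℝ, S.cube.E) 𝓘(ℝ, S.sq.E) ∞ S.π₂₃ := S.contMDiff_snd S.sq

theorem contMDiff_π₁₃ : ContMDiff 𝓘(ℝ, S.cube.E) 𝓘(ℝ, S.sq.E) ∞ S.π₁₃ :=
  contMDiff_pair (S.contMDiff_fst S.sq) (S.contMDiff_p₂.comp (S.contMDiff_snd S.sq)) _

/-- A morphism of surjective submersions: a smooth map covering the identity of `M`. -/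
structure Hom where
  toFun : S.Y → T.Y
  contMDiff : ContMDiff 𝓘(ℝ, S.E) 𝓘(ℝ, T.E) ∞ toFun
  proj_toFun : ∀ y, T.proj (toFun y) = S.proj y

/-- The projection `Y ×_M X → Y`, as a morphism. -/
def homFst : Hom (S.fiberProd T) S := ⟨S.fst T, S.contMDiff_fst T, FiberProd.comm (S := S) (T := T)⟩

/-- The projection `Y ×_M X → X`, as a morphism. -/
def homSnd : Hom (S.fiberProd T) T := ⟨S.snd T, S.contMDiff_snd T, fun _ => rfl⟩

namespace Hom

variable {S T} (f : Hom S T)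

theorem proj_pair {y₁ y₂ : S.Y} (h : S.proj y₁ = S.proj y₂) :
    T.proj (f.toFun y₁) = T.proj (f.toFun y₂) := by rw [f.proj_toFun, f.proj_toFun, h]

/-- The map `f^[2] : Y^[2] → X^[2]` induced by a morphism. -/
def sq (q : S.sq.Y) : T.sq.Y :=
  pair (f.toFun (S.p₁ q)) (f.toFun (S.p₂ q)) (f.proj_pair (S.proj_p₁ q))

theorem contMDiff_sq : ContMDiff 𝓘(ℝ, S.sq.E) 𝓘(ℝ, T.sq.E) ∞ f.sq :=
  contMDiff_pair (f.contMDiff.comp S.contMDiff_p₁) (f.contMDiff.comp S.contMDiff_p₂) _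

/-- The map `f^[3] : Y^[3] → X^[3]` induced by a morphism. -/
def cube (q : S.cube.Y) : T.cube.Y :=
  triple (f.toFun (S.fst S.sq q)) (f.toFun (S.p₁ (S.snd S.sq q))) (f.toFun (S.p₂ (S.snd S.sq q)))
    (f.proj_pair (S.proj_cube q)) (f.proj_pair (S.proj_p₁ _))

theorem contMDiff_cube : ContMDiff 𝓘(ℝ, S.cube.E) 𝓘(ℝ, T.cube.E) ∞ f.cube :=
  contMDiff_of_comp (f.contMDiff.comp (S.contMDiff_fst S.sq))
    (contMDiff_pair (f.contMDiff.comp (S.contMDiff_p₁.comp (S.contMDiff_snd S.sq)))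
      (f.contMDiff.comp (S.contMDiff_p₂.comp (S.contMDiff_snd S.sq))) _)

end Hom

end SurjSubmersion

/-! ### Bundle gerbes -/

section Gerbe

open SurjSubmersion

variable {n : ℕ} {M : Type u} [TopologicalSpace M]
  [ChartedSpace (EuclideanSpace ℝ (Fin n)) M] [IsManifold (𝓡 n) ∞ M]

/-- The isomorphisms `π₁₂^*P ⊗ π₂₃^*P → π₁₃^*P` of `U(1)` bundles over `Y^[3]`. -/
abbrev MulIso (S : SurjSubmersion n M) (P : U1Bundle S.sq.E S.sq.Y) : Type u :=
  U1Bundle.Iso ((P.pullback S.π₁₂ S.contMDiff_π₁₂).tensor (P.pullback S.π₂₃ S.contMDiff_π₂₃))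
    (P.pullback S.π₁₃ S.contMDiff_π₁₃)

/-- The map `P_{(y₁, y₂)} × P_{(y₂, y₃)} → P_{(y₁, y₃)}` given by a multiplication. -/
def MulIso.mul {S : SurjSubmersion n M} {P : U1Bundle S.sq.E S.sq.Y} (m : MulIso S P)
    {y₁ y₂ y₃ : S.Y} {h : S.proj y₁ = S.proj y₂} {h' : S.proj y₂ = S.proj y₃}
    (p : P.Fib (pair y₁ y₂ h)) (q : P.Fib (pair y₂ y₃ h')) : P.Fib (pair y₁ y₃ (h.trans h')) :=
  m.toFun (triple y₁ y₂ y₃ h h') (TensorFib.mk p q)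

/-- A bundle gerbe `(P, Y)` with given surjective submersion `Y → M`: a `U(1)` bundle `P → Y^[2]`
with an associative bundle gerbe multiplication. -/
structure GerbeOver (S : SurjSubmersion n M) : Type (u + 1) where
  P : U1Bundle S.sq.E S.sq.Y
  m : MulIso S P
  assoc : ∀ (y₁ y₂ y₃ y₄ : S.Y) (h₁₂ : S.proj y₁ = S.proj y₂) (h₂₃ : S.proj y₂ = S.proj y₃)
    (h₃₄ : S.proj y₃ = S.proj y₄) (p : P.Fib (pair y₁ y₂ h₁₂)) (q : P.Fib (pair y₂ y₃ h₂₃))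
    (r : P.Fib (pair y₃ y₄ h₃₄)),
    MulIso.mul m (MulIso.mul m p q) r = MulIso.mul m p (MulIso.mul m q r)

namespace GerbeOver

variable {S T : SurjSubmersion n M}

/-- The multiplication `P_{(y₁, y₂)} × P_{(y₂, y₃)} → P_{(y₁, y₃)}`. -/
def mul (G : GerbeOver S) {y₁ y₂ y₃ : S.Y} {h : S.proj y₁ = S.proj y₂}
    {h' : S.proj y₂ = S.proj y₃} (p : G.P.Fib (pair y₁ y₂ h)) (q : G.P.Fib (pair y₂ y₃ h')) :
    G.P.Fib (pair y₁ y₃ (h.trans h')) :=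
  MulIso.mul G.m p q

theorem m_smul_left (G : GerbeOver S) (b : S.cube.Y) (z : Circle) (p : G.P.Fib (S.π₁₂ b))
    (q : G.P.Fib (S.π₂₃ b)) : G.m.toFun b (TensorFib.mk (z • p) q) =
      z • G.m.toFun b (TensorFib.mk p q) :=
  G.m.map_smul b z (TensorFib.mk p q)

theorem m_smul_right (G : GerbeOver S) (b : S.cube.Y) (z : Circle) (p : G.P.Fib (S.π₁₂ b))
    (q : G.P.Fib (S.π₂₃ b)) : G.m.toFun b (TensorFib.mk p (z • q)) =
      z • G.m.toFun b (TensorFib.mk p q) := by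
  refine Eq.trans ?_ (G.m_smul_left b z p q)
  exact congrArg (G.m.toFun b) (TensorFib.mk_smul_left z p q).symm

theorem smooth_m (G : GerbeOver S) {s t : ∀ b, G.P.Fib b} {U V : TopologicalSpace.Opens S.sq.Y}
    (hs : G.P.SmoothOn s U) (ht : G.P.SmoothOn t V) :
    (G.P.pullback S.π₁₃ S.contMDiff_π₁₃).SmoothOn
      (fun b => G.m.toFun b (TensorFib.mk (s (S.π₁₂ b)) (t (S.π₂₃ b))))
      (S.π₁₂ ⁻¹' U ∩ S.π₂₃ ⁻¹' V) :=
  G.m.smooth ⟨S.π₁₂ ⁻¹' U ∩ S.π₂₃ ⁻¹' V, (U.isOpen.preimage S.contMDiff_π₁₂.continuous).inter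
    (V.isOpen.preimage S.contMDiff_π₂₃.continuous)⟩ _
    (U1Bundle.SmoothOn.tensor ((hs.pullback S.contMDiff_π₁₂).mono inter_subset_left)
      ((ht.pullback S.contMDiff_π₂₃).mono inter_subset_right))

/-- The dual bundle gerbe `(P*, Y)`. -/
def dual (G : GerbeOver S) : GerbeOver S where
  P := G.P.dual
  m := U1Bundle.Iso.ofBilinear
    (fun b p q => DualFib.of (G.m.toFun b (TensorFib.mk p.val q.val)))
    (fun b z p q => congrArg DualFib.of (G.m_smul_left b z⁻¹ p.val q.val))
    (fun b z p q => congrArg DualFib.of (G.m_smul_right b z⁻¹ p.val q.val))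
    (fun b => by
      obtain ⟨s, hs, hb⟩ := G.P.cover (S.π₁₂ b)
      obtain ⟨t, ht, hb'⟩ := G.P.cover (S.π₂₃ b)
      have hs' := G.P.smoothOn_of_mem hs
      have ht' := G.P.smoothOn_of_mem ht
      exact ⟨S.π₁₂ ⁻¹' s.1 ∩ S.π₂₃ ⁻¹' t.1, fun b => DualFib.of (s.2 (S.π₁₂ b)),
        fun b => DualFib.of (t.2 (S.π₂₃ b)),
        (s.1.isOpen.preimage S.contMDiff_π₁₂.continuous).inter
          (t.1.isOpen.preimage S.contMDiff_π₂₃.continuous), ⟨hb, hb'⟩,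
        (hs'.dual.pullback S.contMDiff_π₁₂).mono inter_subset_left,
        (ht'.dual.pullback S.contMDiff_π₂₃).mono inter_subset_right,
        (G.smooth_m hs' ht').dual_pullback⟩)
  assoc y₁ y₂ y₃ y₄ h₁₂ h₂₃ h₃₄ p q r :=
    congrArg DualFib.of (G.assoc y₁ y₂ y₃ y₄ h₁₂ h₂₃ h₃₄ p.val q.val r.val)

/-- The product of two bundle gerbes with the same submersion. -/
def tensor (G H : GerbeOver S) : GerbeOver S where
  P := G.P.tensor H.P
  m := U1Bundle.Iso.ofBilinear
    (fun b => TensorFib.mulMap (fun p p' => G.m.toFun b (TensorFib.mk p p'))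
      (fun q q' => H.m.toFun b (TensorFib.mk q q'))
      (G.m_smul_left b) (G.m_smul_right b) (H.m_smul_left b) (H.m_smul_right b))
    (fun b z => TensorFib.ind fun p q => TensorFib.ind fun p' q' =>
      congrArg (fun x => TensorFib.mk x (H.m.toFun b (TensorFib.mk q q')))
        (G.m_smul_left b z p p'))
    (fun b z => TensorFib.ind fun p q => TensorFib.ind fun p' q' =>
      congrArg (fun x => TensorFib.mk x (H.m.toFun b (TensorFib.mk q q')))
        (G.m_smul_right b z p p'))
    (fun b => by
      obtain ⟨s, hs, hb⟩ := G.P.cover (S.π₁₂ b)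
      obtain ⟨t, ht, hb'⟩ := G.P.cover (S.π₂₃ b)
      obtain ⟨u, hu, hc⟩ := H.P.cover (S.π₁₂ b)
      obtain ⟨v, hv, hc'⟩ := H.P.cover (S.π₂₃ b)
      have hs' := (G.P.smoothOn_of_mem hs).mono (V := (s.1 ⊓ u.1 : TopologicalSpace.Opens _))
        inter_subset_left
      have ht' := (G.P.smoothOn_of_mem ht).mono (V := (t.1 ⊓ v.1 : TopologicalSpace.Opens _))
        inter_subset_left
      have hu' := (H.P.smoothOn_of_mem hu).mono (V := (s.1 ⊓ u.1 : TopologicalSpace.Opens _))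
        inter_subset_right
      have hv' := (H.P.smoothOn_of_mem hv).mono (V := (t.1 ⊓ v.1 : TopologicalSpace.Opens _))
        inter_subset_right
      exact ⟨S.π₁₂ ⁻¹' (s.1 ⊓ u.1 : TopologicalSpace.Opens _) ∩
          S.π₂₃ ⁻¹' (t.1 ⊓ v.1 : TopologicalSpace.Opens _),
        fun b => TensorFib.mk (s.2 (S.π₁₂ b)) (u.2 (S.π₁₂ b)),
        fun b => TensorFib.mk (t.2 (S.π₂₃ b)) (v.2 (S.π₂₃ b)),
        ((s.1 ⊓ u.1).isOpen.preimage S.contMDiff_π₁₂.continuous).inter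
          ((t.1 ⊓ v.1).isOpen.preimage S.contMDiff_π₂₃.continuous), ⟨⟨hb, hc⟩, hb', hc'⟩,
        ((hs'.tensor hu').pullback S.contMDiff_π₁₂).mono inter_subset_left,
        ((ht'.tensor hv').pullback S.contMDiff_π₂₃).mono inter_subset_right,
        (G.smooth_m hs' ht').tensor_pullback _ (H.smooth_m hu' hv')⟩)
  assoc y₁ y₂ y₃ y₄ h₁₂ h₂₃ h₃₄ :=
    TensorFib.ind fun p q => TensorFib.ind fun p' q' => TensorFib.ind fun p'' q'' =>
      congrArg₂ TensorFib.mk (G.assoc y₁ y₂ y₃ y₄ h₁₂ h₂₃ h₃₄ p p' p'')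
        (H.assoc y₁ y₂ y₃ y₄ h₁₂ h₂₃ h₃₄ q q' q'')

/-- The pullback of a bundle gerbe along a morphism of surjective submersions over `M`. -/
def pullback (G : GerbeOver T) (f : Hom S T) : GerbeOver S where
  P := G.P.pullback f.sq f.contMDiff_sq
  m := U1Bundle.Iso.ofBilinear
    (fun b p q => G.m.toFun (f.cube b) (TensorFib.mk p q))
    (fun b z p q => G.m_smul_left (f.cube b) z p q)
    (fun b z p q => G.m_smul_right (f.cube b) z p q)
    (fun b => by
      obtain ⟨s, hs, hb⟩ := G.P.cover (T.π₁₂ (f.cube b))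
      obtain ⟨t, ht, hb'⟩ := G.P.cover (T.π₂₃ (f.cube b))
      have hs' := G.P.smoothOn_of_mem hs
      have ht' := G.P.smoothOn_of_mem ht
      have h := (G.smooth_m hs' ht').pullback f.contMDiff_cube
      refine ⟨f.cube ⁻¹' (T.π₁₂ ⁻¹' s.1 ∩ T.π₂₃ ⁻¹' t.1), fun b => s.2 (T.π₁₂ (f.cube b)),
        fun b => t.2 (T.π₂₃ (f.cube b)),
        ((s.1.isOpen.preimage T.contMDiff_π₁₂.continuous).inter
          (t.1.isOpen.preimage T.contMDiff_π₂₃.continuous)).preimage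
            f.contMDiff_cube.continuous, ⟨hb, hb'⟩,
        ((hs'.pullback f.contMDiff_sq).pullback S.contMDiff_π₁₂).mono inter_subset_left,
        ((ht'.pullback f.contMDiff_sq).pullback S.contMDiff_π₂₃).mono inter_subset_right, ?_⟩
      rintro _ ⟨_, ⟨a, ha, rfl⟩, rfl⟩
      exact h _ ⟨_, ⟨a, ha, rfl⟩, rfl⟩)
  assoc y₁ y₂ y₃ y₄ h₁₂ h₂₃ h₃₄ p q r :=
    G.assoc _ _ _ _ (f.proj_pair h₁₂) (f.proj_pair h₂₃) (f.proj_pair h₃₄) p q r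

/-- The bundle gerbe `(δ(R), Y)` of a `U(1)` bundle `R → Y`, with
`δ(R)_{(y₁, y₂)} = R_{y₁} ⊗ R_{y₂}*` and the contraction as multiplication. -/
def delta (R : U1Bundle S.E S.Y) : GerbeOver S where
  P := (R.pullback S.p₁ S.contMDiff_p₁).tensor (R.pullback S.p₂ S.contMDiff_p₂).dual
  m := U1Bundle.Iso.ofBilinear
    (fun b x y => TensorFib.contract (A := R.Fib (S.p₁ (S.π₁₂ b))) (B := R.Fib (S.p₂ (S.π₁₂ b)))
      (C := R.Fib (S.p₂ (S.π₂₃ b))) x y)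
    (fun _ z x y => TensorFib.contract_smul_left z x y)
    (fun _ z x y => TensorFib.contract_smul_right z x y)
    (fun b => by
      obtain ⟨s, hs, hb⟩ := R.cover (S.p₁ (S.π₁₂ b))
      obtain ⟨t, ht, hb'⟩ := R.cover (S.p₂ (S.π₁₂ b))
      obtain ⟨u, hu, hb''⟩ := R.cover (S.p₂ (S.π₂₃ b))
      have hs' := (R.smoothOn_of_mem hs).pullback S.contMDiff_p₁
      have ht' := (R.smoothOn_of_mem ht).pullback S.contMDiff_p₂
      have ht'' := (R.smoothOn_of_mem ht).pullback S.contMDiff_p₁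
      have hu' := (R.smoothOn_of_mem hu).pullback S.contMDiff_p₂
      have k₁ := (hs'.mono inter_subset_left).tensor (ht'.mono inter_subset_right).dual
      have k₂ := (ht''.mono inter_subset_left).tensor (hu'.mono inter_subset_right).dual
      have k₃ := (hs'.mono inter_subset_left).tensor (hu'.mono inter_subset_right).dual
      refine ⟨(S.π₁₂ ⁻¹' (S.p₁ ⁻¹' s.1 ∩ S.p₂ ⁻¹' t.1) ∩ S.π₂₃ ⁻¹' (S.p₁ ⁻¹' t.1 ∩ S.p₂ ⁻¹' u.1)),
        _, _, ?_, ⟨⟨hb, hb'⟩, hb', hb''⟩,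
        (k₁.pullback S.contMDiff_π₁₂).mono inter_subset_left,
        (k₂.pullback S.contMDiff_π₂₃).mono inter_subset_right, ?_⟩
      · exact ((((s.1.isOpen.preimage S.contMDiff_p₁.continuous).inter
          (t.1.isOpen.preimage S.contMDiff_p₂.continuous)).preimage
            S.contMDiff_π₁₂.continuous)).inter
          ((((t.1.isOpen.preimage S.contMDiff_p₁.continuous).inter
          (u.1.isOpen.preimage S.contMDiff_p₂.continuous)).preimage
            S.contMDiff_π₂₃.continuous))
      · have h := (k₃.pullback S.contMDiff_π₁₃).mono
          (V := (S.π₁₂ ⁻¹' (S.p₁ ⁻¹' s.1 ∩ S.p₂ ⁻¹' t.1) ∩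
            S.π₂₃ ⁻¹' (S.p₁ ⁻¹' t.1 ∩ S.p₂ ⁻¹' u.1)))
          (fun c hc => ⟨hc.1.1, hc.2.2⟩)
        refine Eq.mp (congrArg (fun f => U1Bundle.SmoothOn _ f _) (funext fun c => ?_)) h
        have e := TensorFib.contract_mk (s.2 (S.p₁ (S.π₁₂ c))) (t.2 (S.p₂ (S.π₁₂ c)))
          (t.2 (S.p₂ (S.π₁₂ c))) (DualFib.of (u.2 (S.p₂ (S.π₂₃ c))))
        rw [sdiv_self, one_smul] at e
        exact e.symm)
  assoc y₁ y₂ y₃ y₄ _ _ _ x y w := TensorFib.contract_assoc (A := R.Fib y₁) (B := R.Fib y₂)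
    (C := R.Fib y₃) (D := R.Fib y₄) x y w

/-- An isomorphism of bundle gerbes over the same submersion `Y → M`: an isomorphism of the
`U(1)` bundles over `Y^[2]` preserving the multiplications. -/
structure Iso (G H : GerbeOver S) where
  toIso : U1Bundle.Iso G.P H.P
  map_mul : ∀ (y₁ y₂ y₃ : S.Y) (h : S.proj y₁ = S.proj y₂) (h' : S.proj y₂ = S.proj y₃)
    (p : G.P.Fib (pair y₁ y₂ h)) (q : G.P.Fib (pair y₂ y₃ h')),
    toIso.toFun _ (G.mul p q) = H.mul (toIso.toFun _ p) (toIso.toFun _ q)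

/-- A bundle gerbe is trivial if it is isomorphic to `δ(R)` for some `U(1)` bundle `R → Y`. -/
def IsTrivial (G : GerbeOver S) : Prop :=
  ∃ R : U1Bundle S.E S.Y, Nonempty (Iso (delta R) G)

end GerbeOver

variable (n M) in
/-- A bundle gerbe `(P, Y)` over `M`. -/
structure BundleGerbe : Type (u + 1) where
  sub : SurjSubmersion n M
  gerbe : GerbeOver sub

namespace BundleGerbe

/-- The dual `(P, Y)* = (P*, Y)`. -/
def dual (G : BundleGerbe n M) : BundleGerbe n M := ⟨G.sub, G.gerbe.dual⟩

/-- The product `(P, Y) ⊗ (Q, X) = (P ⊗ Q, Y ×_M X)`, with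
`(P ⊗ Q)_{((y₁, x₁), (y₂, x₂))} = P_{(y₁, y₂)} ⊗ Q_{(x₁, x₂)}`. -/
def tensor (G H : BundleGerbe n M) : BundleGerbe n M :=
  ⟨G.sub.fiberProd H.sub,
    (G.gerbe.pullback (G.sub.homFst H.sub)).tensor (H.gerbe.pullback (G.sub.homSnd H.sub))⟩

/-- Triviality of a bundle gerbe. -/
def IsTrivial (G : BundleGerbe n M) : Prop := G.gerbe.IsTrivial

/-- `(P, Y)` and `(Q, X)` are stably isomorphic if `(P, Y)* ⊗ (Q, X)` is trivial. -/
def StablyIsomorphic (G H : BundleGerbe n M) : Prop := (G.dual.tensor H).IsTrivial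

end BundleGerbe

end Gerbe

/-! ### Čech cohomology with integer coefficients -/

namespace Cech

open TopologicalSpace

/-- Open covers `(U_x)` of `M` indexed by the points of `M`, with `x ∈ U_x`. They are cofinal among
all open covers, and refinement is pointwise inclusion. -/
def PointedCover (M : Type u) [TopologicalSpace M] : Type u :=
  {U : M → Opens M // ∀ x, x ∈ U x}

variable {M : Type u} [TopologicalSpace M]

instance : PartialOrder (PointedCover M) := inferInstanceAs (PartialOrder {U : M → Opens M // ∀ x, x ∈ U x})

/-- The intersection `U_{i 0} ∩ ⋯ ∩ U_{i (k - 1)}`. -/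
def inter (U : PointedCover M) {k : ℕ} (i : Fin k → M) : Opens M :=
  ⟨⋂ j, (U.1 (i j) : Set M), isOpen_iInter_of_finite fun j => (U.1 (i j)).isOpen⟩

theorem inter_comp (U : PointedCover M) {k l : ℕ} (i : Fin k → M) (f : Fin l → Fin k) :
    inter U i ≤ inter U (i ∘ f) := fun _ hx =>
  Set.mem_iInter.2 fun j => Set.mem_iInter.1 hx (f j)

theorem inter_mono {U V : PointedCover M} (h : V ≤ U) {k : ℕ} (i : Fin k → M) :
    inter V i ≤ inter U i := fun _ hx =>
  Set.mem_iInter.2 fun j => h (i j) (Set.mem_iInter.1 hx j)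

/-- Restriction of locally constant functions. -/
def res {V W : Opens M} (h : V ≤ W) : LocallyConstant W ℤ →+ LocallyConstant V ℤ where
  toFun f := f.comap ⟨Set.inclusion h, continuous_inclusion h⟩
  map_zero' := rfl
  map_add' _ _ := rfl

theorem res_res {V W X : Opens M} (h : V ≤ W) (h' : W ≤ X) (f : LocallyConstant X ℤ) :
    res h (res h' f) = res (h.trans h') f := rfl

/-- Čech `k`-cochains of the constant sheaf `ℤ`, whose sections are the locally constant functions:
a section over each ordered intersection of `k + 1` members. -/
abbrev Cochain (U : PointedCover M) (k : ℕ) : Type u :=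
  ∀ i : Fin (k + 1) → M, LocallyConstant (inter U i) ℤ

/-- The Čech differential. -/
def d (U : PointedCover M) (k : ℕ) : Cochain U k →+ Cochain U (k + 1) where
  toFun f i := ∑ j : Fin (k + 2), (-1 : ℤ) ^ (j : ℕ) • res (inter_comp U i j.succAbove)
    (f (i ∘ j.succAbove))
  map_zero' := by ext1 i; simp
  map_add' f g := by ext1 i; simp [Finset.sum_add_distrib]

/-- Čech cocycles. -/
def cocycles (U : PointedCover M) (k : ℕ) : AddSubgroup (Cochain U k) := (d U k).ker

/-- Čech coboundaries. -/
def coboundaries (U : PointedCover M) : ∀ k : ℕ, AddSubgroup (Cochain U k)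
  | 0 => ⊥
  | k + 1 => (d U k).range

/-- The Čech cohomology `H^k(U; ℤ)` of a cover. -/
abbrev CoverH (U : PointedCover M) (k : ℕ) : Type u :=
  cocycles U k ⧸ (coboundaries U k).addSubgroupOf (cocycles U k)

/-- Restriction of cochains to a finer cover. -/
def refine {U V : PointedCover M} (h : V ≤ U) (k : ℕ) : Cochain U k →+ Cochain V k where
  toFun f i := res (inter_mono h i) (f i)
  map_zero' := rfl
  map_add' _ _ := rfl

theorem refine_d {U V : PointedCover M} (h : V ≤ U) (k : ℕ) (f : Cochain U k) :
    d V k (refine h k f) = refine h (k + 1) (d U k f) := by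
  funext i
  change ∑ j : Fin (k + 2), _ = res _ (∑ j : Fin (k + 2), _)
  rw [map_sum]
  refine Finset.sum_congr rfl fun j _ => ?_
  rw [map_zsmul]
  rfl

theorem refine_mem_cocycles {U V : PointedCover M} (h : V ≤ U) (k : ℕ) {f : Cochain U k}
    (hf : f ∈ cocycles U k) : refine h k f ∈ cocycles V k := by
  have hf' : d U k f = 0 := hf
  change d V k (refine h k f) = 0
  rw [refine_d, hf', map_zero]

theorem refine_mem_coboundaries {U V : PointedCover M} (h : V ≤ U) (k : ℕ) {f : Cochain U k}
    (hf : f ∈ coboundaries U k) : refine h k f ∈ coboundaries V k := by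
  cases k with
  | zero =>
    have hf' : f = 0 := hf
    rw [hf', map_zero]
    exact zero_mem _
  | succ k =>
    obtain ⟨g, rfl⟩ := hf
    exact ⟨refine h k g, refine_d h k g⟩

/-- The map on cohomology induced by a refinement. -/
def refineH {U V : PointedCover M} (h : V ≤ U) (k : ℕ) : CoverH U k →+ CoverH V k :=
  QuotientAddGroup.map _ _
    (((refine h k).comp (cocycles U k).subtype).codRestrict (cocycles V k)
      fun f => refine_mem_cocycles h k f.2)
    fun f hf => refine_mem_coboundaries h k (f := f.1) hf

open Classical in
variable (M) in
/-- The Čech cohomology `H^k(M; ℤ)`: the direct limit, over open covers ordered by refinement, of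
the cohomology of the covers. -/
abbrev H (k : ℕ) : Type u :=
  AddCommGroup.DirectLimit (ι := (PointedCover M)ᵒᵈ)
    (fun U => CoverH (OrderDual.ofDual U) k)
    (fun _ _ h => refineH (OrderDual.ofDual_le_ofDual.2 h) k)

open Classical in
/-- The class in `H^k(M; ℤ)` of a cocycle on a cover. -/
def classOf (U : PointedCover M) (k : ℕ) : cocycles U k →+ H M k :=
  (AddCommGroup.DirectLimit.of (ι := (PointedCover M)ᵒᵈ)
    (fun U => CoverH (OrderDual.ofDual U) k)
    (fun _ _ h => refineH (OrderDual.ofDual_le_ofDual.2 h) k) (OrderDual.toDual U)).comp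
    (QuotientAddGroup.mk' ((coboundaries U k).addSubgroupOf (cocycles U k)))

end Cech

/-! ### The Dixmier-Douady class -/

namespace BundleGerbe

open SurjSubmersion TopologicalSpace

variable {n : ℕ} {M : Type u} [TopologicalSpace M]
  [ChartedSpace (EuclideanSpace ℝ (Fin n)) M] [IsManifold (𝓡 n) ∞ M]

/-- Smooth local sections of `Y → M` over the members of an open cover. -/
structure LocalSections (S : SurjSubmersion n M) : Type (u + 1) where
  ι : Type u
  U : ι → Opens M
  cover : ∀ x, ∃ a, x ∈ U a
  s : ∀ a, U a → S.Y
  contMDiff_s : ∀ a, ContMDiff (𝓡 n) 𝓘(ℝ, S.E) ∞ (s a)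
  proj_s : ∀ a x, S.proj (s a x) = x

namespace LocalSections

variable {S : SurjSubmersion n M} (D : LocalSections S)

theorem proj_eq {a b : D.ι} {x : M} (ha : x ∈ D.U a) (hb : x ∈ D.U b) :
    S.proj (D.s a ⟨x, ha⟩) = S.proj (D.s b ⟨x, hb⟩) :=
  (D.proj_s a ⟨x, ha⟩).trans (D.proj_s b ⟨x, hb⟩).symm

/-- The map `(s_a, s_b) : U_a ∩ U_b → Y^[2]`. -/
def overlap (a b : D.ι) (x : (D.U a ⊓ D.U b : Opens M)) : S.sq.Y :=
  pair (D.s a ⟨x, x.2.1⟩) (D.s b ⟨x, x.2.2⟩) (D.proj_eq x.2.1 x.2.2)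

theorem contMDiff_overlap (a b : D.ι) :
    ContMDiff (𝓡 n) 𝓘(ℝ, S.sq.E) ∞ (D.overlap a b) :=
  contMDiff_pair
    ((D.contMDiff_s a).comp (contMDiff_inclusion (inf_le_left : D.U a ⊓ D.U b ≤ D.U a)))
    ((D.contMDiff_s b).comp (contMDiff_inclusion (inf_le_right : D.U a ⊓ D.U b ≤ D.U b))) _

end LocalSections

/-- Local sections `s_a` of `Y → M` together with sections `σ_ab` of
`P_ab = (s_a, s_b)^* P` over the double overlaps. -/
structure SectionData (G : BundleGerbe n M) extends LocalSections G.sub where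
  σ : ∀ a b (x : (U a ⊓ U b : Opens M)), G.gerbe.P.Fib (toLocalSections.overlap a b x)
  smooth_σ : ∀ a b, (G.gerbe.P.pullback (toLocalSections.overlap a b)
    (toLocalSections.contMDiff_overlap a b)).SmoothOn (σ a b) univ

/-- The cocycle `g_abc : U_a ∩ U_b ∩ U_c → U(1)`, with `m(σ_ab, σ_bc) = g_abc σ_ac`. -/
def SectionData.g {G : BundleGerbe n M} (D : SectionData G) (a b c : D.ι)
    (x : (D.U a ⊓ D.U b ⊓ D.U c : Opens M)) : Circle :=
  G.gerbe.mul (D.σ a b ⟨x, x.2.1⟩) (D.σ b c ⟨x, x.2.1.2, x.2.2⟩) /ₛ D.σ a c ⟨x, x.2.1.1, x.2.2⟩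

/-- Section data together with smooth logarithms `θ_abc` of the cocycle, `g = exp(2πiθ)`. Such
data exist for instance over every good cover. -/
structure LocalData (G : BundleGerbe n M) extends SectionData G where
  θ : ∀ a b c, (U a ⊓ U b ⊓ U c : Opens M) → ℝ
  smooth_θ : ∀ a b c, ContMDiff (𝓡 n) 𝓘(ℝ) ∞ (θ a b c)
  exp_θ : ∀ a b c x, Circle.exp (2 * Real.pi * θ a b c x) = toSectionData.g a b c x

/-- `c` is a Dixmier-Douady class of `G`: for some local data over an open cover, `c` is the image of
the class `[g_abc]` under the connecting map `H²(M, U(1)) = H³(M; ℤ)` of the exponential sequence,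
that is the class of the integer cocycle `δθ`. The cover is indexed by the points of `M` through a
choice `α` of a member containing each point. -/
def IsDDClass (G : BundleGerbe n M) (c : Cech.H M 3) : Prop :=
  ∃ (D : LocalData G) (α : M → D.ι) (hα : ∀ x, x ∈ D.U (α x))
    (k : Cech.cocycles (⟨fun x => D.U (α x), hα⟩ : Cech.PointedCover M) 3),
    (∀ (x₀ x₁ x₂ x₃ x : M) (h₀ : x ∈ D.U (α x₀)) (h₁ : x ∈ D.U (α x₁)) (h₂ : x ∈ D.U (α x₂))
      (h₃ : x ∈ D.U (α x₃)) (h : x ∈ Cech.inter ⟨fun x => D.U (α x), hα⟩ ![x₀, x₁, x₂, x₃]),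
      (k.1 ![x₀, x₁, x₂, x₃] ⟨x, h⟩ : ℝ) =
        D.θ (α x₁) (α x₂) (α x₃) ⟨x, ⟨h₁, h₂⟩, h₃⟩ - D.θ (α x₀) (α x₂) (α x₃) ⟨x, ⟨h₀, h₂⟩, h₃⟩ +
        D.θ (α x₀) (α x₁) (α x₃) ⟨x, ⟨h₀, h₁⟩, h₃⟩ - D.θ (α x₀) (α x₁) (α x₂) ⟨x, ⟨h₀, h₁⟩, h₂⟩) ∧
    c = Cech.classOf _ 3 k

/-- The Dixmier-Douady class `DD(P, Y)`. -/
def DD (G : BundleGerbe n M) : Cech.H M 3 := Classical.epsilon (IsDDClass G)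

end BundleGerbe

end

/-! The class `DD` is the obstruction to choosing the sections `σ_ab` multiplicatively, and every
assertion follows from three facts about arbitrary (not chosen) Dixmier-Douady classes. If `b` is a
class of `(P, Y)` and `c` one of `(Q, X)`, then `c - b` is a class of `P* ⊗ Q`, because logarithms
of the cocycles subtract (`IsDDClass.tensor_dual`). Every class of a trivial gerbe is `0`
(`IsDDClass.eq_zero`). A gerbe that has `0` as a class is trivial (`IsDDClass.isTrivial`). Hence
stable isomorphism is equivalent to `b = c` for any such `b` and `c`. With both gerbes equal this
gives uniqueness of the class, and in general it identifies stable isomorphism with equality of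
`DD`, so that it is an equivalence relation.

Triviality kills the class: from `δ(R) ≅ P` and local sections `r_a` of `R` along `s_a`, the images
`t_ab` of `r_a ⊗ r_b*` multiply strictly. Writing `σ_ab = exp(2πiζ_ab) t_ab`, the cochain `θ - δζ`
is integral and has the same coboundary as `θ`.

Conversely, if `δθ = δj` with `j` integral, then `θ - j` is a smooth real cocycle, hence `δη` by a
partition of unity, and `exp(-2πiη_ab) σ_ab` multiplies strictly. The fibres `R_y = P_{(y,
s_x(x))}`, with `x` the image of `y`, are then glued by these sections to a bundle, and division `p,
q ↦ p/q` is an isomorphism `δ(R) → P` (`Trivialization.isTrivial`).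

For surjectivity, an integer cocycle is `δθ` for smooth real `θ`, again by a partition of unity, and
`exp(2πiθ)` is the multiplication of a gerbe with trivial bundle over the fibre square of a disjoint
union of open sets (`exists_isDDClass`).

No good cover is used. Local sections of `P` and logarithms are obtained simultaneously on all
overlaps by a paracompactness argument, `Cech.exists_refinement`. Two covers are compared through
`Represents.comp`, the independence of the class from the refinement map. -/

noncomputable section

open Set Manifold

/-! ### Čech 3-classes through functions defined on all of `M` -/

section

namespace Cech

open TopologicalSpace

variable {M : Type u}

/-- The Čech differential of a `2`-cochain given by functions on all of `M`. -/
def delta₂ {A : Type*} [AddCommGroup A] (θ : M → M → M → M → A) (x₀ x₁ x₂ x₃ m : M) : A :=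
  θ x₁ x₂ x₃ m - θ x₀ x₂ x₃ m + θ x₀ x₁ x₃ m - θ x₀ x₁ x₂ m

/-- The Čech differential of a `3`-cochain given by functions on all of `M`. -/
def delta₃ {A : Type*} [AddCommGroup A] (κ : M → M → M → M → M → A) (x₀ x₁ x₂ x₃ x₄ m : M) : A :=
  κ x₁ x₂ x₃ x₄ m - κ x₀ x₂ x₃ x₄ m + κ x₀ x₁ x₃ x₄ m - κ x₀ x₁ x₂ x₄ m + κ x₀ x₁ x₂ x₃ m

theorem delta₃_delta₂ {A : Type*} [AddCommGroup A] (θ : M → M → M → M → A)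
    (x₀ x₁ x₂ x₃ x₄ m : M) : delta₃ (delta₂ θ) x₀ x₁ x₂ x₃ x₄ m = 0 := by
  simp only [delta₃, delta₂]
  abel

theorem eq_vec₄ (i : Fin 4 → M) : i = ![i 0, i 1, i 2, i 3] := by ext j; fin_cases j <;> rfl
theorem eq_vec₅ (i : Fin 5 → M) : i = ![i 0, i 1, i 2, i 3, i 4] := by ext j; fin_cases j <;> rfl

variable [TopologicalSpace M]

theorem mem_inter {U : PointedCover M} {k : ℕ} {i : Fin k → M} {m : M} :
    m ∈ inter U i ↔ ∀ j, m ∈ U.1 (i j) := by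
  change m ∈ (⋂ j, (U.1 (i j) : Set M)) ↔ _
  simp

theorem mem_inter₃ {U : PointedCover M} {x₀ x₁ x₂ m : M} :
    m ∈ inter U ![x₀, x₁, x₂] ↔ m ∈ U.1 x₀ ∧ m ∈ U.1 x₁ ∧ m ∈ U.1 x₂ := by
  simp [mem_inter, Fin.forall_fin_succ]

theorem mem_inter₄ {U : PointedCover M} {x₀ x₁ x₂ x₃ m : M} :
    m ∈ inter U ![x₀, x₁, x₂, x₃] ↔ m ∈ U.1 x₀ ∧ m ∈ U.1 x₁ ∧ m ∈ U.1 x₂ ∧ m ∈ U.1 x₃ := by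
  simp [mem_inter, Fin.forall_fin_succ]

theorem mem_inter₅ {U : PointedCover M} {x₀ x₁ x₂ x₃ x₄ m : M} :
    m ∈ inter U ![x₀, x₁, x₂, x₃, x₄] ↔
      m ∈ U.1 x₀ ∧ m ∈ U.1 x₁ ∧ m ∈ U.1 x₂ ∧ m ∈ U.1 x₃ ∧ m ∈ U.1 x₄ := by
  simp [mem_inter, Fin.forall_fin_succ]

/-- The locally constant function on an open set given by a function continuous there. -/
def ofContinuousOn {W : Opens M} (F : M → ℤ) (hF : ContinuousOn F W) : LocallyConstant W ℤ :=
  ⟨fun x => F x, (IsLocallyConstant.iff_continuous _).2 (continuousOn_iff_continuous_domRestrict.1 hF)⟩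

open Classical in
/-- The extension of a cochain by zero. -/
def total {U : PointedCover M} {k : ℕ} (f : Cochain U k) (i : Fin (k + 1) → M) (m : M) : ℤ :=
  if h : m ∈ inter U i then f i ⟨m, h⟩ else 0

theorem total_eq {U : PointedCover M} {k : ℕ} (f : Cochain U k) {i : Fin (k + 1) → M} {m : M}
    (h : m ∈ inter U i) : total f i m = f i ⟨m, h⟩ := dif_pos h

theorem continuousOn_total {U : PointedCover M} {k : ℕ} (f : Cochain U k) (i : Fin (k + 1) → M) :
    ContinuousOn (total f i) (inter U i) := by
  rw [continuousOn_iff_continuous_domRestrict]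
  refine (f i).continuous.congr fun x => ?_
  exact (total_eq f x.2).symm

/-- Extension by zero makes the restriction maps disappear: at a point of the intersection the
differential is an alternating sum of ordinary functions on `M`. All later cochain identities are
therefore pointwise identities of numbers, proved under membership hypotheses. -/
theorem d_apply {U : PointedCover M} {k : ℕ} (f : Cochain U k) {i : Fin (k + 2) → M} {m : M}
    (h : m ∈ inter U i) :
    d U k f i ⟨m, h⟩ = ∑ j : Fin (k + 2), (-1 : ℤ) ^ (j : ℕ) * total f (i ∘ j.succAbove) m := by
  change (∑ j : Fin (k + 2), (-1 : ℤ) ^ (j : ℕ) • res (inter_comp U i j.succAbove)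
    (f (i ∘ j.succAbove)) : LocallyConstant (inter U i) ℤ) ⟨m, h⟩ = _
  rw [← LocallyConstant.coeFnAddMonoidHom_apply, map_sum, Finset.sum_apply]
  refine Finset.sum_congr rfl fun j _ => ?_
  rw [total_eq f (inter_comp U i j.succAbove h)]
  simp only [LocallyConstant.coeFnAddMonoidHom_apply, LocallyConstant.smul_apply, smul_eq_mul]
  rfl

theorem d₂_apply {U : PointedCover M} (f : Cochain U 2) {x₀ x₁ x₂ x₃ m : M}
    (h : m ∈ inter U ![x₀, x₁, x₂, x₃]) :
    d U 2 f ![x₀, x₁, x₂, x₃] ⟨m, h⟩ =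
      delta₂ (fun x y z => total f ![x, y, z]) x₀ x₁ x₂ x₃ m := by
  have e0 : (![x₀, x₁, x₂, x₃] ∘ (0 : Fin 4).succAbove) = ![x₁, x₂, x₃] := by
    ext j; fin_cases j <;> rfl
  have e1 : (![x₀, x₁, x₂, x₃] ∘ (1 : Fin 4).succAbove) = ![x₀, x₂, x₃] := by
    ext j; fin_cases j <;> rfl
  have e2 : (![x₀, x₁, x₂, x₃] ∘ (2 : Fin 4).succAbove) = ![x₀, x₁, x₃] := by
    ext j; fin_cases j <;> rfl
  have e3 : (![x₀, x₁, x₂, x₃] ∘ (3 : Fin 4).succAbove) = ![x₀, x₁, x₂] := by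
    ext j; fin_cases j <;> rfl
  rw [d_apply, Fin.sum_univ_four, e0, e1, e2, e3]
  simp [delta₂]
  ring

theorem d₃_apply {U : PointedCover M} (f : Cochain U 3) {x₀ x₁ x₂ x₃ x₄ m : M}
    (h : m ∈ inter U ![x₀, x₁, x₂, x₃, x₄]) :
    d U 3 f ![x₀, x₁, x₂, x₃, x₄] ⟨m, h⟩ =
      delta₃ (fun x y z w => total f ![x, y, z, w]) x₀ x₁ x₂ x₃ x₄ m := by
  have e0 : (![x₀, x₁, x₂, x₃, x₄] ∘ (0 : Fin 5).succAbove) = ![x₁, x₂, x₃, x₄] := by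
    ext j; fin_cases j <;> rfl
  have e1 : (![x₀, x₁, x₂, x₃, x₄] ∘ (1 : Fin 5).succAbove) = ![x₀, x₂, x₃, x₄] := by
    ext j; fin_cases j <;> rfl
  have e2 : (![x₀, x₁, x₂, x₃, x₄] ∘ (2 : Fin 5).succAbove) = ![x₀, x₁, x₃, x₄] := by
    ext j; fin_cases j <;> rfl
  have e3 : (![x₀, x₁, x₂, x₃, x₄] ∘ (3 : Fin 5).succAbove) = ![x₀, x₁, x₂, x₄] := by
    ext j; fin_cases j <;> rfl
  have e4 : (![x₀, x₁, x₂, x₃, x₄] ∘ (4 : Fin 5).succAbove) = ![x₀, x₁, x₂, x₃] := by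
    ext j; fin_cases j <;> rfl
  rw [d_apply, Fin.sum_univ_five, e0, e1, e2, e3, e4]
  simp [delta₃]
  ring

theorem ext₄ {U : PointedCover M} {f g : Cochain U 3}
    (h : ∀ x₀ x₁ x₂ x₃ m (hm : m ∈ inter U ![x₀, x₁, x₂, x₃]),
      f ![x₀, x₁, x₂, x₃] ⟨m, hm⟩ = g ![x₀, x₁, x₂, x₃] ⟨m, hm⟩) : f = g := by
  funext i
  rw [eq_vec₄ i]
  exact LocallyConstant.ext fun ⟨m, hm⟩ => h _ _ _ _ m hm

theorem mem_cocycles₃ {U : PointedCover M} {f : Cochain U 3} :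
    f ∈ cocycles U 3 ↔ ∀ x₀ x₁ x₂ x₃ x₄ m, m ∈ inter U ![x₀, x₁, x₂, x₃, x₄] →
      delta₃ (fun x y z w => total f ![x, y, z, w]) x₀ x₁ x₂ x₃ x₄ m = 0 := by
  change d U 3 f = 0 ↔ _
  constructor
  · intro h x₀ x₁ x₂ x₃ x₄ m hm
    rw [← d₃_apply f hm, h]
    rfl
  · intro h
    funext i
    rw [eq_vec₅ i]
    refine LocallyConstant.ext fun ⟨m, hm⟩ => ?_
    rw [d₃_apply]
    exact h _ _ _ _ _ m hm

/-- The `3`-cochain of a family of functions. -/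
def cochain₃ (U : PointedCover M) (K : M → M → M → M → M → ℤ)
    (hK : ∀ x₀ x₁ x₂ x₃, ContinuousOn (K x₀ x₁ x₂ x₃) {m | m ∈ U.1 x₀ ∧ m ∈ U.1 x₁ ∧ m ∈ U.1 x₂ ∧
      m ∈ U.1 x₃}) : Cochain U 3 := fun i =>
  ofContinuousOn (K (i 0) (i 1) (i 2) (i 3)) ((hK _ _ _ _).mono fun m hm => by
    have := mem_inter.1 hm
    exact ⟨this 0, this 1, this 2, this 3⟩)

theorem total_cochain₃ {U : PointedCover M} {K : M → M → M → M → M → ℤ} {hK}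
    {x₀ x₁ x₂ x₃ m : M} (h : m ∈ U.1 x₀ ∧ m ∈ U.1 x₁ ∧ m ∈ U.1 x₂ ∧ m ∈ U.1 x₃) :
    total (cochain₃ U K hK) ![x₀, x₁, x₂, x₃] m = K x₀ x₁ x₂ x₃ m := by
  rw [total_eq _ (mem_inter₄.2 h)]
  rfl

/-- The `2`-cochain of a family of functions. -/
def cochain₂ (U : PointedCover M) (j : M → M → M → M → ℤ)
    (hj : ∀ x₀ x₁ x₂, ContinuousOn (j x₀ x₁ x₂) {m | m ∈ U.1 x₀ ∧ m ∈ U.1 x₁ ∧ m ∈ U.1 x₂}) :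
    Cochain U 2 := fun i =>
  ofContinuousOn (j (i 0) (i 1) (i 2)) ((hj _ _ _).mono fun m hm => by
    have := mem_inter.1 hm
    exact ⟨this 0, this 1, this 2⟩)

theorem total_cochain₂ {U : PointedCover M} {j : M → M → M → M → ℤ} {hj}
    {x₀ x₁ x₂ m : M} (h : m ∈ U.1 x₀ ∧ m ∈ U.1 x₁ ∧ m ∈ U.1 x₂) :
    total (cochain₂ U j hj) ![x₀, x₁, x₂] m = j x₀ x₁ x₂ m := by
  rw [total_eq _ (mem_inter₃.2 h)]
  rfl

/-- Pointwise intersection is a common refinement with unchanged indices. It makes the index set of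
the direct limit directed, which exactness of the limit needs. -/
instance : Min (PointedCover M) where
  min U V := ⟨fun x => U.1 x ⊓ V.1 x, fun x => ⟨U.2 x, V.2 x⟩⟩

theorem min_le_left (U V : PointedCover M) : min U V ≤ U := fun _ => inf_le_left
theorem min_le_right (U V : PointedCover M) : min U V ≤ V := fun _ => inf_le_right

instance : Nonempty (PointedCover M) := ⟨⟨fun _ => ⊤, fun _ => trivial⟩⟩

instance : IsDirectedOrder (PointedCover M)ᵒᵈ where
  directed U V := ⟨OrderDual.toDual (min (OrderDual.ofDual U) (OrderDual.ofDual V)),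
    min_le_left _ _, min_le_right _ _⟩

instance directedSystem (k : ℕ) : DirectedSystem
    (fun U : (PointedCover M)ᵒᵈ => CoverH (OrderDual.ofDual U) k)
    (fun _ _ h => refineH (OrderDual.ofDual_le_ofDual.2 h) k) where
  map_self U x := by
    obtain ⟨x, rfl⟩ := QuotientAddGroup.mk_surjective x
    rfl
  map_map U V W h h' x := by
    obtain ⟨x, rfl⟩ := QuotientAddGroup.mk_surjective x
    rfl

/-- Restriction of cocycles to a finer cover. -/
def refineCocycle {U V : PointedCover M} (h : V ≤ U) (k : ℕ) (f : cocycles U k) : cocycles V k :=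
  ⟨refine h k f.1, refine_mem_cocycles h k f.2⟩

theorem classOf_refine {U V : PointedCover M} (h : V ≤ U) (k : ℕ) (f : cocycles U k) :
    classOf V k (refineCocycle h k f) = classOf U k f := by
  classical
  exact AddCommGroup.DirectLimit.of_f (ι := (PointedCover M)ᵒᵈ)
    (G := fun U => CoverH (OrderDual.ofDual U) k)
    (f := fun _ _ h => refineH (OrderDual.ofDual_le_ofDual.2 h) k)
    (i := OrderDual.toDual U) (j := OrderDual.toDual V) h (QuotientAddGroup.mk f)

theorem classOf_surjective {k : ℕ} (c : H M k) :
    ∃ (U : PointedCover M) (f : cocycles U k), classOf U k f = c := by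
  classical
  refine AddCommGroup.DirectLimit.induction_on c fun U x => ?_
  obtain ⟨x, rfl⟩ := QuotientAddGroup.mk_surjective x
  exact ⟨OrderDual.ofDual U, x, rfl⟩

/-- An element of a directed limit that vanishes already vanishes at some stage, so a cocycle of
class zero becomes a coboundary after refinement. -/
theorem classOf_eq_zero {U : PointedCover M} {k : ℕ} (f : cocycles U (k + 1))
    (h : classOf U (k + 1) f = 0) :
    ∃ (V : PointedCover M) (hV : V ≤ U) (j : Cochain V k), d V k j = refine hV (k + 1) f.1 := by
  classical
  obtain ⟨V, hV, h0⟩ := AddCommGroup.DirectLimit.of.zero_exact (ι := (PointedCover M)ᵒᵈ)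
    (G := fun U => CoverH (OrderDual.ofDual U) (k + 1))
    (f := fun _ _ h => refineH (OrderDual.ofDual_le_ofDual.2 h) (k + 1))
    (OrderDual.toDual U) (QuotientAddGroup.mk f) h
  have h1 := (QuotientAddGroup.eq_zero_iff (refineCocycle (U := U) (V := OrderDual.ofDual V)
    hV (k + 1) f)).1 h0
  obtain ⟨j, hj⟩ := h1
  exact ⟨OrderDual.ofDual V, hV, j, hj⟩

theorem classOf_eq_zero_of_d {U : PointedCover M} {k : ℕ} (f : cocycles U (k + 1))
    (j : Cochain U k) (h : d U k j = f.1) : classOf U (k + 1) f = 0 := by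
  classical
  have h0 : (QuotientAddGroup.mk f : CoverH U (k + 1)) = 0 :=
    (QuotientAddGroup.eq_zero_iff f).2 ⟨j, h⟩
  exact (congrArg (AddCommGroup.DirectLimit.of (ι := (PointedCover M)ᵒᵈ)
    (fun U => CoverH (OrderDual.ofDual U) (k + 1))
    (fun _ _ h => refineH (OrderDual.ofDual_le_ofDual.2 h) (k + 1)) (OrderDual.toDual U)) h0).trans
    (map_zero _)

theorem classOf_sub (U : PointedCover M) (k : ℕ) (f g : cocycles U k) :
    classOf U k (f - g) = classOf U k f - classOf U k g :=
  eq_sub_of_add_eq (((classOf U k).map_add (f - g) g).symm.trans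
    (congrArg (classOf U k) (sub_add_cancel f g)))

theorem total_refine {U V : PointedCover M} (h : V ≤ U) {k : ℕ} (f : Cochain U k)
    {i : Fin (k + 1) → M} {m : M} (hm : m ∈ inter V i) : total (refine h k f) i m = total f i m := by
  rw [total_eq _ hm, total_eq _ (inter_mono h i hm)]
  rfl

/-- Cocycles which become cohomologous on a common refinement have the same class. -/
theorem classOf_eq_of {U V W : PointedCover M} (hU : W ≤ U) (hV : W ≤ V) (k : cocycles U 3)
    (l : cocycles V 3) (j : M → M → M → M → ℤ)
    (hj : ∀ x₀ x₁ x₂, ContinuousOn (j x₀ x₁ x₂) {m | m ∈ W.1 x₀ ∧ m ∈ W.1 x₁ ∧ m ∈ W.1 x₂})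
    (h : ∀ x₀ x₁ x₂ x₃ m, m ∈ W.1 x₀ → m ∈ W.1 x₁ → m ∈ W.1 x₂ → m ∈ W.1 x₃ →
      total k.1 ![x₀, x₁, x₂, x₃] m - total l.1 ![x₀, x₁, x₂, x₃] m = delta₂ j x₀ x₁ x₂ x₃ m) :
    classOf U 3 k = classOf V 3 l := by
  rw [← sub_eq_zero, ← classOf_refine hU, ← classOf_refine hV, ← classOf_sub]
  refine classOf_eq_zero_of_d _ (cochain₂ W j hj) (ext₄ fun x₀ x₁ x₂ x₃ m hm => ?_)
  obtain ⟨h0, h1, h2, h3⟩ := mem_inter₄.1 hm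
  rw [d₂_apply]
  simp only [delta₂]
  rw [total_cochain₂ ⟨h1, h2, h3⟩, total_cochain₂ ⟨h0, h2, h3⟩, total_cochain₂ ⟨h0, h1, h3⟩,
    total_cochain₂ ⟨h0, h1, h2⟩]
  refine (h x₀ x₁ x₂ x₃ m h0 h1 h2 h3).symm.trans ?_
  rw [← total_refine hU k.1 hm, ← total_refine hV l.1 hm, total_eq _ hm, total_eq _ hm]
  rfl

/-- The real functions `κ` are the values of an integer cocycle on `U` of class `c`. -/
def Represents (U : PointedCover M) (κ : M → M → M → M → M → ℝ) (c : H M 3) : Prop :=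
  ∃ k : cocycles U 3, (∀ x₀ x₁ x₂ x₃ m, m ∈ U.1 x₀ → m ∈ U.1 x₁ → m ∈ U.1 x₂ → m ∈ U.1 x₃ →
    (total k.1 ![x₀, x₁, x₂, x₃] m : ℝ) = κ x₀ x₁ x₂ x₃ m) ∧ c = classOf U 3 k

/-- Cocycles pulled back along a refinement map represent the same class. -/
theorem Represents.comp {U V : PointedCover M} {κ : M → M → M → M → M → ℝ} {c : H M 3}
    (h : Represents U κ c) (τ : M → M) (hτ : ∀ x, V.1 x ≤ U.1 (τ x)) :
    Represents V (fun x₀ x₁ x₂ x₃ => κ (τ x₀) (τ x₁) (τ x₂) (τ x₃)) c := by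
  obtain ⟨k, hk, rfl⟩ := h
  set K : M → M → M → M → M → ℤ := fun x y z w => total k.1 ![x, y, z, w] with hKdef
  have hKc : ∀ x₀ x₁ x₂ x₃, ContinuousOn (K x₀ x₁ x₂ x₃)
      {m | m ∈ U.1 x₀ ∧ m ∈ U.1 x₁ ∧ m ∈ U.1 x₂ ∧ m ∈ U.1 x₃} := fun x₀ x₁ x₂ x₃ =>
    (continuousOn_total k.1 _).mono fun m hm => mem_inter₄.2 hm
  have hKd : ∀ x₀ x₁ x₂ x₃ x₄ m, m ∈ U.1 x₀ → m ∈ U.1 x₁ → m ∈ U.1 x₂ → m ∈ U.1 x₃ →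
      m ∈ U.1 x₄ → delta₃ K x₀ x₁ x₂ x₃ x₄ m = 0 := fun x₀ x₁ x₂ x₃ x₄ m h0 h1 h2 h3 h4 =>
    mem_cocycles₃.1 k.2 _ _ _ _ _ _ (mem_inter₅.2 ⟨h0, h1, h2, h3, h4⟩)
  have hLc : ∀ x₀ x₁ x₂ x₃, ContinuousOn (K (τ x₀) (τ x₁) (τ x₂) (τ x₃))
      {m | m ∈ V.1 x₀ ∧ m ∈ V.1 x₁ ∧ m ∈ V.1 x₂ ∧ m ∈ V.1 x₃} := fun x₀ x₁ x₂ x₃ =>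
    (hKc _ _ _ _).mono fun m hm => ⟨hτ _ hm.1, hτ _ hm.2.1, hτ _ hm.2.2.1, hτ _ hm.2.2.2⟩
  let l : Cochain V 3 := cochain₃ V (fun x₀ x₁ x₂ x₃ => K (τ x₀) (τ x₁) (τ x₂) (τ x₃)) hLc
  have hl : l ∈ cocycles V 3 := by
    refine mem_cocycles₃.2 fun x₀ x₁ x₂ x₃ x₄ m hm => ?_
    obtain ⟨h0, h1, h2, h3, h4⟩ := mem_inter₅.1 hm
    refine Eq.trans ?_ (hKd _ _ _ _ _ m (hτ _ h0) (hτ _ h1) (hτ _ h2) (hτ _ h3) (hτ _ h4))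
    simp only [delta₃, l]
    rw [total_cochain₃ ⟨h1, h2, h3, h4⟩, total_cochain₃ ⟨h0, h2, h3, h4⟩,
      total_cochain₃ ⟨h0, h1, h3, h4⟩, total_cochain₃ ⟨h0, h1, h2, h4⟩,
      total_cochain₃ ⟨h0, h1, h2, h3⟩]
  refine ⟨⟨l, hl⟩, fun x₀ x₁ x₂ x₃ m h0 h1 h2 h3 => ?_, ?_⟩
  · change _ = κ (τ x₀) (τ x₁) (τ x₂) (τ x₃) m
    rw [← hk _ _ _ _ m (hτ _ h0) (hτ _ h1) (hτ _ h2) (hτ _ h3)]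
    exact congrArg _ (total_cochain₃ (hK := hLc) ⟨h0, h1, h2, h3⟩)
  -- The prism operator: the witness is minus the chain homotopy between the identity and `τ`. Its
  -- terms mix the indices `x` and `τ x`, so they only make sense on the common refinement `min U
  -- V`.
  · refine classOf_eq_of (min_le_left U V) (min_le_right U V) k ⟨l, hl⟩
      (fun x₀ x₁ x₂ m => -(K x₀ (τ x₀) (τ x₁) (τ x₂) m - K x₀ x₁ (τ x₁) (τ x₂) m +
        K x₀ x₁ x₂ (τ x₂) m)) (fun x₀ x₁ x₂ => ?_) fun x₀ x₁ x₂ x₃ m h0 h1 h2 h3 => ?_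
    · refine ContinuousOn.neg (((ContinuousOn.mono (hKc _ _ _ _) ?_).sub
        (ContinuousOn.mono (hKc _ _ _ _) ?_)).add (ContinuousOn.mono (hKc _ _ _ _) ?_))
      · exact fun m hm => ⟨hm.1.1, hτ _ hm.1.2, hτ _ hm.2.1.2, hτ _ hm.2.2.2⟩
      · exact fun m hm => ⟨hm.1.1, hm.2.1.1, hτ _ hm.2.1.2, hτ _ hm.2.2.2⟩
      · exact fun m hm => ⟨hm.1.1, hm.2.1.1, hm.2.2.1, hτ _ hm.2.2.2⟩
    · have e := total_cochain₃ (hK := hLc) ⟨h0.2, h1.2, h2.2, h3.2⟩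
      have e' : total (⟨l, hl⟩ : cocycles V 3).1 ![x₀, x₁, x₂, x₃] m =
        K (τ x₀) (τ x₁) (τ x₂) (τ x₃) m := e
      rw [e']
      -- The cocycle identities on the simplices `(x₀, …, xᵢ, τxᵢ, …, τx₃)` of the prism. In their
      -- alternating sum the interior faces cancel.
      have a0 := hKd _ _ _ _ _ m h0.1 (hτ _ h0.2) (hτ _ h1.2) (hτ _ h2.2) (hτ _ h3.2)
      have a1 := hKd _ _ _ _ _ m h0.1 h1.1 (hτ _ h1.2) (hτ _ h2.2) (hτ _ h3.2)
      have a2 := hKd _ _ _ _ _ m h0.1 h1.1 h2.1 (hτ _ h2.2) (hτ _ h3.2)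
      have a3 := hKd _ _ _ _ _ m h0.1 h1.1 h2.1 h3.1 (hτ _ h3.2)
      change K x₀ x₁ x₂ x₃ m - _ = _
      simp only [delta₃, delta₂] at a0 a1 a2 a3 ⊢
      linear_combination -a0 + a1 - a2 + a3

theorem Represents.eq_zero {U : PointedCover M} {κ : M → M → M → M → M → ℝ} {c : H M 3}
    (h : Represents U κ c) (j : M → M → M → M → ℤ)
    (hj : ∀ x₀ x₁ x₂, ContinuousOn (j x₀ x₁ x₂) {m | m ∈ U.1 x₀ ∧ m ∈ U.1 x₁ ∧ m ∈ U.1 x₂})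
    (e : ∀ x₀ x₁ x₂ x₃ m, m ∈ U.1 x₀ → m ∈ U.1 x₁ → m ∈ U.1 x₂ → m ∈ U.1 x₃ →
      κ x₀ x₁ x₂ x₃ m = delta₂ j x₀ x₁ x₂ x₃ m) : c = 0 := by
  obtain ⟨k, hk, rfl⟩ := h
  rw [← map_zero (classOf U 3)]
  refine classOf_eq_of le_rfl le_rfl k 0 j hj fun x₀ x₁ x₂ x₃ m h0 h1 h2 h3 => ?_
  have z : total (0 : cocycles U 3).1 ![x₀, x₁, x₂, x₃] m = 0 := by
    rw [total_eq _ (mem_inter₄.2 ⟨h0, h1, h2, h3⟩)]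
    rfl
  rw [z, sub_zero, ← Int.cast_inj (α := ℝ), hk _ _ _ _ _ h0 h1 h2 h3, e _ _ _ _ _ h0 h1 h2 h3]

/-- The refinement `V` is unavoidable, since vanishing is tested in the direct limit. As it keeps
the indices, the functions `κ` are used on it unchanged. -/
theorem Represents.exists_of_zero {U : PointedCover M} {κ : M → M → M → M → M → ℝ}
    (h : Represents U κ 0) : ∃ V ≤ U, ∃ j : M → M → M → M → ℤ,
      (∀ x₀ x₁ x₂, ContinuousOn (j x₀ x₁ x₂) {m | m ∈ V.1 x₀ ∧ m ∈ V.1 x₁ ∧ m ∈ V.1 x₂}) ∧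
      ∀ x₀ x₁ x₂ x₃ m, m ∈ V.1 x₀ → m ∈ V.1 x₁ → m ∈ V.1 x₂ → m ∈ V.1 x₃ →
        κ x₀ x₁ x₂ x₃ m = delta₂ j x₀ x₁ x₂ x₃ m := by
  obtain ⟨k, hk, h0⟩ := h
  obtain ⟨V, hV, j, hj⟩ := classOf_eq_zero k h0.symm
  refine ⟨V, hV, fun x y z => total j ![x, y, z], fun x₀ x₁ x₂ =>
    (continuousOn_total j _).mono fun m hm => mem_inter₃.2 hm,
    fun x₀ x₁ x₂ x₃ m h0 h1 h2 h3 => ?_⟩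
  have hm := mem_inter₄.2 ⟨h0, h1, h2, h3⟩
  rw [← d₂_apply j hm, hj, ← hk _ _ _ _ _ (hV _ h0) (hV _ h1) (hV _ h2) (hV _ h3),
    ← total_refine hV k.1 hm, total_eq _ hm]

theorem Represents.sub {U V : PointedCover M} {κ μ : M → M → M → M → M → ℝ} {b c : H M 3}
    (h : Represents U κ b) (h' : Represents V μ c) :
    Represents (min U V) (fun x₀ x₁ x₂ x₃ m => κ x₀ x₁ x₂ x₃ m - μ x₀ x₁ x₂ x₃ m) (b - c) := by
  obtain ⟨k, hk, rfl⟩ := h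
  obtain ⟨l, hl, rfl⟩ := h'
  refine ⟨refineCocycle (min_le_left U V) 3 k - refineCocycle (min_le_right U V) 3 l,
    fun x₀ x₁ x₂ x₃ m h0 h1 h2 h3 => ?_, by rw [classOf_sub, classOf_refine, classOf_refine]⟩
  have hm := mem_inter₄.2 ⟨h0, h1, h2, h3⟩
  change _ = κ x₀ x₁ x₂ x₃ m - μ x₀ x₁ x₂ x₃ m
  rw [← hk _ _ _ _ _ h0.1 h1.1 h2.1 h3.1, ← hl _ _ _ _ _ h0.2 h1.2 h2.2 h3.2,
    ← total_refine (min_le_left U V) k.1 hm, ← total_refine (min_le_right U V) l.1 hm,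
    total_eq _ hm, total_eq _ hm, total_eq _ hm, ← Int.cast_sub]
  rfl

/-- `ℤ` is embedded in `ℝ`, so continuity of the real values already makes the integer function
locally constant. -/
theorem continuousOn_of_intCast {X : Type*} [TopologicalSpace X] {f : X → ℤ} {g : X → ℝ}
    {W : Set X} (hg : ContinuousOn g W) (h : ∀ x ∈ W, (f x : ℝ) = g x) : ContinuousOn f W := by
  refine (Int.isClosedEmbedding_coe_real.isEmbedding.continuousOn_iff).2 (hg.congr h)

/-- The differential of a real cochain, if integral, represents a class. -/
theorem exists_represents {U : PointedCover M} {θ : M → M → M → M → ℝ}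
    (hθ : ∀ x₀ x₁ x₂, ContinuousOn (θ x₀ x₁ x₂) {m | m ∈ U.1 x₀ ∧ m ∈ U.1 x₁ ∧ m ∈ U.1 x₂})
    (h : ∀ x₀ x₁ x₂ x₃ m, m ∈ U.1 x₀ → m ∈ U.1 x₁ → m ∈ U.1 x₂ → m ∈ U.1 x₃ →
      ∃ N : ℤ, (N : ℝ) = delta₂ θ x₀ x₁ x₂ x₃ m) : ∃ c, Represents U (delta₂ θ) c := by
  -- On the fourfold overlaps the value is already an integer and the floor changes nothing.
  -- Elsewhere it supplies a value that plays no role.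
  let K : M → M → M → M → M → ℤ := fun x₀ x₁ x₂ x₃ m => ⌊delta₂ θ x₀ x₁ x₂ x₃ m⌋
  have hK : ∀ x₀ x₁ x₂ x₃ m, m ∈ U.1 x₀ → m ∈ U.1 x₁ → m ∈ U.1 x₂ → m ∈ U.1 x₃ →
      (K x₀ x₁ x₂ x₃ m : ℝ) = delta₂ θ x₀ x₁ x₂ x₃ m := fun x₀ x₁ x₂ x₃ m h0 h1 h2 h3 => by
    obtain ⟨N, hN⟩ := h x₀ x₁ x₂ x₃ m h0 h1 h2 h3
    simp only [K, ← hN, Int.floor_intCast]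
  have hKc : ∀ x₀ x₁ x₂ x₃, ContinuousOn (K x₀ x₁ x₂ x₃)
      {m | m ∈ U.1 x₀ ∧ m ∈ U.1 x₁ ∧ m ∈ U.1 x₂ ∧ m ∈ U.1 x₃} := fun x₀ x₁ x₂ x₃ => by
    refine continuousOn_of_intCast (g := delta₂ θ x₀ x₁ x₂ x₃) ?_
      fun m hm => hK _ _ _ _ m hm.1 hm.2.1 hm.2.2.1 hm.2.2.2
    refine (((ContinuousOn.mono (hθ _ _ _) ?_).sub (ContinuousOn.mono (hθ _ _ _) ?_)).add
      (ContinuousOn.mono (hθ _ _ _) ?_)).sub (ContinuousOn.mono (hθ _ _ _) ?_)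
    · exact fun m hm => ⟨hm.2.1, hm.2.2.1, hm.2.2.2⟩
    · exact fun m hm => ⟨hm.1, hm.2.2.1, hm.2.2.2⟩
    · exact fun m hm => ⟨hm.1, hm.2.1, hm.2.2.2⟩
    · exact fun m hm => ⟨hm.1, hm.2.1, hm.2.2.1⟩
  have hc : cochain₃ U K hKc ∈ cocycles U 3 := by
    refine mem_cocycles₃.2 fun x₀ x₁ x₂ x₃ x₄ m hm => ?_
    obtain ⟨h0, h1, h2, h3, h4⟩ := mem_inter₅.1 hm
    simp only [delta₃]
    rw [total_cochain₃ ⟨h1, h2, h3, h4⟩, total_cochain₃ ⟨h0, h2, h3, h4⟩,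
      total_cochain₃ ⟨h0, h1, h3, h4⟩, total_cochain₃ ⟨h0, h1, h2, h4⟩,
      total_cochain₃ ⟨h0, h1, h2, h3⟩, ← Int.cast_inj (α := ℝ)]
    push_cast
    rw [hK _ _ _ _ _ h1 h2 h3 h4, hK _ _ _ _ _ h0 h2 h3 h4, hK _ _ _ _ _ h0 h1 h3 h4,
      hK _ _ _ _ _ h0 h1 h2 h4, hK _ _ _ _ _ h0 h1 h2 h3]
    exact delta₃_delta₂ θ x₀ x₁ x₂ x₃ x₄ m
  refine ⟨_, ⟨_, hc⟩, fun x₀ x₁ x₂ x₃ m h0 h1 h2 h3 => ?_, rfl⟩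
  rw [← hK _ _ _ _ _ h0 h1 h2 h3]
  exact congrArg _ (total_cochain₃ (hK := hKc) ⟨h0, h1, h2, h3⟩)

end Cech

end

/-! ### Refining covers so that local choices exist on all triple overlaps -/

section

open TopologicalSpace

/-- This replaces good covers: a property of overlaps that holds near every point and passes to
smaller open sets holds on whole overlaps of a refinement. The difficulty is that one neighbourhood
`V x` must serve all indices at once. Local finiteness leaves finitely many indices near `x`, and
shrinking the cover ensures that if `V x` meets `V y`, then `x` itself lies in `U (τ y)`. The local
hypothesis at `x` then applies to the actual triple of indices, and `V x` was chosen inside the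
resulting neighbourhood. -/
theorem Cech.exists_refinement {M : Type u} [TopologicalSpace M] [ParacompactSpace M] [T2Space M]
    (U : Cech.PointedCover M) (Q : M → M → M → Opens M → Prop)
    (hmono : ∀ i j k W W', W' ≤ W → Q i j k W → Q i j k W') (hbot : ∀ i j k, Q i j k ⊥)
    (hloc : ∀ i j k x, x ∈ U.1 i → x ∈ U.1 j → x ∈ U.1 k → ∃ W, x ∈ W ∧ Q i j k W) :
    ∃ (V : Cech.PointedCover M) (τ : M → M), (∀ x, V.1 x ≤ U.1 (τ x)) ∧
      ∀ x y z, Q (τ x) (τ y) (τ z) (V.1 x ⊓ V.1 y ⊓ V.1 z) := by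
  obtain ⟨v, vo, vc, vlf, vsub⟩ := precise_refinement (fun x => (U.1 x : Set M))
    (fun x => (U.1 x).isOpen) (iUnion_eq_univ_iff.2 fun x => ⟨x, U.2 x⟩)
  obtain ⟨w, wc, wo, hw⟩ := exists_iUnion_eq_closure_subset vo vlf.point_finite vc
  choose τ hτ using fun x => iUnion_eq_univ_iff.1 wc x
  choose N hN hfin using vlf
  -- The neighbourhood is made total in the indices, with `⊤` when `x` is outside the triple
  -- overlap, so that finite intersections over all nearby triples can be formed.
  have hW : ∀ i j k x, ∃ W : Opens M, x ∈ W ∧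
      (x ∈ U.1 i → x ∈ U.1 j → x ∈ U.1 k → Q i j k W) := by
    intro i j k x
    by_cases h : x ∈ U.1 i ∧ x ∈ U.1 j ∧ x ∈ U.1 k
    · obtain ⟨W, hx, hQ⟩ := hloc i j k x h.1 h.2.1 h.2.2
      exact ⟨W, hx, fun _ _ _ => hQ⟩
    · exact ⟨⊤, trivial, fun h1 h2 h3 => (h ⟨h1, h2, h3⟩).elim⟩
  choose W hxW hQ using hW
  let F : M → Set M := fun x => {i | (v i ∩ N x).Nonempty}
  -- The third factor removes those nearby closed sets `closure (w i)` that do not contain `x`. Only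
  -- the finitely many `i ∈ F x` are involved, so the result stays open.
  let V : M → Set M := fun x => interior (N x) ∩ w (τ x) ∩
    (⋂ i ∈ F x, {m | m ∈ closure (w i) → x ∈ closure (w i)}) ∩
    ⋂ i ∈ F x, ⋂ j ∈ F x, ⋂ k ∈ F x, (W i j k x : Set M)
  have hVo : ∀ x, IsOpen (V x) := by
    intro x
    refine ((isOpen_interior.inter (wo _)).inter ((hfin x).isOpen_biInter fun i _ => ?_)).inter
      ((hfin x).isOpen_biInter fun i _ => (hfin x).isOpen_biInter fun j _ =>
        (hfin x).isOpen_biInter fun k _ => (W i j k x).isOpen)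
    by_cases h : x ∈ closure (w i)
    · simp [h]
    · simp only [h, imp_false]
      exact isClosed_closure.isOpen_compl
  have hVx : ∀ x, x ∈ V x := fun x => ⟨⟨⟨mem_interior_iff_mem_nhds.2 (hN x), hτ x⟩,
    mem_iInter₂.2 fun i _ h => h⟩, mem_iInter₂.2 fun i _ => mem_iInter₂.2 fun j _ =>
    mem_iInter₂.2 fun k _ => hxW i j k x⟩
  have key : ∀ x y m, m ∈ V x → m ∈ V y → τ y ∈ F x ∧ x ∈ U.1 (τ y) := by
    intro x y m hx hy
    have h1 : m ∈ v (τ y) := hw _ (subset_closure hy.1.1.2)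
    have h2 : τ y ∈ F x := ⟨m, h1, interior_subset hx.1.1.1⟩
    exact ⟨h2, vsub _ (hw _ (mem_iInter₂.1 hx.1.2 _ h2 (subset_closure hy.1.1.2)))⟩
  refine ⟨⟨fun x => ⟨V x, hVo x⟩, hVx⟩, τ,
    fun x m hm => vsub _ (hw _ (subset_closure hm.1.1.2)), fun x y z => ?_⟩
  by_cases h : ∃ m, m ∈ V x ∧ m ∈ V y ∧ m ∈ V z
  · obtain ⟨m, hx, hy, hz⟩ := h
    obtain ⟨a1, b1⟩ := key x x m hx hx
    obtain ⟨a2, b2⟩ := key x y m hx hy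
    obtain ⟨a3, b3⟩ := key x z m hx hz
    refine hmono _ _ _ _ _ ?_ (hQ _ _ _ _ b1 b2 b3)
    rintro m' ⟨⟨hm', -⟩, -⟩
    exact mem_iInter₂.1 (mem_iInter₂.1 (mem_iInter₂.1 hm'.2 _ a1) _ a2) _ a3
  -- For an empty triple overlap `τ x`, `τ y`, `τ z` need not be admissible at any common point,
  -- which is why the property is assumed on `⊥`.
  · convert hbot (τ x) (τ y) (τ z)
    ext m
    simp only [Opens.coe_inf, Opens.coe_bot, mem_empty_iff_false, iff_false]
    rintro ⟨⟨h1, h2⟩, h3⟩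
    exact h ⟨m, h1, h2, h3⟩

/-! ### Local logarithms of circle-valued functions -/

section Analysis

variable {E : Type*} [NormedAddCommGroup E] [NormedSpace ℝ E] {M : Type*} [TopologicalSpace M]
  [ChartedSpace E M]

theorem contMDiff_circle_coe : ContMDiff (𝓡 1) 𝓘(ℝ, ℂ) ∞ (fun z : Circle => (z : ℂ)) := by
  have := finrank_real_complex_fact'
  exact contMDiff_coe_sphere (E := ℂ) (n := 1)

/-- Smooth circle-valued functions have smooth local logarithms. -/
theorem exists_local_log {f : M → Circle} {W : Set M} (hW : IsOpen W)
    (hf : ContMDiffOn 𝓘(ℝ, E) (𝓡 1) ∞ f W) {x : M} (hx : x ∈ W) :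
    ∃ V : Opens M, x ∈ V ∧ ∃ ζ : M → ℝ, ContMDiffOn 𝓘(ℝ, E) 𝓘(ℝ) ∞ ζ V ∧
      ∀ m ∈ V, Circle.exp (2 * Real.pi * ζ m) = f m := by
  -- Division by `f x` moves the value at `x` to `1`, inside the slit plane where the principal
  -- argument is smooth. The constant `arg (f x)` is added back.
  have h1 : ContMDiffOn 𝓘(ℝ, E) 𝓘(ℝ, ℂ) ∞ (fun m => ((f m * (f x)⁻¹ : Circle) : ℂ)) W :=
    contMDiff_circle_coe.comp_contMDiffOn (hf.mul contMDiffOn_const)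
  have ho := h1.continuousOn.isOpen_inter_preimage hW Complex.isOpen_slitPlane
  refine ⟨⟨_, ho⟩, ⟨hx, by simp⟩, fun m => (Complex.arg (f x : ℂ) +
    Complex.arg ((f m * (f x)⁻¹ : Circle) : ℂ)) / (2 * Real.pi), ?_, fun m hm => ?_⟩
  · rintro m ⟨hm, hs⟩
    have h2 : ContDiffAt ℝ ∞ (fun z : ℂ => (Complex.arg (f x : ℂ) + Complex.arg z) / (2 * Real.pi))
        ((f m * (f x)⁻¹ : Circle) : ℂ) := by
      refine ContDiffAt.div_const (contDiffAt_const.add ?_) _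
      have e : Complex.arg = Complex.imCLM ∘ Complex.log := funext fun z => (Complex.log_im z).symm
      rw [e]
      exact Complex.imCLM.contDiff.contDiffAt.comp _ ((Complex.contDiffAt_log hs).restrict_scalars ℝ)
    exact (h2.contMDiffAt.comp_contMDiffWithinAt m (h1 m hm)).mono inter_subset_left
  · have e : 2 * Real.pi * ((Complex.arg (f x : ℂ) +
        Complex.arg ((f m * (f x)⁻¹ : Circle) : ℂ)) / (2 * Real.pi)) =
        Complex.arg (f x : ℂ) + Complex.arg ((f m * (f x)⁻¹ : Circle) : ℂ) := by
      field_simp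
    rw [e, Circle.exp_add, Circle.exp_arg, Circle.exp_arg, mul_comm, inv_mul_cancel_right]

end Analysis

/-! ### Smooth real cocycles are coboundaries -/

section Cone

variable {n : ℕ} {M : Type u} [TopologicalSpace M]
  [ChartedSpace (EuclideanSpace ℝ (Fin n)) M]

theorem sigmaCompactSpace_of_manifold (n : ℕ) (M : Type u) [TopologicalSpace M]
    [ChartedSpace (EuclideanSpace ℝ (Fin n)) M] [SecondCountableTopology M] : SigmaCompactSpace M := by
  have : LocallyCompactSpace M := ChartedSpace.locallyCompactSpace (EuclideanSpace ℝ (Fin n)) M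
  infer_instance

/-- The support of `φ w` lies in `U w`, so smoothness of `F w` is needed only there although the sum
is smooth on all of `W`. Junk values of `F w` off `U w` are harmless. -/
theorem SmoothPartitionOfUnity.contMDiffOn_finsum_mul {U : Cech.PointedCover M}
    {φ : SmoothPartitionOfUnity M (𝓡 n) M} (hφ : φ.IsSubordinate fun x => (U.1 x : Set M))
    {F : M → M → ℝ} {W : Set M} (hW : IsOpen W)
    (hF : ∀ w, ContMDiffOn (𝓡 n) 𝓘(ℝ) ∞ (F w) (U.1 w ∩ W)) :
    ContMDiffOn (𝓡 n) 𝓘(ℝ) ∞ (fun m => ∑ᶠ w, φ w m * F w m) W := fun _ hm =>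
  (φ.contMDiffAt_finsum fun w hw => (hF w).contMDiffAt
    (((U.1 w).isOpen.inter hW).mem_nhds ⟨hφ w hw, hm⟩)).contMDiffWithinAt

theorem SmoothPartitionOfUnity.finsum_eq_sum (φ : SmoothPartitionOfUnity M (𝓡 n) M)
    (m : M) (F : M → ℝ) : ∑ᶠ w, φ w m * F w = ∑ w ∈ φ.finsupport m, φ w m * F w :=
  finsum_eq_sum_of_support_subset _ fun w hw => by
    rw [φ.coe_finsupport]
    exact left_ne_zero_of_mul hw

theorem SmoothPartitionOfUnity.mem_of_mem_finsupport {U : Cech.PointedCover M}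
    {φ : SmoothPartitionOfUnity M (𝓡 n) M} (hφ : φ.IsSubordinate fun x => (U.1 x : Set M))
    {m w : M} (h : w ∈ φ.finsupport m) : m ∈ U.1 w :=
  hφ w (subset_tsupport _ ((φ.mem_finsupport m).1 h))

theorem SmoothPartitionOfUnity.sum_mul_const (φ : SmoothPartitionOfUnity M (𝓡 n) M) (m : M)
    (a : ℝ) : ∑ w ∈ φ.finsupport m, φ w m * a = a := by
  rw [← Finset.sum_mul, φ.sum_finsupport m (mem_univ m), one_mul]

variable [IsManifold (𝓡 n) ∞ M] [T2Space M] [SecondCountableTopology M]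

variable (n) in
theorem exists_partition (U : Cech.PointedCover M) :
    ∃ φ : SmoothPartitionOfUnity M (𝓡 n) M, φ.IsSubordinate fun x => (U.1 x : Set M) := by
  have := sigmaCompactSpace_of_manifold n M
  exact SmoothPartitionOfUnity.exists_isSubordinate (𝓡 n) isClosed_univ _
    (fun x => (U.1 x).isOpen) fun x _ => mem_iUnion.2 ⟨x, U.2 x⟩

/-- Smooth real `2`-cocycles are coboundaries. -/
theorem Cech.exists_smooth_primitive₂ (U : Cech.PointedCover M) (θ : M → M → M → M → ℝ)
    (hθ : ∀ x y z, ContMDiffOn (𝓡 n) 𝓘(ℝ) ∞ (θ x y z) (U.1 x ∩ U.1 y ∩ U.1 z))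
    (hd : ∀ x₀ x₁ x₂ x₃ m, m ∈ U.1 x₀ → m ∈ U.1 x₁ → m ∈ U.1 x₂ → m ∈ U.1 x₃ →
      Cech.delta₂ θ x₀ x₁ x₂ x₃ m = 0) :
    ∃ η : M → M → M → ℝ, (∀ x y, ContMDiffOn (𝓡 n) 𝓘(ℝ) ∞ (η x y) (U.1 x ∩ U.1 y)) ∧
      ∀ x y z m, m ∈ U.1 x → m ∈ U.1 y → m ∈ U.1 z → η y z m - η x z m + η x y m = θ x y z m := by
  obtain ⟨φ, hφ⟩ := exists_partition n U
  -- The contracting homotopy of a fine sheaf: averaging over an inserted first index. The cocycle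
  -- identity at `(w, x, y, z)` makes the coboundary of the average equal to the average of the
  -- constant `θ x y z m`.
  refine ⟨fun x y m => ∑ᶠ w, φ w m * θ w x y m, fun x y =>
    SmoothPartitionOfUnity.contMDiffOn_finsum_mul hφ ((U.1 x).isOpen.inter (U.1 y).isOpen)
      fun w => (hθ w x y).mono fun m hm => ⟨⟨hm.1, hm.2.1⟩, hm.2.2⟩, fun x y z m hx hy hz => ?_⟩
  simp only [φ.finsum_eq_sum m]
  rw [← Finset.sum_sub_distrib, ← Finset.sum_add_distrib]
  refine Eq.trans (Finset.sum_congr rfl fun w hw => ?_) (φ.sum_mul_const m (θ x y z m))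
  have := hd w x y z m (SmoothPartitionOfUnity.mem_of_mem_finsupport hφ hw) hx hy hz
  simp only [Cech.delta₂] at this
  linear_combination (-φ w m) * this

/-- Smooth real `3`-cocycles are coboundaries. -/
theorem Cech.exists_smooth_primitive₃ (U : Cech.PointedCover M) (κ : M → M → M → M → M → ℝ)
    (hκ : ∀ x y z w, ContMDiffOn (𝓡 n) 𝓘(ℝ) ∞ (κ x y z w) (U.1 x ∩ U.1 y ∩ U.1 z ∩ U.1 w))
    (hd : ∀ x₀ x₁ x₂ x₃ x₄ m, m ∈ U.1 x₀ → m ∈ U.1 x₁ → m ∈ U.1 x₂ → m ∈ U.1 x₃ → m ∈ U.1 x₄ →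
      Cech.delta₃ κ x₀ x₁ x₂ x₃ x₄ m = 0) :
    ∃ θ : M → M → M → M → ℝ,
      (∀ x y z, ContMDiffOn (𝓡 n) 𝓘(ℝ) ∞ (θ x y z) (U.1 x ∩ U.1 y ∩ U.1 z)) ∧
      ∀ x₀ x₁ x₂ x₃ m, m ∈ U.1 x₀ → m ∈ U.1 x₁ → m ∈ U.1 x₂ → m ∈ U.1 x₃ →
        Cech.delta₂ θ x₀ x₁ x₂ x₃ m = κ x₀ x₁ x₂ x₃ m := by
  obtain ⟨φ, hφ⟩ := exists_partition n U
  refine ⟨fun x y z m => ∑ᶠ w, φ w m * κ w x y z m, fun x y z =>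
    SmoothPartitionOfUnity.contMDiffOn_finsum_mul hφ
      (((U.1 x).isOpen.inter (U.1 y).isOpen).inter (U.1 z).isOpen)
      fun w => (hκ w x y z).mono fun m hm => ⟨⟨⟨hm.1, hm.2.1.1⟩, hm.2.1.2⟩, hm.2.2⟩,
    fun x₀ x₁ x₂ x₃ m h0 h1 h2 h3 => ?_⟩
  simp only [Cech.delta₂, φ.finsum_eq_sum m]
  rw [← Finset.sum_sub_distrib, ← Finset.sum_add_distrib, ← Finset.sum_sub_distrib]
  refine Eq.trans (Finset.sum_congr rfl fun w hw => ?_) (φ.sum_mul_const m (κ x₀ x₁ x₂ x₃ m))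
  have := hd w x₀ x₁ x₂ x₃ m (SmoothPartitionOfUnity.mem_of_mem_finsupport hφ hw) h0 h1 h2 h3
  simp only [Cech.delta₃] at this
  linear_combination (-φ w m) * this

end Cone

end

/-! ### Sections of `U(1)` bundles along maps, and gerbe multiplication along maps -/

section

open TopologicalSpace SurjSubmersion

section Opens

variable {E : Type*} [NormedAddCommGroup E] [NormedSpace ℝ E] {N : Type*} [TopologicalSpace N]
  [ChartedSpace E N] {E' : Type*} [NormedAddCommGroup E'] [NormedSpace ℝ E'] {N' : Type*}
  [TopologicalSpace N'] [ChartedSpace E' N']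

theorem contMDiffOn_iff_opens {f : N → N'} {W : Opens N} :
    ContMDiffOn 𝓘(ℝ, E) 𝓘(ℝ, E') ∞ f W ↔ ContMDiff 𝓘(ℝ, E) 𝓘(ℝ, E') ∞ (fun x : W => f x) := by
  constructor
  · intro h x
    exact contMDiffAt_subtype_iff.2 (h.contMDiffAt (W.isOpen.mem_nhds x.2))
  · intro h x hx
    exact (contMDiffAt_subtype_iff.1 (h ⟨x, hx⟩)).contMDiffWithinAt

end Opens

namespace SurjSubmersion

variable {n : ℕ} {M : Type u} [TopologicalSpace M]
  [ChartedSpace (EuclideanSpace ℝ (Fin n)) M] [IsManifold (𝓡 n) ∞ M] {S T : SurjSubmersion n M}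
  {E' : Type*} [NormedAddCommGroup E'] [NormedSpace ℝ E'] {N : Type*}
  [TopologicalSpace N] [ChartedSpace E' N]

theorem contMDiffOn_of_comp {f : N → (S.fiberProd T).Y} {W : Set N} (hW : IsOpen W)
    (h1 : ContMDiffOn 𝓘(ℝ, E') 𝓘(ℝ, S.E) ∞ (fun z => S.fst T (f z)) W)
    (h2 : ContMDiffOn 𝓘(ℝ, E') 𝓘(ℝ, T.E) ∞ (fun z => S.snd T (f z)) W) :
    ContMDiffOn 𝓘(ℝ, E') 𝓘(ℝ, (S.fiberProd T).E) ∞ f W :=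
  (contMDiffOn_iff_opens (W := ⟨W, hW⟩)).2 (contMDiff_of_comp
    ((contMDiffOn_iff_opens (W := ⟨W, hW⟩)).1 h1) ((contMDiffOn_iff_opens (W := ⟨W, hW⟩)).1 h2))

theorem contMDiffOn_pair {a b : N → S.Y} {W : Set N} (hW : IsOpen W)
    (ha : ContMDiffOn 𝓘(ℝ, E') 𝓘(ℝ, S.E) ∞ a W) (hb : ContMDiffOn 𝓘(ℝ, E') 𝓘(ℝ, S.E) ∞ b W)
    (h : ∀ z, S.proj (a z) = S.proj (b z)) :
    ContMDiffOn 𝓘(ℝ, E') 𝓘(ℝ, S.sq.E) ∞ (fun z => pair (a z) (b z) (h z)) W :=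
  contMDiffOn_of_comp hW ha hb

theorem contMDiffOn_triple {a b c : N → S.Y} {W : Set N} (hW : IsOpen W)
    (ha : ContMDiffOn 𝓘(ℝ, E') 𝓘(ℝ, S.E) ∞ a W) (hb : ContMDiffOn 𝓘(ℝ, E') 𝓘(ℝ, S.E) ∞ b W)
    (hc : ContMDiffOn 𝓘(ℝ, E') 𝓘(ℝ, S.E) ∞ c W)
    (h : ∀ z, S.proj (a z) = S.proj (b z)) (h' : ∀ z, S.proj (b z) = S.proj (c z)) :
    ContMDiffOn 𝓘(ℝ, E') 𝓘(ℝ, S.cube.E) ∞ (fun z => triple (a z) (b z) (c z) (h z) (h' z)) W :=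
  contMDiffOn_of_comp hW ha (contMDiffOn_pair hW hb hc h')

end SurjSubmersion

namespace U1Bundle

variable {E : Type} [NormedAddCommGroup E] [NormedSpace ℝ E]
  {B : Type u} [TopologicalSpace B] [ChartedSpace E B]
  {E' : Type*} [NormedAddCommGroup E'] [NormedSpace ℝ E'] {N : Type*}
  [TopologicalSpace N] [ChartedSpace E' N]
  {E'' : Type*} [NormedAddCommGroup E''] [NormedSpace ℝ E''] {N' : Type*}
  [TopologicalSpace N'] [ChartedSpace E'' N']

/-- A section of `P` along a map `f` is smooth on `W` if its ratios to the sections of the atlas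
are smooth. -/
def SmoothAlong (P : U1Bundle E B) (E' : Type*) [NormedAddCommGroup E'] [NormedSpace ℝ E']
    {N : Type*} [TopologicalSpace N] [ChartedSpace E' N] (f : N → B) (σ : ∀ m, P.Fib (f m)) (W : Set N) : Prop :=
  ∀ t ∈ P.atlas, ContMDiffOn 𝓘(ℝ, E') (𝓡 1) ∞ (fun m => σ m /ₛ t.2 (f m)) (W ∩ f ⁻¹' t.1)

theorem smoothOn_iff_smoothAlong {P : U1Bundle E B} {s : ∀ b, P.Fib b} {U : Set B} :
    P.SmoothOn s U ↔ P.SmoothAlong E (fun b => b) s U := Iff.rfl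

theorem smoothOn_pullback_iff {E' : Type} [NormedAddCommGroup E'] [NormedSpace ℝ E'] {B' : Type u}
    [TopologicalSpace B'] [ChartedSpace E' B'] {P : U1Bundle E B} {f : B' → B}
    {hf : ContMDiff 𝓘(ℝ, E') 𝓘(ℝ, E) ∞ f} {σ : ∀ b, P.Fib (f b)} {W : Set B'} :
    (P.pullback f hf).SmoothOn σ W ↔ P.SmoothAlong E' f σ W := by
  constructor
  · exact fun h t ht => h _ (mem_image_of_mem _ ht)
  · rintro h _ ⟨t, ht, rfl⟩
    exact h t ht

namespace SmoothAlong

variable {P Q : U1Bundle E B} {f : N → B} {σ τ : ∀ m, P.Fib (f m)} {V W : Set N}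

theorem mono (h : P.SmoothAlong E' f σ W) (hV : V ⊆ W) : P.SmoothAlong E' f σ V :=
  fun t ht => (h t ht).mono (inter_subset_inter_left _ hV)

theorem congr (h : P.SmoothAlong E' f σ W) (e : ∀ m ∈ W, τ m = σ m) : P.SmoothAlong E' f τ W :=
  fun t ht => (h t ht).congr fun m hm => by rw [e m hm.1]

theorem comp (h : P.SmoothAlong E' f σ W) {g : N' → N} {V : Set N'}
    (hg : ContMDiffOn 𝓘(ℝ, E'') 𝓘(ℝ, E') ∞ g V) (hVW : ∀ m ∈ V, g m ∈ W) :
    P.SmoothAlong E'' (fun m => f (g m)) (fun m => σ (g m)) V :=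
  fun t ht => (h t ht).comp (hg.mono inter_subset_left) fun m hm => ⟨hVW m hm.1, hm.2⟩

theorem of_sdiv (hτ : P.SmoothAlong E' f τ W)
    (h : ContMDiffOn 𝓘(ℝ, E') (𝓡 1) ∞ (fun m => σ m /ₛ τ m) W) : P.SmoothAlong E' f σ W :=
  fun a ha => ((h.mono inter_subset_left).mul (hτ a ha)).congr fun m _ => by simp

theorem smul (hσ : P.SmoothAlong E' f σ W) {z : N → Circle}
    (hz : ContMDiffOn 𝓘(ℝ, E') (𝓡 1) ∞ z W) : P.SmoothAlong E' f (fun m => z m • σ m) W :=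
  hσ.of_sdiv (hz.congr fun m _ => by simp)

/-- Both sections are compared with one atlas section, which cancels in the ratio. Continuity of `f`
makes the preimage of its domain a neighbourhood within `W`. -/
theorem sdiv (hσ : P.SmoothAlong E' f σ W) (hτ : P.SmoothAlong E' f τ W) (hf : ContinuousOn f W) :
    ContMDiffOn 𝓘(ℝ, E') (𝓡 1) ∞ (fun m => σ m /ₛ τ m) W := by
  intro m hm
  obtain ⟨a, ha, hma⟩ := P.cover (f m)
  have h := ((hσ a ha).mul (hτ a ha).inv).congr (f₁ := fun m => σ m /ₛ τ m) fun m _ => by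
    change _ = (σ m /ₛ a.2 (f m)) * (τ m /ₛ a.2 (f m))⁻¹
    rw [inv_sdiv_eq_sdiv_rev, sdiv_mul_sdiv_cancel]
  exact (h m ⟨hm, hma⟩).mono_of_mem_nhdsWithin
    (Filter.inter_mem self_mem_nhdsWithin (hf m hm (a.1.isOpen.mem_nhds hma)))

theorem of_locally (h : ∀ m ∈ W, ∃ V : Set N, IsOpen V ∧ m ∈ V ∧ P.SmoothAlong E' f σ (W ∩ V)) :
    P.SmoothAlong E' f σ W := by
  intro a ha m hm
  obtain ⟨V, hV, hmV, hs⟩ := h m hm.1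
  refine (hs a ha m ⟨⟨hm.1, hmV⟩, hm.2⟩).mono_of_mem_nhdsWithin ?_
  filter_upwards [inter_mem_nhdsWithin _ (hV.mem_nhds hmV)] with c hc
  exact ⟨⟨hc.1.1, hc.2⟩, hc.1.2⟩

theorem dual (hσ : P.SmoothAlong E' f σ W) : P.dual.SmoothAlong E' f (fun m => DualFib.of (σ m)) W := by
  rintro _ ⟨t, ht, rfl⟩
  refine (hσ t ht).inv.congr fun m _ => ?_
  exact (inv_sdiv_eq_sdiv_rev _ _).symm

theorem tensor (hσ : P.SmoothAlong E' f σ W) {τ : ∀ m, Q.Fib (f m)} (hτ : Q.SmoothAlong E' f τ W) :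
    (P.tensor Q).SmoothAlong E' f (fun m => TensorFib.mk (σ m) (τ m)) W := by
  rintro _ ⟨s, hs, t, ht, rfl⟩
  exact ((hσ s hs).mono fun b hb => ⟨hb.1, hb.2.1⟩).mul
    ((hτ t ht).mono fun b hb => ⟨hb.1, hb.2.2⟩)

theorem of_atlas {t} (ht : t ∈ P.atlas) (hf : ContMDiffOn 𝓘(ℝ, E') 𝓘(ℝ, E) ∞ f W)
    (hW : ∀ m ∈ W, f m ∈ t.1) : P.SmoothAlong E' f (fun m => t.2 (f m)) W :=
  (smoothOn_iff_smoothAlong.1 (P.smoothOn_of_mem ht)).comp hf hW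

theorem pullback {E₁ : Type} [NormedAddCommGroup E₁] [NormedSpace ℝ E₁] {B' : Type u}
    [TopologicalSpace B'] [ChartedSpace E₁ B'] {g : B → B'} {P : U1Bundle E₁ B'}
    {hg : ContMDiff 𝓘(ℝ, E) 𝓘(ℝ, E₁) ∞ g} {σ : ∀ m, P.Fib (g (f m))}
    (h : P.SmoothAlong E' (fun m => g (f m)) σ W) : (P.pullback g hg).SmoothAlong E' f σ W := by
  rintro _ ⟨t, ht, rfl⟩
  exact h t ht

/-- An isomorphism is only assumed smooth on sections over open subsets of `B`. Locally `σ` is a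
smooth multiple of a pulled back atlas section, and by equivariance the image is the same multiple
of the image of that section. -/
theorem map (hσ : P.SmoothAlong E' f σ W) (hW : IsOpen W)
    (hf : ContMDiffOn 𝓘(ℝ, E') 𝓘(ℝ, E) ∞ f W) (φ : Iso P Q) :
    Q.SmoothAlong E' f (fun m => φ.toFun (f m) (σ m)) W := by
  refine of_locally fun m hm => ?_
  obtain ⟨t, ht, hmt⟩ := P.cover (f m)
  have ho := hf.continuousOn.isOpen_inter_preimage hW t.1.isOpen
  refine ⟨_, ho, ⟨hm, hmt⟩, ?_⟩
  rw [inter_eq_right.2 inter_subset_left]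
  have hf' := hf.mono (inter_subset_left (t := f ⁻¹' t.1))
  have h1 : Q.SmoothAlong E' f (fun m => φ.toFun (f m) (t.2 (f m))) (W ∩ f ⁻¹' t.1) :=
    (smoothOn_iff_smoothAlong.1 (φ.smooth t.1 t.2 (P.smoothOn_of_mem ht))).comp hf' fun m hm => hm.2
  refine h1.of_sdiv (((hσ.mono inter_subset_left).sdiv (of_atlas ht hf' fun m hm => hm.2)
    hf'.continuousOn).congr fun m _ => ?_)
  exact map_sdiv (φ.toFun (f m)) (φ.map_smul (f m)) _ _

end SmoothAlong

/-- Smooth sections along a smooth map exist locally. -/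
theorem exists_smoothAlong (P : U1Bundle E B) {f : N → B} {W : Set N} (hW : IsOpen W)
    (hf : ContMDiffOn 𝓘(ℝ, E') 𝓘(ℝ, E) ∞ f W) {m : N} (hm : m ∈ W) :
    ∃ V : Opens N, m ∈ V ∧ ∃ σ : ∀ m, P.Fib (f m), P.SmoothAlong E' f σ V := by
  obtain ⟨t, ht, hmt⟩ := P.cover (f m)
  exact ⟨⟨_, hf.continuousOn.isOpen_inter_preimage hW t.1.isOpen⟩, ⟨hm, hmt⟩, _,
    SmoothAlong.of_atlas ht (hf.mono inter_subset_left) fun m hm => hm.2⟩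

end U1Bundle

namespace GerbeOver

variable {n : ℕ} {M : Type u} [TopologicalSpace M]
  [ChartedSpace (EuclideanSpace ℝ (Fin n)) M] [IsManifold (𝓡 n) ∞ M] {S : SurjSubmersion n M}
  (G : GerbeOver S) {y₁ y₂ y₃ y₄ : S.Y} {h₁ : S.proj y₁ = S.proj y₂} {h₂ : S.proj y₂ = S.proj y₃}
  {h₃ : S.proj y₃ = S.proj y₄}

theorem map_smul_left (z : Circle) (p : G.P.Fib (pair y₁ y₂ h₁)) (q : G.P.Fib (pair y₂ y₃ h₂)) :
    G.mul (z • p) q = z • G.mul p q :=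
  G.m_smul_left (triple y₁ y₂ y₃ h₁ h₂) z p q

theorem map_smul_right (z : Circle) (p : G.P.Fib (pair y₁ y₂ h₁)) (q : G.P.Fib (pair y₂ y₃ h₂)) :
    G.mul p (z • q) = z • G.mul p q :=
  G.m_smul_right (triple y₁ y₂ y₃ h₁ h₂) z p q

theorem mul_assoc (p : G.P.Fib (pair y₁ y₂ h₁)) (q : G.P.Fib (pair y₂ y₃ h₂))
    (r : G.P.Fib (pair y₃ y₄ h₃)) : G.mul (G.mul p q) r = G.mul p (G.mul q r) :=
  G.assoc _ _ _ _ _ _ _ p q r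

theorem mul_sdiv_mul (p p' : G.P.Fib (pair y₁ y₂ h₁)) (q q' : G.P.Fib (pair y₂ y₃ h₂)) :
    G.mul p q /ₛ G.mul p' q' = (p /ₛ p') * (q /ₛ q') := by
  apply smul_right_cancel (G.mul p' q')
  rw [sdiv_smul, mul_smul, ← G.map_smul_right, sdiv_smul, ← G.map_smul_left, sdiv_smul]

theorem mul_right_cancel {p p' : G.P.Fib (pair y₁ y₂ h₁)} (q : G.P.Fib (pair y₂ y₃ h₂))
    (h : G.mul p q = G.mul p' q) : p = p' := by
  have := G.mul_sdiv_mul p p' q q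
  rw [h, sdiv_self, sdiv_self, mul_one] at this
  rw [← sdiv_smul p p', ← this, one_smul]

/-- Multiplication by `q` is an equivariant map of torsors, hence onto: any `p` can be corrected by
a phase. This is the source of division in a gerbe. -/
theorem exists_mul_eq (q : G.P.Fib (pair y₂ y₃ h₂)) (r : G.P.Fib (pair y₁ y₃ (h₁.trans h₂))) :
    ∃ p : G.P.Fib (pair y₁ y₂ h₁), G.mul p q = r := by
  let p : G.P.Fib (pair y₁ y₂ h₁) := Classical.arbitrary _
  exact ⟨(r /ₛ G.mul p q) • p, by rw [map_smul_left, sdiv_smul]⟩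

variable {E' : Type*} [NormedAddCommGroup E'] [NormedSpace ℝ E'] {N : Type*}
  [TopologicalSpace N] [ChartedSpace E' N]

/-- The product of two atlas sections is smooth over an open set of `Y^[3]` and is pulled back along
`(a, b, c)`. Passing to `p` and `q` costs only the product of their two smooth ratios, since ratios
are multiplicative. -/
theorem smoothAlong_mul {a b c : N → S.Y} {W : Set N} (hW : IsOpen W)
    (ha : ContMDiffOn 𝓘(ℝ, E') 𝓘(ℝ, S.E) ∞ a W) (hb : ContMDiffOn 𝓘(ℝ, E') 𝓘(ℝ, S.E) ∞ b W)
    (hc : ContMDiffOn 𝓘(ℝ, E') 𝓘(ℝ, S.E) ∞ c W) {h : ∀ m, S.proj (a m) = S.proj (b m)}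
    {h' : ∀ m, S.proj (b m) = S.proj (c m)} {p : ∀ m, G.P.Fib (pair (a m) (b m) (h m))}
    {q : ∀ m, G.P.Fib (pair (b m) (c m) (h' m))}
    (hp : G.P.SmoothAlong E' (fun m => pair (a m) (b m) (h m)) p W)
    (hq : G.P.SmoothAlong E' (fun m => pair (b m) (c m) (h' m)) q W) :
    G.P.SmoothAlong E' (fun m => pair (a m) (c m) ((h m).trans (h' m)))
      (fun m => G.mul (p m) (q m)) W := by
  refine U1Bundle.SmoothAlong.of_locally fun m hm => ?_
  have hab := contMDiffOn_pair hW ha hb h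
  have hbc := contMDiffOn_pair hW hb hc h'
  obtain ⟨s, hs, hms⟩ := G.P.cover (pair (a m) (b m) (h m))
  obtain ⟨t, ht, hmt⟩ := G.P.cover (pair (b m) (c m) (h' m))
  have o1 := hab.continuousOn.isOpen_inter_preimage hW s.1.isOpen
  have o2 := hbc.continuousOn.isOpen_inter_preimage hW t.1.isOpen
  refine ⟨_, o1.inter o2, ⟨⟨hm, hms⟩, hm, hmt⟩, ?_⟩
  rw [inter_eq_right.2 fun m hm => hm.1.1]
  have k := (U1Bundle.smoothOn_pullback_iff.1
    (G.smooth_m (G.P.smoothOn_of_mem hs) (G.P.smoothOn_of_mem ht))).comp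
    ((contMDiffOn_triple hW ha hb hc h h').mono (fun m hm => hm.1.1)) (V := (W ∩ _) ∩ (W ∩ _))
    fun m hm => ⟨hm.1.2, hm.2.2⟩
  have k' : G.P.SmoothAlong E' (fun m => pair (a m) (c m) ((h m).trans (h' m)))
      (fun m => G.mul (s.2 (pair (a m) (b m) (h m))) (t.2 (pair (b m) (c m) (h' m))))
      ((W ∩ (fun m => pair (a m) (b m) (h m)) ⁻¹' s.1) ∩
        (W ∩ (fun m => pair (b m) (c m) (h' m)) ⁻¹' t.1)) := k
  refine k'.of_sdiv ((((hp s hs).mono inter_subset_left).mul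
    ((hq t ht).mono inter_subset_right)).congr fun m _ => ?_)
  exact G.mul_sdiv_mul _ _ _ _

end GerbeOver

end

/-! ### Local data over pointed covers -/

section

open TopologicalSpace SurjSubmersion

theorem contMDiffOn_of_opens {E : Type*} [NormedAddCommGroup E] [NormedSpace ℝ E] {N : Type*}
    [TopologicalSpace N] [ChartedSpace E N] {E' H' : Type*} [NormedAddCommGroup E']
    [NormedSpace ℝ E'] [TopologicalSpace H'] {J : ModelWithCorners ℝ E' H'} {N' : Type*}
    [TopologicalSpace N'] [ChartedSpace H' N'] {W : Opens N} {f : N → N'} {f₀ : W → N'}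
    (h : ∀ x : W, f x = f₀ x) {A : Set W} (hA : IsOpen A) (hf : ContMDiffOn 𝓘(ℝ, E) J ∞ f₀ A)
    {A' : Set N} (hA' : ∀ m ∈ A', ∃ hm : m ∈ W, (⟨m, hm⟩ : W) ∈ A) :
    ContMDiffOn 𝓘(ℝ, E) J ∞ f A' := by
  intro m hm
  obtain ⟨hm, hmA⟩ := hA' m hm
  have h1 := hf.contMDiffAt (hA.mem_nhds hmA)
  rw [← funext h] at h1
  exact (contMDiffAt_subtype_iff.1 h1).contMDiffWithinAt

section Data

variable {n : ℕ} {M : Type u} [TopologicalSpace M]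
  [ChartedSpace (EuclideanSpace ℝ (Fin n)) M] [IsManifold (𝓡 n) ∞ M]

namespace SurjSubmersion

/-- Submersions have smooth local sections. -/
theorem exists_local_section (S : SurjSubmersion n M) (x : M) :
    ∃ W : Opens M, x ∈ W ∧ ∃ s : M → S.Y, (∀ m, S.proj (s m) = m) ∧
      ContMDiffOn (𝓡 n) 𝓘(ℝ, S.E) ∞ s W := by
  classical
  obtain ⟨y, rfl⟩ := S.surjective x
  choose r hr using S.surjective
  have hy : y ∈ (S.upChart y).source := (S.submersion y).mem_domChart_source
  -- In submersion charts the section keeps the fibre coordinate of `y` and moves the base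
  -- coordinate. Off `W` an arbitrary set-theoretic section `r` is used, so that the equation `proj
  -- (s m) = m` holds on all of `M`.
  let f : M → S.E := fun m => (S.split y).symm (S.downChart y m, (S.split y (S.upChart y y)).2)
  have hl : ContMDiff 𝓘(ℝ, EuclideanSpace ℝ (Fin n) × S.Compl) 𝓘(ℝ, S.E) ∞
      (S.split y).symm := (S.split y).symm.contDiff.contMDiff
  have hf : ContMDiffOn (𝓡 n) 𝓘(ℝ, S.E) ∞ f (S.downChart y).source :=
    hl.comp_contMDiffOn ((S.contMDiffOn_downChart y).prodMk_space contMDiffOn_const)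
  let W : Opens M := ⟨_, hf.continuousOn.isOpen_inter_preimage (S.downChart y).open_source
    (S.upChart y).open_target⟩
  have hfy : f (S.proj y) = S.upChart y y := by
    simp only [f]
    rw [S.chart_proj y hy]
    simp
  have hW : ∀ m ∈ W, S.proj ((S.upChart y).symm (f m)) = m := by
    intro m hm
    have h1 := (S.upChart y).map_target hm.2
    apply (S.downChart y).injOn (S.mapsTo y h1) hm.1
    rw [S.chart_proj y h1, (S.upChart y).right_inv hm.2]
    simp [f]
  refine ⟨W, ⟨S.mapsTo y hy, ?_⟩, fun m => if m ∈ W then (S.upChart y).symm (f m) else r m,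
    fun m => ?_, ?_⟩
  · change f (S.proj y) ∈ (S.upChart y).target
    rw [hfy]
    exact (S.upChart y).map_source hy
  · beta_reduce
    split_ifs with h
    exacts [hW m h, hr m]
  · refine ((S.contMDiffOn_upChart_symm y).comp (hf.mono inter_subset_left)
      fun m (hm : m ∈ W) => hm.2).congr fun m hm => if_pos hm

end SurjSubmersion

namespace GerbeOver

variable {S : SurjSubmersion n M} (G : GerbeOver S)

/-- Transport of elements of the fibres along equalities of the end points. -/
def castFib {y₁ y₁' y₂ y₂' : S.Y} (e₁ : y₁ = y₁') (e₂ : y₂ = y₂') (h : S.proj y₁ = S.proj y₂)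
    (h' : S.proj y₁' = S.proj y₂') (p : G.P.Fib (pair y₁ y₂ h)) : G.P.Fib (pair y₁' y₂' h') :=
  cast (by subst e₁ e₂; rfl) p

theorem castFib_sdiv {y₁ y₁' y₂ y₂' : S.Y} (e₁ : y₁ = y₁') (e₂ : y₂ = y₂')
    (h : S.proj y₁ = S.proj y₂) (h' : S.proj y₁' = S.proj y₂') (p : G.P.Fib (pair y₁ y₂ h))
    (t : ∀ b, G.P.Fib b) :
    G.castFib e₁ e₂ h h' p /ₛ t (pair y₁' y₂' h') = p /ₛ t (pair y₁ y₂ h) := by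
  subst e₁ e₂
  rfl

theorem castFib_smul {y₁ y₁' y₂ y₂' : S.Y} (e₁ : y₁ = y₁') (e₂ : y₂ = y₂')
    (h : S.proj y₁ = S.proj y₂) (h' : S.proj y₁' = S.proj y₂') (p : G.P.Fib (pair y₁ y₂ h))
    (z : Circle) : G.castFib e₁ e₂ h h' (z • p) = z • G.castFib e₁ e₂ h h' p := by
  subst e₁ e₂
  rfl

theorem castFib_mul {y₁ y₁' y₂ y₂' y₃ y₃' : S.Y} (e₁ : y₁ = y₁') (e₂ : y₂ = y₂') (e₃ : y₃ = y₃')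
    (h₁₂ : S.proj y₁ = S.proj y₂) (h₁₂' : S.proj y₁' = S.proj y₂') (h₂₃ : S.proj y₂ = S.proj y₃)
    (h₂₃' : S.proj y₂' = S.proj y₃') (p : G.P.Fib (pair y₁ y₂ h₁₂)) (q : G.P.Fib (pair y₂ y₃ h₂₃)) :
    G.mul (G.castFib e₁ e₂ h₁₂ h₁₂' p) (G.castFib e₂ e₃ h₂₃ h₂₃' q) =
      G.castFib e₁ e₃ (h₁₂.trans h₂₃) (h₁₂'.trans h₂₃') (G.mul p q) := by
  subst e₁ e₂ e₃
  rfl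

/-- Local data for the Dixmier-Douady class over a cover indexed by the points of `M`, with all
functions and sections extended arbitrarily to `M`. -/
structure PointedData where
  U : Cech.PointedCover M
  s : M → M → S.Y
  proj_s : ∀ x m, S.proj (s x m) = m
  smooth_s : ∀ x, ContMDiffOn (𝓡 n) 𝓘(ℝ, S.E) ∞ (s x) (U.1 x)
  σ : ∀ x y m, G.P.Fib (pair (s x m) (s y m) ((proj_s x m).trans (proj_s y m).symm))
  smooth_σ : ∀ x y, G.P.SmoothAlong (EuclideanSpace ℝ (Fin n))
    (fun m => pair (s x m) (s y m) ((proj_s x m).trans (proj_s y m).symm)) (σ x y)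
    (U.1 x ∩ U.1 y)
  θ : M → M → M → M → ℝ
  smooth_θ : ∀ x y z, ContMDiffOn (𝓡 n) 𝓘(ℝ) ∞ (θ x y z) (U.1 x ∩ U.1 y ∩ U.1 z)
  mul_σ : ∀ x y z m, m ∈ U.1 x → m ∈ U.1 y → m ∈ U.1 z →
    G.mul (σ x y m) (σ y z m) = Circle.exp (2 * Real.pi * θ x y z m) • σ x z m

theorem exists_int_of_circleExp {t : ℝ} (h : Circle.exp (2 * Real.pi * t) = 1) :
    ∃ N : ℤ, (N : ℝ) = t := by
  obtain ⟨N, hN⟩ := Circle.exp_eq_one.1 h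
  refine ⟨N, ?_⟩
  have := Real.pi_pos
  apply mul_left_cancel₀ (Real.two_pi_pos.ne')
  linarith

theorem circleExp_int (N : ℤ) : Circle.exp (2 * Real.pi * N) = 1 :=
  Circle.exp_eq_one.2 ⟨N, by ring⟩

namespace PointedData

variable {G} (D : PointedData G)

/-- The two bracketings of `σ₀₁ σ₁₂ σ₂₃` agree by associativity, which is the cocycle identity for
`exp(2πiθ)`. -/
theorem exists_int {x₀ x₁ x₂ x₃ m : M} (h0 : m ∈ D.U.1 x₀) (h1 : m ∈ D.U.1 x₁)
    (h2 : m ∈ D.U.1 x₂) (h3 : m ∈ D.U.1 x₃) :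
    ∃ N : ℤ, (N : ℝ) = Cech.delta₂ D.θ x₀ x₁ x₂ x₃ m := by
  apply exists_int_of_circleExp
  have h := G.mul_assoc (D.σ x₀ x₁ m) (D.σ x₁ x₂ m) (D.σ x₂ x₃ m)
  rw [D.mul_σ _ _ _ _ h0 h1 h2, D.mul_σ _ _ _ _ h1 h2 h3, map_smul_left, map_smul_right,
    D.mul_σ _ _ _ _ h0 h2 h3, D.mul_σ _ _ _ _ h0 h1 h3, ← mul_smul, ← mul_smul] at h
  have h' := smul_right_cancel _ h
  simp only [Cech.delta₂]
  have e : 2 * Real.pi * (D.θ x₁ x₂ x₃ m - D.θ x₀ x₂ x₃ m + D.θ x₀ x₁ x₃ m - D.θ x₀ x₁ x₂ m) =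
    (2 * Real.pi * D.θ x₁ x₂ x₃ m + 2 * Real.pi * D.θ x₀ x₁ x₃ m) -
      (2 * Real.pi * D.θ x₀ x₁ x₂ m + 2 * Real.pi * D.θ x₀ x₂ x₃ m) := by ring
  rw [e, Circle.exp_sub, Circle.exp_add, Circle.exp_add, h', div_self']

theorem exists_represents : ∃ c, Cech.Represents D.U (Cech.delta₂ D.θ) c :=
  Cech.exists_represents (fun x y z => (D.smooth_θ x y z).continuousOn.mono
    fun _ hm => ⟨⟨hm.1, hm.2.1⟩, hm.2.2⟩) fun _ _ _ _ _ h0 h1 h2 h3 => D.exists_int h0 h1 h2 h3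

/-- The local data, with functions and sections defined on the overlaps only, given by pointed data. -/
def toLocalData {G : BundleGerbe n M} (D : PointedData G.gerbe) : BundleGerbe.LocalData G where
  ι := M
  U := D.U.1
  cover x := ⟨x, D.U.2 x⟩
  s a x := D.s a x
  contMDiff_s a := contMDiffOn_iff_opens.1 (D.smooth_s a)
  proj_s a x := D.proj_s a x
  σ a b x := D.σ a b x
  smooth_σ a b := U1Bundle.smoothOn_pullback_iff.2
    ((D.smooth_σ a b).comp contMDiff_subtype_val.contMDiffOn fun m _ => m.2)
  θ a b c x := D.θ a b c x
  smooth_θ a b c := (contMDiffOn_iff_opens (W := D.U.1 a ⊓ D.U.1 b ⊓ D.U.1 c)).1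
    (D.smooth_θ a b c)
  exp_θ a b c x := by
    change _ = G.gerbe.mul (D.σ a b x) (D.σ b c x) /ₛ D.σ a c x
    rw [D.mul_σ _ _ _ _ x.2.1.1 x.2.1.2 x.2.2, smul_sdiv]

theorem isDDClass {G : BundleGerbe n M} (D : PointedData G.gerbe) {c : Cech.H M 3}
    (h : Cech.Represents D.U (Cech.delta₂ D.θ) c) : G.IsDDClass c := by
  obtain ⟨k, hk, hc⟩ := h
  refine ⟨D.toLocalData, (fun x : M => x), fun x => D.U.2 x, k, ?_, hc⟩
  intro x₀ x₁ x₂ x₃ x h0 h1 h2 h3 h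
  refine Eq.trans ?_ (hk x₀ x₁ x₂ x₃ x h0 h1 h2 h3)
  exact congrArg _ (Cech.total_eq k.1 h).symm

end PointedData

/-- Sections and functions on the overlaps are extended arbitrarily to `M`, so that later arguments
avoid subtypes. The extended `s` agrees with the old one only up to a proved equality, hence the
transport of `σ` by `castFib`. -/
theorem exists_pointedData_of_isDDClass {G : BundleGerbe n M} {c : Cech.H M 3}
    (h : G.IsDDClass c) :
    ∃ D : PointedData G.gerbe, Cech.Represents D.U (Cech.delta₂ D.θ) c := by
  classical
  obtain ⟨D, α, hα, k, hk, hc⟩ := h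
  choose r hr using G.sub.surjective
  let s : M → M → G.sub.Y := fun x m => if hm : m ∈ D.U (α x) then D.s (α x) ⟨m, hm⟩ else r m
  have hs : ∀ x m (hm : m ∈ D.U (α x)), D.s (α x) ⟨m, hm⟩ = s x m := fun x m hm => by
    simp only [s, dif_pos hm]
  have hproj : ∀ x m, G.sub.proj (s x m) = m := by
    intro x m
    simp only [s]
    split_ifs with hm
    exacts [D.proj_s _ _, hr m]
  let σ : ∀ x y m, G.gerbe.P.Fib (pair (s x m) (s y m) ((hproj x m).trans (hproj y m).symm)) :=
    fun x y m => if hm : m ∈ D.U (α x) ∧ m ∈ D.U (α y) then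
      G.gerbe.castFib (hs x m hm.1) (hs y m hm.2) _ _ (D.σ (α x) (α y) ⟨m, hm⟩)
      else Classical.arbitrary _
  have hσ : ∀ x y m (hx : m ∈ D.U (α x)) (hy : m ∈ D.U (α y)),
      σ x y m = G.gerbe.castFib (hs x m hx) (hs y m hy) (D.proj_eq hx hy)
        ((hproj x m).trans (hproj y m).symm) (D.σ (α x) (α y) ⟨m, hx, hy⟩) :=
    fun x y m hx hy => by
      have hm : m ∈ D.U (α x) ∧ m ∈ D.U (α y) := ⟨hx, hy⟩
      simp only [σ, dif_pos hm]
  let θ : M → M → M → M → ℝ := fun x y z m =>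
    if hm : (m ∈ D.U (α x) ∧ m ∈ D.U (α y)) ∧ m ∈ D.U (α z) then
      D.θ (α x) (α y) (α z) ⟨m, hm⟩ else 0
  have hθ : ∀ x y z m (hx : m ∈ D.U (α x)) (hy : m ∈ D.U (α y)) (hz : m ∈ D.U (α z)),
      θ x y z m = D.θ (α x) (α y) (α z) ⟨m, ⟨hx, hy⟩, hz⟩ := fun x y z m hx hy hz => by
    have hm : (m ∈ D.U (α x) ∧ m ∈ D.U (α y)) ∧ m ∈ D.U (α z) := ⟨⟨hx, hy⟩, hz⟩
    simp only [θ, dif_pos hm]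
  refine ⟨⟨⟨fun x => D.U (α x), hα⟩, s, hproj, fun x => ?_, σ, fun x y t ht => ?_, θ,
    fun x y z => ?_, fun x y z m hx hy hz => ?_⟩, k, fun x₀ x₁ x₂ x₃ m h0 h1 h2 h3 => ?_, hc⟩
  · exact contMDiffOn_of_opens (W := D.U (α x)) (fun m => (hs x m m.2).symm) isOpen_univ
      (D.contMDiff_s (α x)).contMDiffOn fun m hm => ⟨hm, trivial⟩
  · have h1 := U1Bundle.smoothOn_pullback_iff.1 (D.smooth_σ (α x) (α y)) t ht
    refine contMDiffOn_of_opens (W := D.U (α x) ⊓ D.U (α y)) (fun m => ?_)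
      (isOpen_univ.inter (t.1.isOpen.preimage (D.contMDiff_overlap (α x) (α y)).continuous))
      h1 fun m hm => ⟨hm.1, trivial, ?_⟩
    · rw [hσ x y m m.2.1 m.2.2]
      exact G.gerbe.castFib_sdiv (hs x m m.2.1) (hs y m m.2.2) _ _ _ t.2
    · have h2 := hm.2
      simp only [mem_preimage] at h2 ⊢
      convert h2 using 1
      simp only [BundleGerbe.LocalSections.overlap, hs]
  · exact contMDiffOn_of_opens (W := D.U (α x) ⊓ D.U (α y) ⊓ D.U (α z))
      (fun m => hθ x y z m m.2.1.1 m.2.1.2 m.2.2) isOpen_univ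
      (D.smooth_θ (α x) (α y) (α z)).contMDiffOn fun m hm => ⟨hm, trivial⟩
  · rw [hσ x y m hx hy, hσ y z m hy hz, hσ x z m hx hz, hθ x y z m hx hy hz, D.exp_θ]
    refine (G.gerbe.castFib_mul _ _ _ _ _ _ _ _ _).trans ?_
    refine Eq.trans (congrArg _ (sdiv_smul _ _).symm) (G.gerbe.castFib_smul _ _ _ _ _ _)
  · have h := Cech.mem_inter₄.2 ⟨h0, h1, h2, h3⟩
    simp only [Cech.delta₂]
    rw [Cech.total_eq k.1 h, hk _ _ _ _ _ h0 h1 h2 h3 h, hθ _ _ _ _ h1 h2 h3,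
      hθ _ _ _ _ h0 h2 h3, hθ _ _ _ _ h0 h1 h3, hθ _ _ _ _ h0 h1 h2]

/-- Two successive refinements are made: the first gives sections `σ` on double overlaps, the second
logarithms of the resulting cocycle on triple overlaps. -/
theorem exists_pointedData [T2Space M] [SecondCountableTopology M] {S : SurjSubmersion n M}
    (G : GerbeOver S) : Nonempty (PointedData G) := by
  have := sigmaCompactSpace_of_manifold n M
  have : LocallyCompactSpace M := ChartedSpace.locallyCompactSpace (EuclideanSpace ℝ (Fin n)) M
  choose U₀ hU₀ s hproj hs using S.exists_local_section
  obtain ⟨V, τ, hV, hQ⟩ := Cech.exists_refinement ⟨U₀, hU₀⟩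
    (fun i j _ W => ∃ σ : ∀ m, G.P.Fib (pair (s i m) (s j m) ((hproj i m).trans (hproj j m).symm)),
      G.P.SmoothAlong (EuclideanSpace ℝ (Fin n)) _ σ W)
    (fun i j k W W' h ⟨σ, hσ⟩ => ⟨σ, hσ.mono h⟩)
    (fun i j k => ⟨fun _ => Classical.arbitrary _, fun t _ m hm => hm.1.elim⟩)
    (fun i j k x hi hj _ => G.P.exists_smoothAlong ((U₀ i).isOpen.inter (U₀ j).isOpen)
      (contMDiffOn_pair ((U₀ i).isOpen.inter (U₀ j).isOpen) ((hs i).mono inter_subset_left)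
        ((hs j).mono inter_subset_right) _) ⟨hi, hj⟩)
  -- The property does not involve the third index, so repeating `y` turns the triple overlap into
  -- the double one.
  choose σ hσ using fun x y => hQ x y y
  have hs' : ∀ x, ContMDiffOn (𝓡 n) 𝓘(ℝ, S.E) ∞ (s (τ x)) (V.1 x) := fun x => (hs _).mono (hV x)
  have hσ' : ∀ x y, G.P.SmoothAlong (EuclideanSpace ℝ (Fin n))
      (fun m => pair (s (τ x) m) (s (τ y) m) ((hproj _ m).trans (hproj _ m).symm)) (σ x y)
      (V.1 x ∩ V.1 y) := fun x y => (hσ x y).mono fun m hm => ⟨hm, hm.2⟩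
  have hg : ∀ x y z, ContMDiffOn (𝓡 n) (𝓡 1) ∞
      (fun m => G.mul (σ x y m) (σ y z m) /ₛ σ x z m) (V.1 x ∩ V.1 y ∩ V.1 z) := by
    intro x y z
    have ho := ((V.1 x).isOpen.inter (V.1 y).isOpen).inter (V.1 z).isOpen
    have hx := (hs' x).mono (t := V.1 x ∩ V.1 y ∩ V.1 z) fun m hm => hm.1.1
    have hy := (hs' y).mono (t := V.1 x ∩ V.1 y ∩ V.1 z) fun m hm => hm.1.2
    have hz := (hs' z).mono (t := V.1 x ∩ V.1 y ∩ V.1 z) fun m hm => hm.2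
    exact (G.smoothAlong_mul ho hx hy hz ((hσ' x y).mono fun m hm => hm.1)
      ((hσ' y z).mono fun m hm => ⟨hm.1.2, hm.2⟩)).sdiv
      ((hσ' x z).mono fun m hm => ⟨hm.1.1, hm.2⟩) (contMDiffOn_pair ho hx hz _).continuousOn
  obtain ⟨V', τ', hV', hQ'⟩ := Cech.exists_refinement V
    (fun i j k W => ∃ θ : M → ℝ, ContMDiffOn (𝓡 n) 𝓘(ℝ) ∞ θ W ∧
      ∀ m ∈ W, Circle.exp (2 * Real.pi * θ m) = G.mul (σ i j m) (σ j k m) /ₛ σ i k m)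
    (fun i j k W W' h ⟨θ, hθ, e⟩ => ⟨θ, hθ.mono h, fun m hm => e m (h hm)⟩)
    (fun i j k => ⟨0, fun m hm => hm.elim, fun m hm => hm.elim⟩)
    (fun i j k x hi hj hk => exists_local_log
      (((V.1 i).isOpen.inter (V.1 j).isOpen).inter (V.1 k).isOpen) (hg i j k) ⟨⟨hi, hj⟩, hk⟩)
  choose θ hθ hexp using hQ'
  exact ⟨⟨V', fun x => s (τ (τ' x)), fun x => hproj _, fun x => (hs' _).mono (hV' x),
    fun x y => σ (τ' x) (τ' y), fun x y => (hσ' _ _).mono fun m hm => ⟨hV' _ hm.1, hV' _ hm.2⟩,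
    θ, hθ, fun x y z m hx hy hz => by rw [hexp x y z m ⟨⟨hx, hy⟩, hz⟩, sdiv_smul]⟩⟩

end GerbeOver

end Data

end

/-! ### Trivial bundle gerbes have class zero -/

section

open TopologicalSpace SurjSubmersion

section Trivial

variable {n : ℕ} {M : Type u} [TopologicalSpace M]
  [ChartedSpace (EuclideanSpace ℝ (Fin n)) M] [IsManifold (𝓡 n) ∞ M]

namespace GerbeOver

variable {S : SurjSubmersion n M} {G : GerbeOver S}

/-- Contracting `b*` with `b` gives `1`. Thus sections of `R` along the `s_x` produce sections of
`P` whose cocycle is identically `1`. -/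
theorem Iso.mul_trivial {R : U1Bundle S.E S.Y} (φ : Iso (delta R) G) {y₁ y₂ y₃ : S.Y}
    (h : S.proj y₁ = S.proj y₂) (h' : S.proj y₂ = S.proj y₃) (a : R.Fib y₁) (b : R.Fib y₂)
    (c : R.Fib y₃) :
    G.mul (φ.toIso.toFun (pair y₁ y₂ h) (TensorFib.mk a (DualFib.of b)))
        (φ.toIso.toFun (pair y₂ y₃ h') (TensorFib.mk b (DualFib.of c))) =
      φ.toIso.toFun (pair y₁ y₃ (h.trans h')) (TensorFib.mk a (DualFib.of c)) := by
  refine (φ.map_mul y₁ y₂ y₃ h h' (TensorFib.mk a (DualFib.of b))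
    (TensorFib.mk b (DualFib.of c))).symm.trans ?_
  refine congrArg (φ.toIso.toFun (pair y₁ y₃ (h.trans h'))) ?_
  refine (TensorFib.contract_mk a b b (DualFib.of c)).trans ?_
  rw [sdiv_self, one_smul]
  rfl

theorem Iso.smoothAlong_trivial {R : U1Bundle S.E S.Y} (φ : Iso (delta R) G) {E' : Type*}
    [NormedAddCommGroup E'] [NormedSpace ℝ E'] {N : Type*} [TopologicalSpace N] [ChartedSpace E' N]
    {a b : N → S.Y} {W : Set N} (hW : IsOpen W) (ha : ContMDiffOn 𝓘(ℝ, E') 𝓘(ℝ, S.E) ∞ a W)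
    (hb : ContMDiffOn 𝓘(ℝ, E') 𝓘(ℝ, S.E) ∞ b W) (h : ∀ m, S.proj (a m) = S.proj (b m))
    {p : ∀ m, R.Fib (a m)} {q : ∀ m, R.Fib (b m)} (hp : R.SmoothAlong E' a p W)
    (hq : R.SmoothAlong E' b q W) :
    G.P.SmoothAlong E' (fun m => pair (a m) (b m) (h m)) (fun m =>
      φ.toIso.toFun (pair (a m) (b m) (h m)) (TensorFib.mk (p m) (DualFib.of (q m)))) W := by
  have hf := contMDiffOn_pair hW ha hb h
  have h1 : (R.pullback S.p₁ S.contMDiff_p₁).SmoothAlong E' (fun m => pair (a m) (b m) (h m)) p W :=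
    U1Bundle.SmoothAlong.pullback hp
  have h2 : (R.pullback S.p₂ S.contMDiff_p₂).SmoothAlong E' (fun m => pair (a m) (b m) (h m)) q W :=
    U1Bundle.SmoothAlong.pullback hq
  exact (h1.tensor h2.dual).map hW hf φ.toIso

variable [T2Space M] [SecondCountableTopology M]

/-- The given `σ` are compared with the strictly multiplicative sections `t` coming from `R`. After
refinement their ratios have smooth logarithms `ζ`, and correcting `θ` by `δζ` makes it integral
without changing its coboundary. -/
theorem IsTrivial.eq_zero (hG : G.IsTrivial) (D : PointedData G) {c : Cech.H M 3}
    (hc : Cech.Represents D.U (Cech.delta₂ D.θ) c) : c = 0 := by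
  have := sigmaCompactSpace_of_manifold n M
  have : LocallyCompactSpace M := ChartedSpace.locallyCompactSpace (EuclideanSpace ℝ (Fin n)) M
  obtain ⟨R, ⟨φ⟩⟩ := hG
  choose V₀ hxV₀ r hr using fun x =>
    R.exists_smoothAlong (D.U.1 x).isOpen (D.smooth_s x) (D.U.2 x)
  let V : Cech.PointedCover M := ⟨fun x => V₀ x ⊓ D.U.1 x, fun x => ⟨hxV₀ x, D.U.2 x⟩⟩
  let t : ∀ x y m, G.P.Fib (pair (D.s x m) (D.s y m) ((D.proj_s x m).trans (D.proj_s y m).symm)) :=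
    fun x y m => φ.toIso.toFun _ (TensorFib.mk (r x m) (DualFib.of (r y m)))
  have ht : ∀ x y z m, G.mul (t x y m) (t y z m) = t x z m := fun x y z m =>
    φ.mul_trivial _ _ (r x m) (r y m) (r z m)
  have ho : ∀ x y, IsOpen ((V.1 x : Set M) ∩ V.1 y) := fun x y => (V.1 x).isOpen.inter (V.1 y).isOpen
  have hsx : ∀ x y, ContMDiffOn (𝓡 n) 𝓘(ℝ, S.E) ∞ (D.s x) (V.1 x ∩ V.1 y) := fun x y =>
    (D.smooth_s x).mono fun m hm => hm.1.2
  have hsy : ∀ x y, ContMDiffOn (𝓡 n) 𝓘(ℝ, S.E) ∞ (D.s y) (V.1 x ∩ V.1 y) := fun x y =>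
    (D.smooth_s y).mono fun m hm => hm.2.2
  have hf : ∀ x y, ContMDiffOn (𝓡 n) (𝓡 1) ∞ (fun m => D.σ x y m /ₛ t x y m) (V.1 x ∩ V.1 y) :=
    fun x y => ((D.smooth_σ x y).mono fun m hm => ⟨hm.1.2, hm.2.2⟩).sdiv
      (φ.smoothAlong_trivial (ho x y) (hsx x y) (hsy x y) _ ((hr x).mono fun m hm => hm.1.1)
        ((hr y).mono fun m hm => hm.2.1))
      (contMDiffOn_pair (ho x y) (hsx x y) (hsy x y) _).continuousOn
  obtain ⟨W, τ, hW, hQ⟩ := Cech.exists_refinement V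
    (fun i j _ W => ∃ ζ : M → ℝ, ContMDiffOn (𝓡 n) 𝓘(ℝ) ∞ ζ W ∧
      ∀ m ∈ W, Circle.exp (2 * Real.pi * ζ m) = D.σ i j m /ₛ t i j m)
    (fun i j k W W' h ⟨ζ, hζ, e⟩ => ⟨ζ, hζ.mono h, fun m hm => e m (h hm)⟩)
    (fun i j k => ⟨0, fun m hm => hm.elim, fun m hm => hm.elim⟩)
    (fun i j k x hi hj hk => exists_local_log (ho i j) (hf i j) ⟨hi, hj⟩)
  choose ζ hζ hexp using fun x y => hQ x y y
  have hτ : ∀ x, W.1 x ≤ D.U.1 (τ x) := fun x => (hW x).trans inf_le_right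
  -- This is `θ - δζ`, whose exponential is `1`. It is the integer cochain that bounds `δθ`.
  let u : M → M → M → M → ℝ := fun x y z m =>
    D.θ (τ x) (τ y) (τ z) m - (ζ y z m - ζ x z m + ζ x y m)
  have hu : ∀ x y z m, m ∈ W.1 x → m ∈ W.1 y → m ∈ W.1 z → ∃ N : ℤ, (N : ℝ) = u x y z m := by
    intro x y z m hx hy hz
    apply exists_int_of_circleExp
    have e := D.mul_σ (τ x) (τ y) (τ z) m (hτ x hx) (hτ y hy) (hτ z hz)
    have e1 : ∀ a b, m ∈ W.1 a → m ∈ W.1 b → D.σ (τ a) (τ b) m =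
        Circle.exp (2 * Real.pi * ζ a b m) • t (τ a) (τ b) m := fun a b ha hb => by
      rw [hexp a b m ⟨⟨ha, hb⟩, hb⟩, sdiv_smul]
    rw [e1 x y hx hy, e1 y z hy hz, e1 x z hx hz, map_smul_left, map_smul_right, ht, ← mul_smul,
      ← mul_smul] at e
    have e' := smul_right_cancel _ e
    have e2 : 2 * Real.pi * u x y z m = (2 * Real.pi * D.θ (τ x) (τ y) (τ z) m +
        2 * Real.pi * ζ x z m) - (2 * Real.pi * ζ x y m + 2 * Real.pi * ζ y z m) := by
      simp only [u]
      ring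
    rw [e2, Circle.exp_sub, Circle.exp_add, Circle.exp_add, e', div_self']
  have hj : ∀ x y z m, m ∈ W.1 x → m ∈ W.1 y → m ∈ W.1 z →
      ((⌊u x y z m⌋ : ℤ) : ℝ) = u x y z m := by
    intro x y z m hx hy hz
    obtain ⟨N, hN⟩ := hu x y z m hx hy hz
    rw [← hN, Int.floor_intCast]
  refine (hc.comp τ hτ).eq_zero (fun x y z m => ⌊u x y z m⌋) (fun x y z => ?_)
    fun x₀ x₁ x₂ x₃ m h0 h1 h2 h3 => ?_
  · refine Cech.continuousOn_of_intCast (g := u x y z) ?_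
      fun m hm => hj x y z m hm.1 hm.2.1 hm.2.2
    refine ContinuousOn.sub ((D.smooth_θ _ _ _).continuousOn.mono
      fun m hm => ⟨⟨hτ _ hm.1, hτ _ hm.2.1⟩, hτ _ hm.2.2⟩) ((ContinuousOn.sub ?_ ?_).add ?_)
    · exact (hζ y z).continuousOn.mono fun m hm => ⟨⟨hm.2.1, hm.2.2⟩, hm.2.2⟩
    · exact (hζ x z).continuousOn.mono fun m hm => ⟨⟨hm.1, hm.2.2⟩, hm.2.2⟩
    · exact (hζ x y).continuousOn.mono fun m hm => ⟨⟨hm.1, hm.2.1⟩, hm.2.1⟩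
  · simp only [Cech.delta₂]
    push_cast
    rw [hj _ _ _ _ h1 h2 h3, hj _ _ _ _ h0 h2 h3, hj _ _ _ _ h0 h1 h3, hj _ _ _ _ h0 h1 h2]
    simp only [u]
    ring

end GerbeOver

/-! ### The class of `P* ⊗ Q` -/

namespace GerbeOver

variable {S T : SurjSubmersion n M} (G : GerbeOver S) (H : GerbeOver T)

/-- The point `(y, x)` of the fibre product. -/
def _root_.SurjSubmersion.fiberPair (y : S.Y) (x : T.Y) (e : S.proj y = T.proj x) :
    (S.fiberProd T).Y :=
  (⟨y, x, e⟩ : FiberProd S T)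

/-- The product `P* ⊗ Q` over the fibre product `Y ×_M X`. -/
abbrev dualTensor : GerbeOver (S.fiberProd T) :=
  (G.dual.pullback (S.homFst T)).tensor (H.pullback (S.homSnd T))

/-- The element of a fibre of `P* ⊗ Q` given by elements of the fibres of `P` and `Q`. -/
def dualTensorMk {y₁ y₂ : S.Y} {x₁ x₂ : T.Y} {e₁ : S.proj y₁ = T.proj x₁}
    {e₂ : S.proj y₂ = T.proj x₂} {h : S.proj y₁ = S.proj y₂} {h' : T.proj x₁ = T.proj x₂}
    (p : G.P.Fib (pair y₁ y₂ h)) (q : H.P.Fib (pair x₁ x₂ h')) :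
    (dualTensor G H).P.Fib
      (pair (fiberPair y₁ x₁ e₁) (fiberPair y₂ x₂ e₂) h') :=
  TensorFib.mk (A := DualFib (G.P.Fib (pair y₁ y₂ h))) (B := H.P.Fib (pair x₁ x₂ h'))
    (DualFib.of p) q

theorem dualTensor_mul {y₁ y₂ y₃ : S.Y} {x₁ x₂ x₃ : T.Y} {e₁ : S.proj y₁ = T.proj x₁}
    {e₂ : S.proj y₂ = T.proj x₂} {e₃ : S.proj y₃ = T.proj x₃} {h₁ : S.proj y₁ = S.proj y₂}
    {h₁' : T.proj x₁ = T.proj x₂} {h₂ : S.proj y₂ = S.proj y₃} {h₂' : T.proj x₂ = T.proj x₃}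
    (p : G.P.Fib (pair y₁ y₂ h₁)) (q : H.P.Fib (pair x₁ x₂ h₁'))
    (p' : G.P.Fib (pair y₂ y₃ h₂)) (q' : H.P.Fib (pair x₂ x₃ h₂')) :
    (dualTensor G H).mul (dualTensorMk G H (e₁ := e₁) (e₂ := e₂) p q)
        (dualTensorMk G H (e₁ := e₂) (e₂ := e₃) p' q') =
      dualTensorMk G H (G.mul p p') (H.mul q q') := rfl

/-- The circle acts inversely on the dual factor. This is where the minus sign in `c - b` comes
from. -/
theorem dualTensorMk_smul {y₁ y₂ : S.Y} {x₁ x₂ : T.Y} {e₁ : S.proj y₁ = T.proj x₁}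
    {e₂ : S.proj y₂ = T.proj x₂} {h : S.proj y₁ = S.proj y₂} {h' : T.proj x₁ = T.proj x₂}
    (z w : Circle) (p : G.P.Fib (pair y₁ y₂ h)) (q : H.P.Fib (pair x₁ x₂ h')) :
    dualTensorMk G H (e₁ := e₁) (e₂ := e₂) (z • p) (w • q) =
      (w / z) • dualTensorMk G H (e₁ := e₁) (e₂ := e₂) p q := by
  have h1 := TensorFib.smul_mk (w / z) (DualFib.of p) q
  have h2 := TensorFib.mk_smul_left w (DualFib.of (z • p)) q
  rw [DualFib.smul_of] at h1 h2
  refine h2.symm.trans (Eq.trans (congrArg (fun x => TensorFib.mk (DualFib.of x) q) ?_) h1.symm)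
  rw [← mul_smul, inv_div, div_eq_inv_mul]

variable {G H}

/-- The local data of `P* ⊗ Q` given by local data of `P` and `Q`. -/
def PointedData.dualTensor (D : PointedData G) (D' : PointedData H) :
    PointedData (GerbeOver.dualTensor G H) where
  -- The order of the two covers is that of `Represents.sub` for the difference `c - b`.
  U := min D'.U D.U
  s x m := fiberPair (D.s x m) (D'.s x m) ((D.proj_s x m).trans (D'.proj_s x m).symm)
  proj_s x m := D'.proj_s x m
  smooth_s x := contMDiffOn_of_comp (S := S) (T := T) (min D'.U D.U |>.1 x).isOpen
    ((D.smooth_s x).mono fun m hm => hm.2) ((D'.smooth_s x).mono fun m hm => hm.1)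
  σ x y m := dualTensorMk G H (D.σ x y m) (D'.σ x y m)
  smooth_σ x y := by
    refine U1Bundle.SmoothAlong.tensor (U1Bundle.SmoothAlong.pullback (P := G.P.dual)
      (hg := (S.homFst T).contMDiff_sq)
      (U1Bundle.SmoothAlong.dual ?_)) (U1Bundle.SmoothAlong.pullback (P := H.P)
      (hg := (S.homSnd T).contMDiff_sq) ?_)
    · exact (D.smooth_σ x y).mono fun m hm => ⟨hm.1.2, hm.2.2⟩
    · exact (D'.smooth_σ x y).mono fun m hm => ⟨hm.1.1, hm.2.1⟩
  θ x y z m := D'.θ x y z m - D.θ x y z m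
  smooth_θ x y z := ((D'.smooth_θ x y z).mono fun m hm => ⟨⟨hm.1.1.1, hm.1.2.1⟩, hm.2.1⟩).sub
    ((D.smooth_θ x y z).mono fun m hm => ⟨⟨hm.1.1.2, hm.1.2.2⟩, hm.2.2⟩)
  mul_σ x y z m hx hy hz := by
    refine (dualTensor_mul G H _ _ _ _).trans ((congrArg₂ (dualTensorMk G H)
      (D.mul_σ x y z m hx.2 hy.2 hz.2) (D'.mul_σ x y z m hx.1 hy.1 hz.1)).trans ?_)
    rw [mul_sub, Circle.exp_sub]
    exact dualTensorMk_smul G H _ _ _ _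

end GerbeOver

namespace BundleGerbe

open GerbeOver

variable {G H : BundleGerbe n M}

theorem IsDDClass.tensor_dual {b c : Cech.H M 3} (hG : G.IsDDClass b) (hH : H.IsDDClass c) :
    (G.dual.tensor H).IsDDClass (c - b) := by
  obtain ⟨D, hD⟩ := exists_pointedData_of_isDDClass hG
  obtain ⟨D', hD'⟩ := exists_pointedData_of_isDDClass hH
  refine (D.dualTensor D').isDDClass (G := G.dual.tensor H) ?_
  have e : Cech.delta₂ (D.dualTensor D').θ = fun x₀ x₁ x₂ x₃ m =>
      Cech.delta₂ D'.θ x₀ x₁ x₂ x₃ m - Cech.delta₂ D.θ x₀ x₁ x₂ x₃ m := by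
    funext x₀ x₁ x₂ x₃ m
    simp only [Cech.delta₂, PointedData.dualTensor]
    ring
  have h := hD'.sub hD
  rw [← e] at h
  exact h

theorem IsDDClass.eq_zero [T2Space M] [SecondCountableTopology M] {c : Cech.H M 3}
    (hc : G.IsDDClass c) (hG : G.IsTrivial) : c = 0 := by
  obtain ⟨D, hD⟩ := exists_pointedData_of_isDDClass hc
  exact hG.eq_zero D hD

end BundleGerbe

end Trivial

end

/-! ### Division in a gerbe, and triviality from class zero -/

section

open TopologicalSpace SurjSubmersion

theorem contMDiffOn_intCast {E : Type*} [NormedAddCommGroup E] [NormedSpace ℝ E] {N : Type*}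
    [TopologicalSpace N] [ChartedSpace E N] {j : N → ℤ} {W : Set N} (hW : IsOpen W)
    (hj : ContinuousOn j W) : ContMDiffOn 𝓘(ℝ, E) 𝓘(ℝ) ∞ (fun m => (j m : ℝ)) W := by
  intro m hm
  have h : (fun m => (j m : ℝ)) =ᶠ[nhds m] fun _ => (j m : ℝ) := by
    filter_upwards [(hj.continuousAt (hW.mem_nhds hm)).eventually_mem
      ((isOpen_discrete {j m}).mem_nhds rfl)] with m' hm'
    rw [mem_singleton_iff.1 hm']
  exact (contMDiffAt_const.congr_of_eventuallyEq h).contMDiffWithinAt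

namespace GerbeOver

section Div

variable {n : ℕ} {M : Type u} [TopologicalSpace M]
  [ChartedSpace (EuclideanSpace ℝ (Fin n)) M] [IsManifold (𝓡 n) ∞ M] {S : SurjSubmersion n M}
  (G : GerbeOver S)

/-- The division `P_{(y₁, z)} × P_{(y₂, z)} → P_{(y₁, y₂)}`. -/
def div {y₁ y₂ z z' : S.Y} (e : z' = z) {h₁ : S.proj y₁ = S.proj z} {h₂ : S.proj y₂ = S.proj z'}
    {h : S.proj y₁ = S.proj y₂} (p : G.P.Fib (pair y₁ z h₁)) (q : G.P.Fib (pair y₂ z' h₂)) :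
    G.P.Fib (pair y₁ y₂ h) :=
  (G.exists_mul_eq (h₁ := h) (G.castFib rfl e h₂ (e ▸ h₂) q) p).choose

variable {y₁ y₂ y₃ z z' z'' : S.Y} {h₁ : S.proj y₁ = S.proj z} {h₂ : S.proj y₂ = S.proj z'}
  {h₃ : S.proj y₃ = S.proj z''} {h : S.proj y₁ = S.proj y₂} {h' : S.proj y₂ = S.proj y₃}

/-- The defining property of the quotient `p/q`. The explicit equality `e` is needed because in the
application the two end points are built from the images of `y₁` and of `y₂` in `M`, which are equal
but not syntactically the same. -/
theorem div_mul (e : z' = z) (p : G.P.Fib (pair y₁ z h₁)) (q : G.P.Fib (pair y₂ z' h₂)) :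
    G.mul (G.div e (h := h) p q) (G.castFib rfl e h₂ (e ▸ h₂) q) = p :=
  (G.exists_mul_eq (h₁ := h) (G.castFib rfl e h₂ (e ▸ h₂) q) p).choose_spec

theorem div_eq (e : z' = z) {p : G.P.Fib (pair y₁ z h₁)} {q : G.P.Fib (pair y₂ z' h₂)}
    {r : G.P.Fib (pair y₁ y₂ h)} (hr : G.mul r (G.castFib rfl e h₂ (e ▸ h₂) q) = p) :
    G.div e p q = r :=
  G.mul_right_cancel _ ((G.div_mul e p q).trans hr.symm)

theorem div_smul_left (e : z' = z) (w : Circle) (p : G.P.Fib (pair y₁ z h₁))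
    (q : G.P.Fib (pair y₂ z' h₂)) : G.div e (h := h) (w • p) q = w • G.div e p q :=
  G.div_eq e (by rw [map_smul_left, div_mul])

/-- In this form the statement says that division is equivariant in the dual of the second factor,
so it descends to `R ⊗ R*`. -/
theorem div_smul_right (e : z' = z) (w : Circle) (p : G.P.Fib (pair y₁ z h₁))
    (q : G.P.Fib (pair y₂ z' h₂)) : G.div e (h := h) p (w⁻¹ • q) = w • G.div e p q :=
  G.div_eq e (by rw [castFib_smul, map_smul_left, map_smul_right, div_mul, smul_inv_smul])

/-- By associativity `(p/q)(q/r)` solves the equation that defines `p/r`. This becomes the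
compatibility of division with the contraction in `δ(R)`. -/
theorem div_mul_div (e : z' = z) (e' : z'' = z') (p : G.P.Fib (pair y₁ z h₁))
    (q : G.P.Fib (pair y₂ z' h₂)) (r : G.P.Fib (pair y₃ z'' h₃)) :
    G.mul (G.div e (h := h) p q) (G.div e' (h := h') q r) = G.div (e'.trans e) p r := by
  subst e e'
  refine (G.div_eq _ ?_).symm
  have h1 := G.div_mul (h := h) rfl p q
  have h2 := G.div_mul (h := h') rfl q r
  rw [mul_assoc, h2]
  exact h1

variable {E' : Type*} [NormedAddCommGroup E'] [NormedSpace ℝ E'] {N : Type*}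
  [TopologicalSpace N] [ChartedSpace E' N]

/-- Locally `p/q` is a smooth section `t` of `P` along `(a, b)`, rescaled by the ratio of `p` to `t
q`, which is smooth by `smoothAlong_mul`. -/
theorem smoothAlong_div {a b c c' : N → S.Y} {W : Set N} (hW : IsOpen W)
    (ha : ContMDiffOn 𝓘(ℝ, E') 𝓘(ℝ, S.E) ∞ a W) (hb : ContMDiffOn 𝓘(ℝ, E') 𝓘(ℝ, S.E) ∞ b W)
    (hc : ContMDiffOn 𝓘(ℝ, E') 𝓘(ℝ, S.E) ∞ c W) (e : ∀ m, c' m = c m)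
    {h₁ : ∀ m, S.proj (a m) = S.proj (c m)} {h₂ : ∀ m, S.proj (b m) = S.proj (c' m)}
    {h : ∀ m, S.proj (a m) = S.proj (b m)}
    {p : ∀ m, G.P.Fib (pair (a m) (c m) (h₁ m))} {q : ∀ m, G.P.Fib (pair (b m) (c' m) (h₂ m))}
    (hp : G.P.SmoothAlong E' (fun m => pair (a m) (c m) (h₁ m)) p W)
    (hq : G.P.SmoothAlong E' (fun m => pair (b m) (c' m) (h₂ m)) q W) :
    G.P.SmoothAlong E' (fun m => pair (a m) (b m) (h m)) (fun m => G.div (e m) (p m) (q m)) W := by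
  obtain rfl : c' = c := funext e
  refine U1Bundle.SmoothAlong.of_locally fun m hm => ?_
  obtain ⟨V, hmV, t, ht⟩ := G.P.exists_smoothAlong hW (contMDiffOn_pair hW ha hb h) hm
  refine ⟨V, V.isOpen, hmV, ?_⟩
  have ho := hW.inter V.isOpen
  have i1 : W ∩ V ⊆ W := inter_subset_left
  have ht' := ht.mono (inter_subset_right (s := W))
  have k := (hp.mono i1).sdiv (G.smoothAlong_mul ho (ha.mono i1) (hb.mono i1) (hc.mono i1) ht'
    (hq.mono i1)) (contMDiffOn_pair ho (ha.mono i1) (hc.mono i1) h₁).continuousOn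
  refine (ht'.smul k).congr fun m _ => G.div_eq rfl ?_
  rw [map_smul_left]
  exact sdiv_smul _ _

end Div

/-! ### Descent: the bundle `R` with `δ(R) ≅ P` -/

section Descent

variable {n : ℕ} {M : Type u} [TopologicalSpace M]
  [ChartedSpace (EuclideanSpace ℝ (Fin n)) M] [IsManifold (𝓡 n) ∞ M] {S : SurjSubmersion n M}

/-- Sections `s_x` of `Y → M` and sections `σ_xy` of `(s_x, s_y)^* P` compatible with the
multiplication. -/
structure Trivialization (G : GerbeOver S) where
  U : Cech.PointedCover M
  s : M → M → S.Y
  proj_s : ∀ x m, S.proj (s x m) = m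
  smooth_s : ∀ x, ContMDiffOn (𝓡 n) 𝓘(ℝ, S.E) ∞ (s x) (U.1 x)
  σ : ∀ x y m, G.P.Fib (pair (s x m) (s y m) ((proj_s x m).trans (proj_s y m).symm))
  smooth_σ : ∀ x y, G.P.SmoothAlong (EuclideanSpace ℝ (Fin n))
    (fun m => pair (s x m) (s y m) ((proj_s x m).trans (proj_s y m).symm)) (σ x y)
    (U.1 x ∩ U.1 y)
  mul_σ : ∀ x y z m, m ∈ U.1 x → m ∈ U.1 y → m ∈ U.1 z →
    G.mul (σ x y m) (σ y z m) = σ x z m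

namespace Trivialization

variable {G : GerbeOver S} (D : Trivialization G)

/-- A common right factor cancels from a quotient. Division in the fibres of `R` can therefore be
computed with a fixed index `b`, where everything is smooth. -/
theorem div_mul_σ {x x' : M} (e : x' = x) (b : M) {y₁ y₂ : S.Y} {h₁ : S.proj y₁ = S.proj (D.s b x)}
    {h₂ : S.proj y₂ = S.proj (D.s b x')} {h : S.proj y₁ = S.proj y₂}
    (p : G.P.Fib (pair y₁ (D.s b x) h₁)) (q : G.P.Fib (pair y₂ (D.s b x') h₂)) :
    G.div (congrArg (fun x => D.s x x) e) (h := h) (G.mul p (D.σ b x x))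
      (G.mul q (D.σ b x' x')) = G.div (congrArg (D.s b) e) p q := by
  subst e
  refine G.div_eq _ ?_
  have h1 := G.div_mul (h := h) rfl p q
  refine (G.mul_assoc _ _ _).symm.trans ?_
  exact congrArg (fun r => G.mul r (D.σ b x' x')) h1

theorem proj_eq (b : M) (y : S.Y) : S.proj y = S.proj (D.s b (S.proj y)) :=
  (D.proj_s b (S.proj y)).symm

theorem smooth_s_proj {b : M} {W : Set S.Y} (hW : ∀ y ∈ W, S.proj y ∈ D.U.1 b) :
    ContMDiffOn 𝓘(ℝ, S.E) 𝓘(ℝ, S.E) ∞ (fun y => D.s b (S.proj y)) W :=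
  (D.smooth_s b).comp S.contMDiff_proj.contMDiffOn hW

theorem smooth_pair_proj {b : M} {W : Set S.Y} (ho : IsOpen W)
    (hW : ∀ y ∈ W, S.proj y ∈ D.U.1 b) :
    ContMDiffOn 𝓘(ℝ, S.E) 𝓘(ℝ, S.sq.E) ∞
      (fun y => pair y (D.s b (S.proj y)) (D.proj_eq b y)) W :=
  contMDiffOn_pair ho contMDiffOn_id (D.smooth_s_proj hW) _

/-- The bundle over `Y` with fibres `P_{(y, s_x(x))}`, where `x` is the image of `y` in `M`. -/
def bundle : U1Bundle S.E S.Y where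
  Fib y := G.P.Fib (pair y (D.s (S.proj y) (S.proj y)) (D.proj_eq _ y))
  -- In the fibre over `y` the index of the section `s` is the image of `y`, and nothing is assumed
  -- about how `s` and `σ` depend on their indices. Smoothness is instead defined with a locally
  -- fixed index `b`: a smooth element of `P_{(y, s_b)}` is carried into the fibre by `σ_{b,x}`.
  atlas := {r | ∃ b : M, (∀ y ∈ r.1, S.proj y ∈ D.U.1 b) ∧
    ∃ p : ∀ y, G.P.Fib (pair y (D.s b (S.proj y)) (D.proj_eq b y)),
      G.P.SmoothAlong S.E (fun y => pair y (D.s b (S.proj y)) (D.proj_eq b y)) p r.1 ∧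
      ∀ y, r.2 y = G.mul (p y) (D.σ b (S.proj y) (S.proj y))}
  cover y := by
    have ho := (D.U.1 (S.proj y)).isOpen.preimage S.contMDiff_proj.continuous
    obtain ⟨V, hyV, p, hp⟩ := G.P.exists_smoothAlong ho
      (D.smooth_pair_proj (b := S.proj y) ho fun _ h => h) (m := y) (D.U.2 _)
    exact ⟨⟨V ⊓ ⟨_, ho⟩, _⟩, ⟨S.proj y, fun y h => h.2, p, hp.mono inter_subset_left,
      fun y => rfl⟩, hyV, D.U.2 _⟩
  compat := by
    rintro ⟨A, r⟩ ⟨b, hb, p, hp, hr⟩ ⟨A', r'⟩ ⟨c, hc, q, hq, hr'⟩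
    have ho : IsOpen ((A : Set S.Y) ∩ A') := A.isOpen.inter A'.isOpen
    have hb' : ∀ y ∈ (A : Set S.Y) ∩ A', S.proj y ∈ D.U.1 b := fun y h => hb y h.1
    have hc' : ∀ y ∈ (A : Set S.Y) ∩ A', S.proj y ∈ D.U.1 c := fun y h => hc y h.2
    have hσ := (D.smooth_σ b c).comp (S.contMDiff_proj.contMDiffOn (s := (A : Set S.Y) ∩ A'))
      fun y hy => ⟨hb' y hy, hc' y hy⟩
    have k := (G.smoothAlong_mul ho contMDiffOn_id (D.smooth_s_proj hb') (D.smooth_s_proj hc')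
      (h := D.proj_eq b) (hp.mono inter_subset_left) hσ).sdiv (hq.mono inter_subset_right)
      (D.smooth_pair_proj ho hc').continuousOn
    refine k.congr fun y hy => ?_
    change r y /ₛ r' y = _
    -- Strict multiplicativity factors `σ_{b,x}` as `σ_{b,c} σ_{c,x}`. The possibly non-smooth
    -- factor `σ_{c,x}` then cancels, and the transition function involves only `p`, `q` and
    -- `σ_{b,c}`.
    have e : r y = G.mul (G.mul (p y) (D.σ b c (S.proj y))) (D.σ c (S.proj y) (S.proj y)) := by
      rw [mul_assoc, D.mul_σ b c _ _ (hb' y hy) (hc' y hy) (D.U.2 _)]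
      exact hr y
    rw [e, show r' y = _ from hr' y, mul_sdiv_mul, sdiv_self, mul_one]

theorem proj_s_congr {y₁ y₂ : S.Y} (h : S.proj y₁ = S.proj y₂) :
    D.s (S.proj y₂) (S.proj y₂) = D.s (S.proj y₁) (S.proj y₁) :=
  congrArg (fun x => D.s x x) h.symm

/-- The isomorphism `δ(R) → P` given by division. -/
def toIso : U1Bundle.Iso (delta D.bundle).P G.P :=
  U1Bundle.Iso.ofBilinear (P := D.bundle.pullback S.p₁ S.contMDiff_p₁)
    (Q := (D.bundle.pullback S.p₂ S.contMDiff_p₂).dual)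
    (fun b p q => G.div (y₁ := S.p₁ b) (y₂ := S.p₂ b) (h := S.proj_p₁ b)
      (D.proj_s_congr (S.proj_p₁ b)) p q.val)
    (fun b w p q => G.div_smul_left _ w p q.val)
    (fun b w p q => G.div_smul_right _ w p q.val)
    (fun b => by
      -- The index is frozen at the image of the point under consideration, which gives atlas
      -- sections of `R` near both end points.
      let x := S.proj (S.p₁ b)
      have ho := (D.U.1 x).isOpen.preimage S.contMDiff_proj.continuous
      have h2 : S.proj (S.p₂ b) ∈ D.U.1 x := S.proj_p₁ b ▸ D.U.2 x
      obtain ⟨V₁, hV₁, p₁, hp₁⟩ := G.P.exists_smoothAlong ho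
        (D.smooth_pair_proj (b := x) ho fun _ h => h) (m := S.p₁ b) (D.U.2 x)
      obtain ⟨V₂, hV₂, p₂, hp₂⟩ := G.P.exists_smoothAlong ho
        (D.smooth_pair_proj (b := x) ho fun _ h => h) (m := S.p₂ b) h2
      let A₁ : Opens S.Y := V₁ ⊓ ⟨_, ho⟩
      let A₂ : Opens S.Y := V₂ ⊓ ⟨_, ho⟩
      let r₁ : ∀ y, D.bundle.Fib y := fun y => G.mul (p₁ y) (D.σ x (S.proj y) (S.proj y))
      let r₂ : ∀ y, D.bundle.Fib y := fun y => G.mul (p₂ y) (D.σ x (S.proj y) (S.proj y))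
      have hr₁ : (A₁, r₁) ∈ D.bundle.atlas :=
        ⟨x, fun y h => h.2, p₁, hp₁.mono inter_subset_left, fun y => rfl⟩
      have hr₂ : (A₂, r₂) ∈ D.bundle.atlas :=
        ⟨x, fun y h => h.2, p₂, hp₂.mono inter_subset_left, fun y => rfl⟩
      have hW : IsOpen (S.p₁ ⁻¹' A₁ ∩ S.p₂ ⁻¹' A₂) :=
        (A₁.isOpen.preimage S.contMDiff_p₁.continuous).inter
          (A₂.isOpen.preimage S.contMDiff_p₂.continuous)
      refine ⟨S.p₁ ⁻¹' A₁ ∩ S.p₂ ⁻¹' A₂, fun b => r₁ (S.p₁ b), fun b => DualFib.of (r₂ (S.p₂ b)),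
        hW, ⟨⟨hV₁, D.U.2 x⟩, hV₂, h2⟩,
        ((D.bundle.smoothOn_of_mem hr₁).pullback S.contMDiff_p₁).mono inter_subset_left,
        (((D.bundle.smoothOn_of_mem hr₂).pullback S.contMDiff_p₂).dual).mono inter_subset_right, ?_⟩
      have k1 := (hp₁.mono inter_subset_left).comp (V := S.p₁ ⁻¹' A₁ ∩ S.p₂ ⁻¹' A₂)
        S.contMDiff_p₁.contMDiffOn fun c hc => hc.1
      have k2 := (hp₂.mono inter_subset_left).comp (V := S.p₁ ⁻¹' A₁ ∩ S.p₂ ⁻¹' A₂)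
        S.contMDiff_p₂.contMDiffOn fun c hc => hc.2
      have k := G.smoothAlong_div hW S.contMDiff_p₁.contMDiffOn S.contMDiff_p₂.contMDiffOn
        ((D.smooth_s_proj (b := x) (W := A₁) fun y h => h.2).comp S.contMDiff_p₁.contMDiffOn
          fun c hc => hc.1)
        (fun c => congrArg (D.s x) (S.proj_p₁ c).symm) (h := S.proj_p₁) k1 k2
      have k' := k.congr (τ := fun c => G.div (y₁ := S.p₁ c) (y₂ := S.p₂ c) (h := S.proj_p₁ c)
        (D.proj_s_congr (S.proj_p₁ c)) (r₁ (S.p₁ c)) (r₂ (S.p₂ c)))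
        fun c _ => D.div_mul_σ (S.proj_p₁ c).symm x _ _
      exact k')

/-- The fibres `R_y = P_{(y, s_x(x))}` recover `P_{(y₁, y₂)}` by division, because `y₁` and `y₂`
have the same reference point. Compatibility with the multiplications is `(a/b)(b/c) = a/c`. -/
theorem isTrivial (D : Trivialization G) : G.IsTrivial := by
  refine ⟨D.bundle, ⟨D.toIso, fun y₁ y₂ y₃ h h' => ?_⟩⟩
  refine TensorFib.ind (A := D.bundle.Fib y₁) (B := DualFib (D.bundle.Fib y₂)) fun a b =>
    TensorFib.ind (A := D.bundle.Fib y₂) (B := DualFib (D.bundle.Fib y₃)) fun b' c => ?_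
  obtain ⟨b⟩ := b
  obtain ⟨c⟩ := c
  change G.div (D.proj_s_congr (h.trans h')) ((b' /ₛ b) • a) c =
    G.mul (G.div (D.proj_s_congr h) a b) (G.div (D.proj_s_congr h') b' c)
  -- The contraction pairs `b*` with `b'`. Writing `b'` as a phase times `b` reduces to equal middle
  -- terms.
  have e : G.div (D.proj_s_congr h') (h := h') b' c =
      (b' /ₛ b) • G.div (D.proj_s_congr h') (h := h') b c := by
    refine Eq.trans ?_ (G.div_smul_left (D.proj_s_congr h') (h := h') (b' /ₛ b) b c)
    exact congrArg (fun x => G.div (D.proj_s_congr h') (h := h') x c) (sdiv_smul b' b).symm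
  rw [e, map_smul_right]
  refine (G.div_smul_left _ _ _ _).trans (congrArg _ ?_)
  exact (G.div_mul_div (D.proj_s_congr h) (D.proj_s_congr h') a b c).symm

end Trivialization

variable [T2Space M] [SecondCountableTopology M]

/-- After refinement `δθ = δj` with `j` integral. The smooth real cocycle `θ - j` equals `δη`, and
twisting `σ` by `exp(-2πiη)` leaves only the factor `exp(2πij) = 1`. -/
theorem isTrivial_of_represents_zero {G : GerbeOver S} (D : PointedData G)
    (h : Cech.Represents D.U (Cech.delta₂ D.θ) 0) : G.IsTrivial := by
  obtain ⟨V, hV, j, hj, e⟩ := h.exists_of_zero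
  obtain ⟨η, hη, hηd⟩ := Cech.exists_smooth_primitive₂ V
    (fun x y z m => D.θ x y z m - (j x y z m : ℝ))
    (fun x y z => ((D.smooth_θ x y z).mono fun m hm => ⟨⟨hV _ hm.1.1, hV _ hm.1.2⟩, hV _ hm.2⟩).sub
      (contMDiffOn_intCast (((V.1 x).isOpen.inter (V.1 y).isOpen).inter (V.1 z).isOpen)
        ((hj x y z).mono fun m hm => ⟨hm.1.1, hm.1.2, hm.2⟩)))
    (fun x₀ x₁ x₂ x₃ m h0 h1 h2 h3 => by
      have := e x₀ x₁ x₂ x₃ m h0 h1 h2 h3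
      simp only [Cech.delta₂] at this ⊢
      push_cast at this
      linear_combination this)
  have hηe : ∀ x y, ContMDiffOn (𝓡 n) (𝓡 1) ∞
      (fun m => Circle.exp (-(2 * Real.pi * η x y m))) (V.1 x ∩ V.1 y) := fun x y =>
    contMDiff_circleExp.comp_contMDiffOn (((contDiff_const.mul contDiff_id).neg :
      ContDiff ℝ ∞ fun t : ℝ => -(2 * Real.pi * t)).contMDiff.comp_contMDiffOn (hη x y))
  refine Trivialization.isTrivial ⟨V, D.s, D.proj_s, fun x => (D.smooth_s x).mono (hV x),
    fun x y m => Circle.exp (-(2 * Real.pi * η x y m)) • D.σ x y m, fun x y =>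
      ((D.smooth_σ x y).mono fun m hm => ⟨hV _ hm.1, hV _ hm.2⟩).smul (hηe x y),
    fun x y z m hx hy hz => ?_⟩
  rw [map_smul_left, map_smul_right, D.mul_σ x y z m (hV _ hx) (hV _ hy) (hV _ hz), ← mul_smul,
    ← mul_smul, ← Circle.exp_add, ← Circle.exp_add]
  congr 1
  have h1 := hηd x y z m hx hy hz
  have h2 : -(2 * Real.pi * η x y m) + -(2 * Real.pi * η y z m) + 2 * Real.pi * D.θ x y z m =
      -(2 * Real.pi * η x z m) + 2 * Real.pi * (j x y z m : ℝ) := by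
    linear_combination (-2 * Real.pi) * h1
  rw [h2, Circle.exp_add, circleExp_int, mul_one]

end Descent

end GerbeOver

theorem BundleGerbe.IsDDClass.isTrivial {n : ℕ} {M : Type u} [TopologicalSpace M]
    [ChartedSpace (EuclideanSpace ℝ (Fin n)) M] [IsManifold (𝓡 n) ∞ M] [T2Space M]
    [SecondCountableTopology M] {G : BundleGerbe n M} (h : G.IsDDClass 0) : G.IsTrivial := by
  obtain ⟨D, hD⟩ := GerbeOver.exists_pointedData_of_isDDClass h
  exact GerbeOver.isTrivial_of_represents_zero D hD

end

/-! ### The smooth structure lifted along a local homeomorphism -/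

section

open TopologicalSpace SurjSubmersion

namespace IsLocalHomeomorph

variable {E : Type} [NormedAddCommGroup E] {M : Type u} [TopologicalSpace M]
  [ChartedSpace E M] {Y : Type u} [TopologicalSpace Y] {f : Y → M} (hf : IsLocalHomeomorph f)

/-- The chart of the source of a local homeomorphism around `y` lifting the preferred chart of the
target. -/
def liftChart (y : Y) : OpenPartialHomeomorph Y E :=
  (hf y).choose.trans (chartAt E (f y))

theorem coe_liftChart (y : Y) : ⇑(hf.liftChart (E := E) y) = chartAt E (f y) ∘ f :=
  congrArg (fun g : Y → M => chartAt E (f y) ∘ g) (hf y).choose_spec.2.symm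

theorem mem_liftChart_source (y : Y) : y ∈ (hf.liftChart (E := E) y).source := by
  have h : f y ∈ (chartAt E (f y)).source := mem_chart_source E (f y)
  exact ⟨(hf y).choose_spec.1, (congrFun (hf y).choose_spec.2 y) ▸ h⟩

theorem mapsTo_liftChart {y z : Y} (hz : z ∈ (hf.liftChart (E := E) y).source) :
    f z ∈ (chartAt E (f y)).source := by
  have h : z ∈ (hf y).choose ⁻¹' (chartAt E (f y)).source := hz.2
  rwa [← (hf y).choose_spec.2] at h

theorem liftChart_symm_spec {y : Y} {w : E} (hw : w ∈ (hf.liftChart (E := E) y).target) :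
    f ((hf.liftChart y).symm w) = (chartAt E (f y)).symm w := by
  have h := (hf.liftChart y).right_inv hw
  rw [coe_liftChart] at h
  have h1 := hf.mapsTo_liftChart ((hf.liftChart y).map_target hw)
  rw [← (chartAt E (f y)).left_inv h1]
  exact congrArg _ h

/-- The charts of the source of a local homeomorphism to a charted space. -/
abbrev comapChartedSpace (E : Type) [NormedAddCommGroup E] {M : Type u}
    [TopologicalSpace M] [ChartedSpace E M] {Y : Type u} [TopologicalSpace Y] {f : Y → M}
    (hf : IsLocalHomeomorph f) : ChartedSpace E Y where
  atlas := range hf.liftChart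
  chartAt := hf.liftChart
  mem_chart_source := hf.mem_liftChart_source
  chart_mem_atlas y := ⟨y, rfl⟩

variable [NormedSpace ℝ E]

/-- Transition maps between lifted charts are restrictions of transition maps of `M`, since `f`
intertwines a lifted chart with the chart below it. -/
theorem isManifold [IsManifold 𝓘(ℝ, E) ∞ M] :
    letI := hf.comapChartedSpace E
    IsManifold 𝓘(ℝ, E) ∞ Y := by
  let := hf.comapChartedSpace E
  apply isManifold_of_contDiffOn
  rintro _ _ ⟨y, rfl⟩ ⟨z, rfl⟩
  have h := (contDiffGroupoid ∞ 𝓘(ℝ, E)).compatible (chart_mem_atlas E (f y))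
    (chart_mem_atlas E (f z))
  rw [contDiffGroupoid, mem_groupoid_of_pregroupoid] at h
  have h' : ContDiffOn ℝ ∞ (chartAt E (f z) ∘ (chartAt E (f y)).symm)
      ((chartAt E (f y)).symm ≫ₕ chartAt E (f z)).source := by
    simpa [contDiffPregroupoid] using h.1
  rw [modelWithCornersSelf_coe, modelWithCornersSelf_coe_symm, Function.id_comp, Function.comp_id,
    preimage_id, range_id, inter_univ]
  have hs : ∀ w ∈ ((hf.liftChart (E := E) y).symm ≫ₕ hf.liftChart (E := E) z).source,
      w ∈ (hf.liftChart (E := E) y).target ∧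
        (hf.liftChart (E := E) y).symm w ∈ (hf.liftChart (E := E) z).source := fun w hw => hw
  refine (h'.mono fun w hw => ?_).congr fun w hw => ?_
  · obtain ⟨h1, h2⟩ := hs w hw
    have h3 := hf.mapsTo_liftChart h2
    rw [liftChart_symm_spec hf h1] at h3
    exact ⟨h1.1, h3⟩
  · change hf.liftChart z ((hf.liftChart y).symm w) = _
    rw [coe_liftChart]
    exact congrArg (chartAt E (f z)) (liftChart_symm_spec hf (hs w hw).1)

variable [IsManifold 𝓘(ℝ, E) ∞ M]

/-- A lifted chart is `f` followed by a chart of `M`, so for a continuous map into `Y` smoothness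
can be tested after `f`. Continuity keeps nearby values on one sheet. -/
theorem contMDiffOn_of_comp {N E' : Type*} [NormedAddCommGroup E'] [NormedSpace ℝ E']
    [TopologicalSpace N] [ChartedSpace E' N] {g : N → Y} {W : Set N} (hW : IsOpen W)
    (hg : ContinuousOn g W) (hfg : ContMDiffOn 𝓘(ℝ, E') 𝓘(ℝ, E) ∞ (fun x => f (g x)) W) :
    letI := hf.comapChartedSpace E
    ContMDiffOn 𝓘(ℝ, E') 𝓘(ℝ, E) ∞ g W := by
  let := hf.comapChartedSpace E
  have := hf.isManifold (E := E)
  intro x hx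
  have ho := hg.isOpen_inter_preimage hW (hf.liftChart (E := E) (g x)).open_source
  have h1 : ContMDiffOn 𝓘(ℝ, E') 𝓘(ℝ, E) ∞ (fun z => hf.liftChart (E := E) (g x) (g z))
      (W ∩ g ⁻¹' (hf.liftChart (E := E) (g x)).source) := by
    rw [coe_liftChart]
    exact (contMDiffOn_chart (I := 𝓘(ℝ, E)) (x := f (g x)) (n := ∞)).comp
      (hfg.mono inter_subset_left) fun z hz => hf.mapsTo_liftChart hz.2
  have h2 := (contMDiffOn_chart_symm (I := 𝓘(ℝ, E)) (x := g x) (n := ∞)).comp h1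
    fun z hz => (hf.liftChart (E := E) (g x)).map_source hz.2
  refine ((h2.congr fun z hz => ?_).contMDiffAt
    (ho.mem_nhds ⟨hx, hf.mem_liftChart_source _⟩)).contMDiffWithinAt
  exact ((hf.liftChart (E := E) (g x)).left_inv hz.2).symm

/-- In lifted charts `f` is the identity, so the complement is the zero space, modelled by `PUnit`.
-/
theorem isSubmersion : letI := hf.comapChartedSpace E
    IsSubmersion 𝓘(ℝ, E) 𝓘(ℝ, E) ∞ f := by
  let := hf.comapChartedSpace E
  have := hf.isManifold (E := E)
  refine ⟨PUnit, inferInstance, inferInstance, fun y => ?_⟩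
  refine IsSubmersionAtOfComplement.mk_of_charts (ContinuousLinearEquiv.prodUnique ℝ E PUnit).symm
    (hf.liftChart y) (chartAt E (f y)) (hf.mem_liftChart_source y) (mem_chart_source E (f y))
    (IsManifold.chart_mem_maximalAtlas (I := 𝓘(ℝ, E)) y)
    (IsManifold.chart_mem_maximalAtlas (I := 𝓘(ℝ, E)) (f y)) (fun z hz => hf.mapsTo_liftChart hz) ?_
  intro w hw
  have hw' : w ∈ (hf.liftChart (E := E) y).target := by simpa using hw
  have h := (hf.liftChart y).right_inv hw'
  rw [coe_liftChart] at h
  simpa using h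

end IsLocalHomeomorph

end

/-! ### Every class is attained: gerbes from cocycles -/

section

open TopologicalSpace SurjSubmersion

/-- The fibre of the trivial `U(1)` bundle. -/
structure TrivialFib : Type u where
  of ::
  val : Circle

namespace TrivialFib

instance : Torsor Circle TrivialFib.{u} where
  smul z x := ⟨z * x.val⟩
  one_smul x := congrArg of (one_mul x.val)
  mul_smul z w x := congrArg of (mul_assoc z w x.val)
  sdiv x y := x.val / y.val
  nonempty := ⟨⟨1⟩⟩
  sdiv_smul' x y := congrArg of (div_mul_cancel x.val y.val)
  smul_sdiv' z x := mul_div_cancel_right z x.val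

end TrivialFib

variable (E : Type) [NormedAddCommGroup E] [NormedSpace ℝ E]
  (B : Type u) [TopologicalSpace B] [ChartedSpace E B] in
/-- The trivial `U(1)` bundle over `B`. -/
def U1Bundle.trivial : U1Bundle E B where
  Fib _ := TrivialFib
  atlas := {(⊤, fun _ => .of 1)}
  cover _ := ⟨_, rfl, mem_univ _⟩
  compat := by
    rintro _ rfl _ rfl
    exact contMDiffOn_const (c := (1 : Circle) / 1)

theorem U1Bundle.trivial_smoothAlong {E : Type} [NormedAddCommGroup E] [NormedSpace ℝ E]
    {B : Type u} [TopologicalSpace B] [ChartedSpace E B] {E' : Type*} [NormedAddCommGroup E']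
    [NormedSpace ℝ E'] {N : Type*} [TopologicalSpace N] [ChartedSpace E' N] {f : N → B}
    {z : N → Circle} {W : Set N} (hz : ContMDiffOn 𝓘(ℝ, E') (𝓡 1) ∞ z W) :
    (U1Bundle.trivial E B).SmoothAlong E' f (fun m => (.of (z m) : TrivialFib)) W := by
  rintro _ rfl
  refine (hz.mono inter_subset_left).congr fun m _ => ?_
  exact div_one (z m)

section

variable {n : ℕ} {M : Type u} [TopologicalSpace M]
  [ChartedSpace (EuclideanSpace ℝ (Fin n)) M] [IsManifold (𝓡 n) ∞ M]

/-- The bundle gerbe whose bundle is trivial, with the multiplication given by a smooth `2`-cocycle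
`g : Y^[3] → U(1)`. -/
def GerbeOver.ofCocycle (S : SurjSubmersion n M) (g : S.Y → S.Y → S.Y → Circle)
    (hg : ContMDiff 𝓘(ℝ, S.cube.E) (𝓡 1) ∞
      fun b : S.cube.Y => g (S.fst S.sq b) (S.p₁ (S.snd S.sq b)) (S.p₂ (S.snd S.sq b)))
    (hc : ∀ y₁ y₂ y₃ y₄, S.proj y₁ = S.proj y₂ → S.proj y₂ = S.proj y₃ → S.proj y₃ = S.proj y₄ →
      g y₁ y₂ y₃ * g y₁ y₃ y₄ = g y₂ y₃ y₄ * g y₁ y₂ y₄) : GerbeOver S where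
  P := U1Bundle.trivial S.sq.E S.sq.Y
  m := U1Bundle.Iso.ofBilinear
    (fun b p q => (.of (g (S.fst S.sq b) (S.p₁ (S.snd S.sq b)) (S.p₂ (S.snd S.sq b)) *
      (p.val * q.val)) : TrivialFib))
    (fun b z p q => congrArg TrivialFib.of (by
      change _ * (z * p.val * q.val) = z * (_ * (p.val * q.val))
      rw [_root_.mul_assoc z, mul_left_comm]))
    (fun b z p q => congrArg TrivialFib.of (by
      change _ * (p.val * (z * q.val)) = z * (_ * (p.val * q.val))
      rw [mul_left_comm p.val, mul_left_comm]))
    (fun b => by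
      refine ⟨univ, fun _ => (.of 1 : TrivialFib), fun _ => (.of 1 : TrivialFib), isOpen_univ,
        mem_univ b, U1Bundle.smoothOn_pullback_iff.2 (U1Bundle.trivial_smoothAlong contMDiffOn_const),
        U1Bundle.smoothOn_pullback_iff.2 (U1Bundle.trivial_smoothAlong contMDiffOn_const),
        U1Bundle.smoothOn_pullback_iff.2 (U1Bundle.trivial_smoothAlong ?_)⟩
      simpa using hg.contMDiffOn)
  assoc y₁ y₂ y₃ y₄ h₁₂ h₂₃ h₃₄ p q r := by
    obtain ⟨p⟩ := p
    obtain ⟨q⟩ := q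
    obtain ⟨r⟩ := r
    refine congrArg TrivialFib.of ?_
    change g y₁ y₃ y₄ * ((g y₁ y₂ y₃ * (p * q)) * r) = g y₁ y₂ y₄ * (p * (g y₂ y₃ y₄ * (q * r)))
    calc _ = (g y₁ y₂ y₃ * g y₁ y₃ y₄) * (p * q * r) := by ac_rfl
      _ = (g y₂ y₃ y₄ * g y₁ y₂ y₄) * (p * q * r) := by rw [hc _ _ _ _ h₁₂ h₂₃ h₃₄]
      _ = _ := by ac_rfl

/-! ### The disjoint union of a countable subcover as a submersion -/

namespace Cech.PointedCover

variable (U : Cech.PointedCover M) (C : Set M)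

/-- The disjoint union of the members of a cover indexed by `C`. -/
abbrev Total : Type u := Σ i : C, U.1 i

/-- The map from the disjoint union of members of a cover to the space. -/
def totalProj (y : U.Total C) : M := y.2

omit [ChartedSpace (EuclideanSpace ℝ (Fin n)) M] [IsManifold (𝓡 n) ∞ M] in
theorem isLocalHomeomorph_totalProj : IsLocalHomeomorph (U.totalProj C) := by
  rw [isLocalHomeomorph_iff_isLocalHomeomorphOn_univ]
  refine IsLocalHomeomorphOn.mk _ _ fun y _ => ?_
  obtain ⟨i, m⟩ := y
  have : Nonempty (U.1 i) := ⟨m⟩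
  refine ⟨((Topology.IsOpenEmbedding.sigmaMk (σ := fun i : C => U.1 i)).toOpenPartialHomeomorph
    (Sigma.mk i)).symm.trans
      ((U.1 i).isOpen.isOpenEmbedding_subtypeVal.toOpenPartialHomeomorph Subtype.val), ?_, ?_⟩
  · simp
  · intro y hy
    have hy' : y ∈ range (Sigma.mk (β := fun i : C => U.1 i) i) := by simpa using hy
    obtain ⟨m', rfl⟩ := hy'
    have := Topology.IsOpenEmbedding.toOpenPartialHomeomorph_left_inv
      (Sigma.mk (β := fun i : C => U.1 i) i)
      (Topology.IsOpenEmbedding.sigmaMk (σ := fun i : C => U.1 i)) (x := m')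
    exact congrArg Subtype.val this.symm

section

variable {U C}

/-- The member of the cover containing a point of the disjoint union. -/
def index (y : U.Total C) : M := y.1

theorem totalProj_mem_index (y : U.Total C) : U.totalProj C y ∈ U.1 (index y) := y.2.2

/-- The index is locally constant on the disjoint union. Functions chosen separately for each tuple
of indices are thus smooth as soon as each one is. -/
theorem isOpen_setOf_index_eq (i : M) : IsOpen {y : U.Total C | index y = i} := by
  by_cases hi : i ∈ C
  · have h : {y : U.Total C | index y = i} = range (Sigma.mk ⟨i, hi⟩) := by
      ext ⟨j, m⟩
      constructor
      · intro h
        obtain rfl : j = ⟨i, hi⟩ := Subtype.ext h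
        exact ⟨m, rfl⟩
      · rintro ⟨m', h⟩
        rw [← h]
        rfl
    rw [h]
    exact isOpen_range_sigmaMk
  · convert isOpen_empty
    ext y
    exact ⟨fun h => hi (h ▸ y.1.2), fun h => h.elim⟩

end

variable [T2Space M] [SecondCountableTopology M]

variable (n) in
/-- The disjoint union of countably many open sets covering `M`, as a surjective submersion. -/
def submersion (hC : C.Countable) (hU : ∀ m, ∃ i ∈ C, m ∈ U.1 i) : SurjSubmersion n M :=
  letI := (U.isLocalHomeomorph_totalProj C).comapChartedSpace (EuclideanSpace ℝ (Fin n))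
  haveI := (U.isLocalHomeomorph_totalProj C).isManifold (E := EuclideanSpace ℝ (Fin n))
  -- Countability of the index set is what makes the disjoint union second countable. A union over
  -- all points of `M` would not do in general.
  haveI : Countable C := hC.to_subtype
  { E := EuclideanSpace ℝ (Fin n)
    Y := U.Total C
    proj := U.totalProj C
    isSubmersion := (U.isLocalHomeomorph_totalProj C).isSubmersion
    surjective := fun m => by
      obtain ⟨i, hi, hm⟩ := hU m
      exact ⟨⟨⟨i, hi⟩, m, hm⟩, rfl⟩ }

variable {U C}

variable (hC : C.Countable) (hU : ∀ m, ∃ i ∈ C, m ∈ U.1 i)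

/-- The inclusion of the `i`-th summand, extended off `U i` by arbitrary preimages. Its index on `U
i` is recorded so that the cocycle can be evaluated on it. -/
theorem exists_section {i : M} (hi : i ∈ C) : ∃ s : M → (U.submersion n C hC hU).Y,
    (∀ m, (U.submersion n C hC hU).proj (s m) = m) ∧
      ContMDiffOn (𝓡 n) 𝓘(ℝ, (U.submersion n C hC hU).E) ∞ s (U.1 i) ∧
      ∀ m ∈ U.1 i, index (U := U) (C := C) (s m) = i := by
  classical
  have hr : ∀ m, ∃ y : U.Total C, U.totalProj C y = m := (U.submersion n C hC hU).surjective
  choose r hr using hr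
  let s : M → U.Total C := fun m => if h : m ∈ U.1 i then ⟨⟨i, hi⟩, m, h⟩ else r m
  have hs : ∀ m (h : m ∈ U.1 i), s m = ⟨⟨i, hi⟩, m, h⟩ := fun m h => dif_pos h
  have hp : ∀ m, U.totalProj C (s m) = m := by
    intro m
    by_cases h : m ∈ U.1 i
    · rw [hs m h]
      rfl
    · rw [show s m = r m from dif_neg h]
      exact hr m
  refine ⟨s, hp, ?_, fun m h => congrArg (fun y : U.Total C => (y.1 : M)) (hs m h)⟩
  refine (U.isLocalHomeomorph_totalProj C).contMDiffOn_of_comp (E := EuclideanSpace ℝ (Fin n))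
    (U.1 i).isOpen ?_ ?_
  · rw [continuousOn_iff_continuous_domRestrict]
    refine (continuous_sigmaMk (σ := fun i : C => U.1 i) (i := ⟨i, hi⟩)).congr fun m => ?_
    exact (hs m m.2).symm
  · exact contMDiffOn_id.congr fun m _ => hp m

end Cech.PointedCover

variable [T2Space M] [SecondCountableTopology M]

-- Over the disjoint union of countably many members, `exp(2πiθ)` is an associative multiplication
-- on the trivial bundle, since `δθ` is integral. The tautological sections with `σ = 1` give back
-- `θ`, reindexed.
open Cech.PointedCover in
theorem BundleGerbe.exists_isDDClass_of_represents {U : Cech.PointedCover M}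
    {θ : M → M → M → M → ℝ}
    (hθ : ∀ x y z, ContMDiffOn (𝓡 n) 𝓘(ℝ) ∞ (θ x y z) (U.1 x ∩ U.1 y ∩ U.1 z)) {c : Cech.H M 3}
    (h : Cech.Represents U (Cech.delta₂ θ) c) : ∃ G : BundleGerbe n M, G.IsDDClass c := by
  obtain ⟨C, hC, hU⟩ := TopologicalSpace.countable_cover_nhds
    (fun x => (U.1 x).isOpen.mem_nhds (U.2 x))
  replace hU : ∀ m, ∃ i ∈ C, m ∈ U.1 i := fun m => by
    simpa using (hU.symm ▸ mem_univ m : m ∈ ⋃ x ∈ C, (U.1 x : Set M))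
  let S := U.submersion n C hC hU
  let I : S.Y → M := index (U := U) (C := C)
  have hI : ∀ i, IsOpen {y | I y = i} := isOpen_setOf_index_eq
  -- The base point is read off from `y₁`. On `Y^[3]` the three images agree, which is all that
  -- smoothness and the cocycle identity need.
  let g : S.Y → S.Y → S.Y → Circle := fun y₁ y₂ y₃ => Circle.exp (2 * Real.pi *
    θ (I y₁) (I y₂) (I y₃) (S.proj y₁))
  have hmem : ∀ y : S.Y, S.proj y ∈ U.1 (I y) := totalProj_mem_index
  have hge : ∀ x y z, ContMDiffOn (𝓡 n) (𝓡 1) ∞ (fun m => Circle.exp (2 * Real.pi * θ x y z m))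
      (U.1 x ∩ U.1 y ∩ U.1 z) := fun x y z =>
    contMDiff_circleExp.comp_contMDiffOn ((contDiff_const.mul contDiff_id :
      ContDiff ℝ ∞ fun t : ℝ => 2 * Real.pi * t).contMDiff.comp_contMDiffOn (hθ x y z))
  have hg : ContMDiff 𝓘(ℝ, S.cube.E) (𝓡 1) ∞
      fun b : S.cube.Y => g (S.fst S.sq b) (S.p₁ (S.snd S.sq b)) (S.p₂ (S.snd S.sq b)) := by
    intro b
    have h1 := S.contMDiff_fst S.sq
    have h2 := S.contMDiff_p₁.comp (S.contMDiff_snd S.sq)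
    have h3 := S.contMDiff_p₂.comp (S.contMDiff_snd S.sq)
    have o := (((hI (I (S.fst S.sq b))).preimage h1.continuous).inter
      ((hI (I (S.p₁ (S.snd S.sq b)))).preimage h2.continuous)).inter
      ((hI (I (S.p₂ (S.snd S.sq b)))).preimage h3.continuous)
    refine ContMDiffOn.contMDiffAt ?_ (o.mem_nhds ⟨⟨rfl, rfl⟩, rfl⟩)
    refine ((hge (I (S.fst S.sq b)) (I (S.p₁ (S.snd S.sq b)))
      (I (S.p₂ (S.snd S.sq b)))).comp (S.contMDiff_proj.comp h1).contMDiffOn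
        fun q hq => ?_).congr fun q hq => ?_
    · obtain ⟨⟨e1, e2⟩, e3⟩ := hq
      have e1' : I (S.fst S.sq q) = I (S.fst S.sq b) := e1
      have e2' : I (S.p₁ (S.snd S.sq q)) = I (S.p₁ (S.snd S.sq b)) := e2
      have e3' : I (S.p₂ (S.snd S.sq q)) = I (S.p₂ (S.snd S.sq b)) := e3
      rw [← e1', ← e2', ← e3']
      refine ⟨⟨hmem _, ?_⟩, ?_⟩
      · exact (congrArg (· ∈ U.1 _) (S.proj_cube q)).mpr (hmem (S.p₁ (S.snd S.sq q)))
      · exact (congrArg (· ∈ U.1 _) ((S.proj_cube q).trans (S.proj_p₁ _))).mpr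
          (hmem (S.p₂ (S.snd S.sq q)))
    · obtain ⟨⟨e1, e2⟩, e3⟩ := hq
      have e1' : I (S.fst S.sq q) = I (S.fst S.sq b) := e1
      have e2' : I (S.p₁ (S.snd S.sq q)) = I (S.p₁ (S.snd S.sq b)) := e2
      have e3' : I (S.p₂ (S.snd S.sq q)) = I (S.p₂ (S.snd S.sq b)) := e3
      simp only [g, e1', e2', e3']
      rfl
  have hgc : ∀ y₁ y₂ y₃ y₄, S.proj y₁ = S.proj y₂ → S.proj y₂ = S.proj y₃ →
      S.proj y₃ = S.proj y₄ → g y₁ y₂ y₃ * g y₁ y₃ y₄ = g y₂ y₃ y₄ * g y₁ y₂ y₄ := by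
    intro y₁ y₂ y₃ y₄ h₁₂ h₂₃ h₃₄
    obtain ⟨k, hk, -⟩ := h
    have e := hk (I y₁) (I y₂) (I y₃) (I y₄) (S.proj y₁)
      (hmem y₁) (h₁₂ ▸ hmem y₂) (h₁₂ ▸ h₂₃ ▸ hmem y₃) (h₁₂ ▸ h₂₃ ▸ h₃₄ ▸ hmem y₄)
    simp only [Cech.delta₂] at e
    simp only [g]
    rw [← h₁₂, ← Circle.exp_add, ← Circle.exp_add, ← mul_one (Circle.exp (_ + _)),
      ← GerbeOver.circleExp_int, ← Circle.exp_add]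
    congr 1
    rw [e]
    ring
  have hU' := hU
  -- Each point of `M` is assigned a member of the countable subfamily containing it. The pointed
  -- cover `x ↦ U (ι x)` refines `U` along `ι`, so `Represents.comp` identifies the class at the
  -- end.
  choose ι hιC hι using hU'
  have hsec : ∀ x, ∃ s : M → S.Y, (∀ m, S.proj (s m) = m) ∧
      ContMDiffOn (𝓡 n) 𝓘(ℝ, S.E) ∞ s (U.1 (ι x)) ∧ ∀ m ∈ U.1 (ι x), I (s m) = ι x :=
    fun x => exists_section (n := n) hC hU (hιC x)
  choose s hs hss hsi using hsec
  let D : GerbeOver.PointedData (GerbeOver.ofCocycle S g hg hgc) :=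
    { U := ⟨fun x => U.1 (ι x), hι⟩
      s := s
      proj_s := hs
      smooth_s := hss
      σ := fun x y m => (.of 1 : TrivialFib)
      smooth_σ := fun x y => U1Bundle.trivial_smoothAlong contMDiffOn_const
      θ := fun x y z => θ (ι x) (ι y) (ι z)
      smooth_θ := fun x y z => hθ _ _ _
      mul_σ := fun x y z m hx hy hz => by
        refine congrArg TrivialFib.of (congrArg₂ (· * ·) ?_ (mul_one 1))
        change Circle.exp (2 * Real.pi * θ (I (s x m)) (I (s y m))
          (I (s z m)) (S.proj (s x m))) = _
        rw [hsi x m hx, hsi y m hy, hsi z m hz]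
        exact congrArg (fun m => Circle.exp (2 * Real.pi * θ (ι x) (ι y) (ι z) m)) (hs x m) }
  refine ⟨⟨S, GerbeOver.ofCocycle S g hg hgc⟩, GerbeOver.PointedData.isDDClass D ?_⟩
  exact h.comp ι fun x => le_rfl

/-- An integer cocycle, viewed as a smooth real one, is `δθ` by the partition of unity argument. The
gerbe built from `exp(2πiθ)` then has the given class. -/
theorem BundleGerbe.exists_isDDClass (c : Cech.H M 3) :
    ∃ G : BundleGerbe n M, G.IsDDClass c := by
  obtain ⟨U, k, rfl⟩ := Cech.classOf_surjective c
  have hsub : ∀ x y z w m, m ∈ (U.1 x ∩ U.1 y ∩ U.1 z ∩ U.1 w : Set M) →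
      m ∈ Cech.inter U ![x, y, z, w] := fun x y z w m hm =>
    Cech.mem_inter₄.2 ⟨hm.1.1.1, hm.1.1.2, hm.1.2, hm.2⟩
  obtain ⟨θ, hθ, hd⟩ := Cech.exists_smooth_primitive₃ (n := n) U
    (fun x y z w m => (Cech.total k.1 ![x, y, z, w] m : ℝ))
    (fun x y z w => contMDiffOn_intCast ((((U.1 x).isOpen.inter (U.1 y).isOpen).inter
      (U.1 z).isOpen).inter (U.1 w).isOpen) ((Cech.continuousOn_total k.1 _).mono (hsub x y z w)))
    (fun x₀ x₁ x₂ x₃ x₄ m h0 h1 h2 h3 h4 => by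
      have := Cech.mem_cocycles₃.1 k.2 x₀ x₁ x₂ x₃ x₄ m
        (Cech.mem_inter.2 fun j => by fin_cases j <;> assumption)
      simp only [Cech.delta₃] at this ⊢
      exact_mod_cast this)
  exact exists_isDDClass_of_represents hθ
    ⟨k, fun x₀ x₁ x₂ x₃ m h0 h1 h2 h3 => (hd x₀ x₁ x₂ x₃ m h0 h1 h2 h3).symm, rfl⟩

end

end

/-! ### Well-definedness and classification -/

namespace BundleGerbe

variable {n : ℕ} {M : Type u} [TopologicalSpace M]
  [ChartedSpace (EuclideanSpace ℝ (Fin n)) M] [IsManifold (𝓡 n) ∞ M] [T2Space M]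
  [SecondCountableTopology M]

theorem isDDClass_DD (G : BundleGerbe n M) : G.IsDDClass G.DD := by
  obtain ⟨D⟩ := GerbeOver.exists_pointedData G.gerbe
  obtain ⟨c, hc⟩ := D.exists_represents
  exact Classical.epsilon_spec ⟨c, D.isDDClass hc⟩

/-- Stated for arbitrary classes rather than for `DD`, so that it also yields uniqueness of the
class. -/
theorem stablyIsomorphic_iff_of_isDDClass {G H : BundleGerbe n M} {b c : Cech.H M 3}
    (hG : G.IsDDClass b) (hH : H.IsDDClass c) : G.StablyIsomorphic H ↔ b = c := by
  have h := hG.tensor_dual hH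
  constructor
  · exact fun hs => (sub_eq_zero.1 (h.eq_zero hs)).symm
  · rintro rfl
    rw [sub_self] at h
    exact h.isTrivial

theorem isDDClass_iff (G : BundleGerbe n M) (c : Cech.H M 3) : G.IsDDClass c ↔ c = G.DD := by
  constructor
  · intro hc
    -- The criterion with `c` on both sides shows that `G` is stably isomorphic to itself. Applied
    -- again with `c` and `G.DD`, it forces the two classes to agree.
    exact (stablyIsomorphic_iff_of_isDDClass hc G.isDDClass_DD).1
      ((stablyIsomorphic_iff_of_isDDClass hc hc).2 rfl)
  · rintro rfl
    exact G.isDDClass_DD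

theorem stablyIsomorphic_iff (G H : BundleGerbe n M) : G.StablyIsomorphic H ↔ G.DD = H.DD :=
  stablyIsomorphic_iff_of_isDDClass G.isDDClass_DD H.isDDClass_DD

end BundleGerbe

end

theorem mainTheorem2 {n : ℕ} {M : Type u} [TopologicalSpace M]
    [ChartedSpace (EuclideanSpace ℝ (Fin n)) M] [IsManifold (𝓡 n) ∞ M]
    [T2Space M] [SecondCountableTopology M] :
    (∀ (G : BundleGerbe n M) (c : Cech.H M 3), BundleGerbe.IsDDClass G c ↔ c = G.DD) ∧
    (∀ G H : BundleGerbe n M, BundleGerbe.StablyIsomorphic G H ↔ G.DD = H.DD) ∧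
    Equivalence (BundleGerbe.StablyIsomorphic (n := n) (M := M)) ∧
    ∃ Φ : Quot (BundleGerbe.StablyIsomorphic (n := n) (M := M)) → Cech.H M 3,
      (∀ G : BundleGerbe n M, Φ (Quot.mk _ G) = G.DD) ∧ Function.Bijective Φ := by
  refine ⟨BundleGerbe.isDDClass_iff, BundleGerbe.stablyIsomorphic_iff, ⟨fun G => ?_, fun h => ?_,
    fun h h' => ?_⟩, Quot.lift BundleGerbe.DD fun G H h => (G.stablyIsomorphic_iff H).1 h,
    fun G => rfl, ?_, fun c => ?_⟩
  · exact (G.stablyIsomorphic_iff G).2 rfl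
  · rw [BundleGerbe.stablyIsomorphic_iff] at h ⊢
    exact h.symm
  · rw [BundleGerbe.stablyIsomorphic_iff] at h h' ⊢
    exact h.trans h'
  · rintro ⟨G⟩ ⟨H⟩ h
    exact Quot.sound ((G.stablyIsomorphic_iff H).2 h)
  · obtain ⟨G, hG⟩ := BundleGerbe.exists_isDDClass (n := n) c
    exact ⟨Quot.mk _ G, ((G.isDDClass_iff c).1 hG).symm⟩
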